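/- Let $k$ be a field containing a primitive $4$th root of unity $\mathfrak q$ (so $\mathrm{char}\,k\neq 2$). Quasi-Hopf algebras $(H,\Delta,\varepsilon,\Phi,S,\alpha,\beta)$ are over $k$; write $\Phi=X^1\otimes X^2\otimes X^3$, $\Phi^{-1}=x^1\otimes x^2\otimes x^3=y^1\otimes y^2\otimes y^3$, $\Delta(h)=h_1\otimes h_2$ (summation understood). Let $H_{\mathfrak q}(8)$ be the $k$-algebra generated by $g,x$ with $g^2=1$, $x^4=0$, $gx=-xg$, and let $H(32)$ be the $k$-algebra generated by $g,x,y$ with $g^2=1$, $x^4=y^4=0$, $gx=-xg$, $gy=-yg$, $yx=\mathfrak q\,xy$. With $p_\pm=\frac12(1\pm g)$ they carry the structure $$\Delta(g)=g\otimes g,\quad \Delta(x)=x\otimes(p_++\mathfrak q p_-)+1\otimes p_+x+g\otimes p_-x,\quad \Delta(y)=y\otimes(p_+-\mathfrak q p_-)+1\otimes p_+y+g\otimes p_-y,$$ $$\varepsilon(g)=1,\ \varepsilon(x)=\varepsilon(y)=0,\quad S(g)=g,\ S(x)=-x(p_++\mathfrak q p_-),\ S(y)=-y(p_+-\mathfrak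 q p_-),$$ $$\Phi=1-2p_-\otimes p_-\otimes p_-,\quad \alpha=g,\ \beta=1$$ (without $y$ in the case of $H_{\mathfrak q}(8)$). Let $H_{\mathfrak q}(16)=k[C_2]\otimes H_{\mathfrak q}(8)$ be the tensor product with the group Hopf algebra of the cyclic group of order $2$; let $g_2$ be the image of the generator of $C_2$ and $g_1,x$ the images of $g,x\in H_{\mathfrak q}(8)$. Let $H_4$ be the Sweedler Hopf algebra generated by $g,x$ with $g^2=1$, $x^2=0$, $gx=-xg$, $\Delta(g)=g\otimes g$, $\Delta(x)=g\otimes x+x\otimes 1$, $\varepsilon(g)=1$, $\varepsilon(x)=0$, $S(g)=g$, $S(x)=-gx$. For a quasi-Hopf algebra $H$, call a pair $(\sigma,v)$, with $\sigma:H\to k$ an algebra morphism and $v\in H$, admissible if $$\sigma(v)=-1,\quad \varepsilon(v)=1,\quad \Delta(v)=\sigma(y^1x^3X^2)\,x^1X^1vy^2\otimes x^2vX^3y^3,\quad \sigma(h_2)h_1v=\sigma(h_1)vh_2\ \text{ for all } h\in H.$$ Let $H(\theta)_{\sigma,v}$ be the algebra generated by $H$ and $\theta$ with relations $\theta^2=0$,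 $h\theta=\sigma(h_1)\theta h_2$ ($h\in H$), with structure maps extending those of $H$ by $\varepsilon(\theta)=0$, $$\Delta(\theta)=\sigma(X^2x^1)vX^1x^2\otimes\theta X^3x^3+\sigma(x^1)\theta x^2\otimes x^3,\quad S(\theta)=-\sigma(X^2x^1_2)S(X^1x^1_1v)\alpha\theta X^3x^2\beta S(x^3).$$ Then $H_{\mathfrak q}(8)$, $H(32)$ and $H_{\mathfrak q}(16)$ are quasi-Hopf algebras, and the following hold. (1) There is an algebra morphism $\sigma_0:H_{\mathfrak q}(16)\to k$ with $\sigma_0(g_1)=1$, $\sigma_0(g_2)=-1$, $\sigma_0(x)=0$, and a pair $(\sigma,v)$ is admissible for $H_{\mathfrak q}(16)$ if and only if $\sigma=\sigma_0$ and $v=g_2$. (2) $H_{\mathfrak q}(16)(\theta)_{\sigma_0,g_2}$ is a $32$-dimensional quasi-Hopf algebra, isomorphic as a quasi-Hopf algebra to $H_4\otimes H_{\mathfrak q}(8)$. (3) For $H\in\{H_{\mathfrak q}(8),H(32)\}$, the group Hopf algebra $k[C_2]$ with the trivial $H$-action and trivial $H$-coaction is a Hopf algebra in the category ${}^H_H\mathcal{YD}$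 of left Yetter-Drinfeld modules over $H$, and every $2$-dimensional Hopf algebra in ${}^H_H\mathcal{YD}$ is isomorphic to it. -/

import Mathlib

open scoped TensorProduct

universe u v w

namespace QH

noncomputable section

/-! ## Quasi-Hopf algebras -/

/-- The structure maps of a quasi-Hopf algebra on the algebra `H`, without the axioms: the
comultiplication, the counit, the (invertible) reassociator, the antipode and the distinguished
elements `α`, `β`. -/
structure QuasiHopfData (k : Type u) (H : Type v) [Field k] [Ring H] [Algebra k H] where
  comul : H →ₗ[k] H ⊗[k] H
  counit : H →ₗ[k] k
  reassoc : (H ⊗[k] (H ⊗[k] H))ˣ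
  antipode : H →ₗ[k] H
  alpha : H
  beta : H

namespace QuasiHopfData

variable {k : Type u} {H : Type v} [Field k] [Ring H] [Algebra k H]

/-- The comultiplication and the counit are morphisms of unital algebras. -/
class IsMult (D : QuasiHopfData k H) : Prop where
  comul_one : D.comul 1 = 1
  comul_mul : ∀ a b : H, D.comul (a * b) = D.comul a * D.comul b
  counit_one : D.counit 1 = 1
  counit_mul : ∀ a b : H, D.counit (a * b) = D.counit a * D.counit b

variable (D : QuasiHopfData k H)

/-- The reassociator `Φ = X¹ ⊗ X² ⊗ X³`. -/
def Phi : H ⊗[k] (H ⊗[k] H) := (D.reassoc : H ⊗[k] (H ⊗[k] H))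

/-- The inverse `Φ⁻¹ = x¹ ⊗ x² ⊗ x³`. -/
def PhiInv : H ⊗[k] (H ⊗[k] H) := ((D.reassoc⁻¹ : (H ⊗[k] (H ⊗[k] H))ˣ) : H ⊗[k] (H ⊗[k] H))

/-- `(Δ ⊗ Id) Δ(h)`, in `H ⊗ (H ⊗ H)`. -/
def comulLeft : H →ₗ[k] H ⊗[k] (H ⊗[k] H) :=
  (TensorProduct.assoc k H H H).toLinearMap ∘ₗ D.comul.rTensor H ∘ₗ D.comul

/-- `(Id ⊗ Δ) Δ(h)`, in `H ⊗ (H ⊗ H)`. -/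
def comulRight : H →ₗ[k] H ⊗[k] (H ⊗[k] H) := D.comul.lTensor H ∘ₗ D.comul

/-- The axioms of a quasi-Hopf algebra. -/
structure IsQuasiHopf : Prop extends D.IsMult where
  /-- `(Id ⊗ Δ) Δ(h) = Φ (Δ ⊗ Id) Δ(h) Φ⁻¹`. -/
  quasi_coassoc : ∀ h : H, D.comulRight h = D.Phi * D.comulLeft h * D.PhiInv
  /-- `(Id ⊗ ε) Δ(h) = h`. -/
  lTensor_counit : ∀ h : H, TensorProduct.rid k H (D.counit.lTensor H (D.comul h)) = h
  /-- `(ε ⊗ Id) Δ(h) = h`. -/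
  rTensor_counit : ∀ h : H, TensorProduct.lid k H (D.counit.rTensor H (D.comul h)) = h
  /-- `(Id ⊗ ε ⊗ Id) Φ = 1 ⊗ 1`. -/
  normalized :
    ((TensorProduct.lid k H).toLinearMap ∘ₗ D.counit.rTensor H).lTensor H D.Phi = 1
  /-- `(1 ⊗ Φ) (Id ⊗ Δ ⊗ Id)(Φ) (Φ ⊗ 1) = (Id ⊗ Id ⊗ Δ)(Φ) (Δ ⊗ Id ⊗ Id)(Φ)`,
  in `H ⊗ (H ⊗ (H ⊗ H))`. -/
  pentagon :
    ((1 : H) ⊗ₜ[k] D.Phi)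
        * ((TensorProduct.assoc k H H H).toLinearMap ∘ₗ D.comul.rTensor H).lTensor H D.Phi
        * (TensorProduct.assoc k H H H).toLinearMap.lTensor H
            (TensorProduct.assoc k H (H ⊗[k] H) H (D.Phi ⊗ₜ[k] (1 : H)))
      = (D.comul.lTensor H).lTensor H D.Phi
        * TensorProduct.assoc k H H (H ⊗[k] H) (D.comul.rTensor (H ⊗[k] H) D.Phi)
  antipode_one : D.antipode 1 = 1
  antipode_mul : ∀ a b : H, D.antipode (a * b) = D.antipode b * D.antipode a
  /-- `S(h₁) α h₂ = ε(h) α`. -/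
  antipode_alpha : ∀ h : H,
    LinearMap.mul' k H (TensorProduct.map D.antipode (LinearMap.mulLeft k D.alpha) (D.comul h))
      = D.counit h • D.alpha
  /-- `h₁ β S(h₂) = ε(h) β`. -/
  antipode_beta : ∀ h : H,
    LinearMap.mul' k H
        (TensorProduct.map LinearMap.id (LinearMap.mulLeft k D.beta ∘ₗ D.antipode) (D.comul h))
      = D.counit h • D.beta
  /-- `X¹ β S(X²) α X³ = 1`. -/
  reassoc_antipode :
    LinearMap.mul' k H (TensorProduct.map LinearMap.id
      (LinearMap.mul' k H ∘ₗ TensorProduct.map (LinearMap.mulLeft k D.beta ∘ₗ D.antipode)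
        (LinearMap.mulLeft k D.alpha)) D.Phi) = 1
  /-- `S(x¹) α x² β S(x³) = 1`. -/
  reassocInv_antipode :
    LinearMap.mul' k H (TensorProduct.map D.antipode
      (LinearMap.mul' k H ∘ₗ TensorProduct.map (LinearMap.mulLeft k D.alpha)
        (LinearMap.mulLeft k D.beta ∘ₗ D.antipode)) D.PhiInv) = 1

/-- The quasi-Hopf structure maps of an ordinary Hopf algebra: `Φ = 1`, `α = β = 1`. -/
def ofHopf (k : Type u) (H : Type v) [Field k] [Ring H] [HopfAlgebra k H] :
    QuasiHopfData k H where
  comul := Coalgebra.comul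
  counit := Coalgebra.counit
  reassoc := 1
  antipode := HopfAlgebra.antipode k
  alpha := 1
  beta := 1

instance (k : Type u) (H : Type v) [Field k] [Ring H] [HopfAlgebra k H] :
    (ofHopf k H).IsMult where
  comul_one := Bialgebra.comul_one
  comul_mul := Bialgebra.comul_mul
  counit_one := Bialgebra.counit_one
  counit_mul := Bialgebra.counit_mul

end QuasiHopfData

section Tensor

variable {k : Type u} {A : Type v} {B : Type w} [Field k] [Ring A] [Algebra k A] [Ring B]
  [Algebra k B]

/-- The tensor product of two quasi-Hopf algebras (componentwise structure). -/
def QuasiHopfData.tensor (D : QuasiHopfData k A) (E : QuasiHopfData k B) :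
    QuasiHopfData k (A ⊗[k] B) where
  comul := (TensorProduct.tensorTensorTensorComm k A A B B).toLinearMap ∘ₗ
    TensorProduct.map D.comul E.comul
  counit := (TensorProduct.lid k k).toLinearMap ∘ₗ TensorProduct.map D.counit E.counit
  reassoc :=
    let i : A →ₐ[k] A ⊗[k] B := Algebra.TensorProduct.includeLeft
    let j : B →ₐ[k] A ⊗[k] B := Algebra.TensorProduct.includeRight
    Units.map
        (Algebra.TensorProduct.map i (Algebra.TensorProduct.map i i)).toRingHom.toMonoidHom
        D.reassoc
      * Units.map
        (Algebra.TensorProduct.map j (Algebra.TensorProduct.map j j)).toRingHom.toMonoidHom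
        E.reassoc
  antipode := TensorProduct.map D.antipode E.antipode
  alpha := D.alpha ⊗ₜ[k] E.alpha
  beta := D.beta ⊗ₜ[k] E.beta

instance (D : QuasiHopfData k A) (E : QuasiHopfData k B) [hD : D.IsMult] [hE : E.IsMult] :
    (D.tensor E).IsMult where
  comul_one := by
    simp [QuasiHopfData.tensor, Algebra.TensorProduct.one_def, hD.comul_one, hE.comul_one]
  comul_mul a b := by
    have key : ∀ (x y : A ⊗[k] A) (z t : B ⊗[k] B),
        TensorProduct.tensorTensorTensorComm k A A B B ((x * y) ⊗ₜ[k] (z * t))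
          = TensorProduct.tensorTensorTensorComm k A A B B (x ⊗ₜ[k] z)
            * TensorProduct.tensorTensorTensorComm k A A B B (y ⊗ₜ[k] t) := by
      intro x y z t
      have := map_mul (Algebra.TensorProduct.tensorTensorTensorComm k k k k A A B B)
        (x ⊗ₜ[k] z) (y ⊗ₜ[k] t)
      rw [Algebra.TensorProduct.tmul_mul_tmul] at this
      exact this
    induction a using TensorProduct.induction_on with
    | zero => simp
    | add a a' ha ha' => simp only [add_mul, map_add, ha, ha']
    | tmul a a' =>
      induction b using TensorProduct.induction_on with
      | zero => simp
      | add b b' hb hb' => simp only [mul_add, map_add, hb, hb']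
      | tmul b b' =>
        simp only [QuasiHopfData.tensor, Algebra.TensorProduct.tmul_mul_tmul,
          LinearMap.comp_apply, TensorProduct.map_tmul, hD.comul_mul, hE.comul_mul,
          LinearEquiv.coe_coe, key]
  counit_one := by
    simp [QuasiHopfData.tensor, Algebra.TensorProduct.one_def, hD.counit_one, hE.counit_one]
  counit_mul a b := by
    induction a using TensorProduct.induction_on with
    | zero => simp
    | add a a' ha ha' => simp only [add_mul, map_add, ha, ha']
    | tmul a a' =>
      induction b using TensorProduct.induction_on with
      | zero => simp
      | add b b' hb hb' => simp only [mul_add, map_add, hb, hb']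
      | tmul b b' =>
        simp only [QuasiHopfData.tensor, Algebra.TensorProduct.tmul_mul_tmul,
          LinearMap.comp_apply, TensorProduct.map_tmul, hD.counit_mul, hE.counit_mul,
          LinearEquiv.coe_coe, TensorProduct.lid_tmul, smul_eq_mul]
        ring

/-- An isomorphism of quasi-Hopf algebras: an isomorphism of algebras that respects the
comultiplications, the counits, the reassociators, the antipodes and the distinguished
elements. -/
structure QuasiHopfEquiv (D : QuasiHopfData k A) (E : QuasiHopfData k B) extends A ≃ₐ[k] B where
  map_comul : ∀ a : A, E.comul (toAlgEquiv a)
    = TensorProduct.map toAlgEquiv.toLinearMap toAlgEquiv.toLinearMap (D.comul a)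
  map_counit : ∀ a : A, E.counit (toAlgEquiv a) = D.counit a
  map_reassoc : E.Phi = TensorProduct.map toAlgEquiv.toLinearMap
    (TensorProduct.map toAlgEquiv.toLinearMap toAlgEquiv.toLinearMap) D.Phi
  map_antipode : ∀ a : A, E.antipode (toAlgEquiv a) = toAlgEquiv (D.antipode a)
  map_alpha : toAlgEquiv D.alpha = E.alpha
  map_beta : toAlgEquiv D.beta = E.beta

end Tensor

/-! ## Pairs `(σ, v)` and the quasi-Hopf algebra `H(θ)` -/

namespace QuasiHopfData

variable {k : Type u} {H : Type v} [Field k] [Ring H] [Algebra k H]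
variable (D : QuasiHopfData k H) (σ : H →ₐ[k] k)

/-- `a ⊗ t ↦ σ(a) t`. -/
def contract₁ : H ⊗[k] (H ⊗[k] H) →ₗ[k] H ⊗[k] H :=
  (TensorProduct.lid k (H ⊗[k] H)).toLinearMap ∘ₗ σ.toLinearMap.rTensor (H ⊗[k] H)

/-- `a ⊗ b ⊗ c ↦ σ(b) a ⊗ c`. -/
def contract₂ : H ⊗[k] (H ⊗[k] H) →ₗ[k] H ⊗[k] H :=
  ((TensorProduct.lid k H).toLinearMap ∘ₗ σ.toLinearMap.rTensor H).lTensor H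

/-- `a ⊗ b ⊗ c ↦ σ(c) a ⊗ b`. -/
def contract₃ : H ⊗[k] (H ⊗[k] H) →ₗ[k] H ⊗[k] H :=
  ((TensorProduct.rid k H).toLinearMap ∘ₗ σ.toLinearMap.lTensor H).lTensor H

/-- `h ↦ σ(h₁) h₂`. -/
def hitL : H →ₗ[k] H :=
  (TensorProduct.lid k H).toLinearMap ∘ₗ σ.toLinearMap.rTensor H ∘ₗ D.comul

/-- `h ↦ σ(h₂) h₁`. -/
def hitR : H →ₗ[k] H :=
  (TensorProduct.rid k H).toLinearMap ∘ₗ σ.toLinearMap.lTensor H ∘ₗ D.comul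

/-- The conditions on a pair `(σ, v)`:
`σ(v) = -1`, `ε(v) = 1`, `Δ(v) = σ(y¹ x³ X²) x¹ X¹ v y² ⊗ x² v X³ y³` and
`σ(h₂) h₁ v = σ(h₁) v h₂` for all `h`. -/
structure IsAdmissible (v : H) : Prop where
  apply_eq : σ v = -1
  counit_eq : D.counit v = 1
  comul_eq : D.comul v =
    contract₃ σ D.PhiInv * (1 ⊗ₜ[k] v) * contract₂ σ D.Phi * (v ⊗ₜ[k] 1) * contract₁ σ D.PhiInv
  commute : ∀ h : H, D.hitR σ h * v = v * D.hitL σ h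

variable [hD : D.IsMult]

/-- `h ↦ σ(h₁) h₂` as a morphism of algebras. -/
def hitLHom : H →ₐ[k] H :=
  AlgHom.ofLinearMap (D.hitL σ)
    (by simp [hitL, hD.comul_one, Algebra.TensorProduct.one_def])
    (by
      intro a b
      have key : ∀ x y : H ⊗[k] H,
          TensorProduct.lid k H (σ.toLinearMap.rTensor H (x * y))
            = TensorProduct.lid k H (σ.toLinearMap.rTensor H x)
              * TensorProduct.lid k H (σ.toLinearMap.rTensor H y) := by
        intro x y
        induction x using TensorProduct.induction_on with
        | zero => simp
        | add x x' hx hx' => simp only [add_mul, map_add, hx, hx']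
        | tmul x x' =>
          induction y using TensorProduct.induction_on with
          | zero => simp
          | add y y' hy hy' => simp only [mul_add, map_add, hy, hy']
          | tmul y y' =>
            simp only [Algebra.TensorProduct.tmul_mul_tmul, LinearMap.rTensor_tmul,
              AlgHom.toLinearMap_apply, map_mul, TensorProduct.lid_tmul, smul_mul_smul_comm]
      simp only [hitL, LinearMap.comp_apply, hD.comul_mul, LinearEquiv.coe_coe, key])

/-- `θ H`, i.e. `H` as a bimodule over itself, with the regular right action and the left action
twisted by `h ↦ σ(h₁) h₂`. -/
@[nolint unusedArguments]
def ThetaBimod (_D : QuasiHopfData k H) (_σ : H →ₐ[k] k) : Type v := H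

instance : AddCommGroup (ThetaBimod D σ) := inferInstanceAs (AddCommGroup H)
instance : Module k (ThetaBimod D σ) := inferInstanceAs (Module k H)
instance : Module Hᵐᵒᵖ (ThetaBimod D σ) := inferInstanceAs (Module Hᵐᵒᵖ H)
instance : Module H (ThetaBimod D σ) :=
  Module.compHom (R := H) H (D.hitLHom σ).toRingHom

theorem ThetaBimod.smul_def (h : H) (m : ThetaBimod D σ) :
    h • m = (D.hitLHom σ h * (show H from m) : H) := rfl

instance : SMulCommClass H Hᵐᵒᵖ (ThetaBimod D σ) where
  smul_comm a b m := by
    induction b using MulOpposite.rec' with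
    | h b => exact (mul_assoc (D.hitLHom σ a) (show H from m) b).symm

instance : IsScalarTower k H (ThetaBimod D σ) where
  smul_assoc c a m := by
    rw [ThetaBimod.smul_def, map_smul, smul_mul_assoc]
    rfl

instance : IsScalarTower k Hᵐᵒᵖ (ThetaBimod D σ) :=
  inferInstanceAs (IsScalarTower k Hᵐᵒᵖ H)

/-- The underlying algebra of `H(θ)`: the algebra generated by `H` and an element `θ` with
`θ² = 0` and `h θ = σ(h₁) θ h₂`. It is realised as the square-zero extension `H ⊕ θ H` of `H`;
`QH.QuasiHopfData.Theta.existsUnique_lift` is its universal property. -/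
abbrev Theta : Type v := TrivSqZeroExt H (ThetaBimod D σ)

namespace Theta

/-- The inclusion of `H` in `H(θ)`. -/
def incl : H →ₐ[k] Theta D σ := TrivSqZeroExt.inlAlgHom k H (ThetaBimod D σ)

/-- The generator `θ`. -/
def theta : Theta D σ := TrivSqZeroExt.inr (show ThetaBimod D σ from (1 : H))

/-- The first component `a` of `a + θ b`. -/
def fstPart : Theta D σ →ₗ[k] H where
  toFun z := z.fst
  map_add' _ _ := rfl
  map_smul' _ _ := rfl

/-- The second component `b` of `a + θ b`. -/
def sndPart : Theta D σ →ₗ[k] H where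
  toFun z := z.snd
  map_add' _ _ := rfl
  map_smul' _ _ := rfl

theorem inr_eq (b : H) :
    (TrivSqZeroExt.inr (show ThetaBimod D σ from b) : Theta D σ) = theta D σ * incl D σ b := by
  refine Eq.trans ?_ (TrivSqZeroExt.inr_mul_inl b (show ThetaBimod D σ from (1 : H))).symm
  congr 1
  exact (one_mul b).symm

theorem eq_fstPart_add (z : Theta D σ) :
    z = incl D σ (fstPart D σ z) + theta D σ * incl D σ (sndPart D σ z) := by
  rw [← inr_eq]
  exact (TrivSqZeroExt.inl_fst_add_inr_snd_eq z).symm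

theorem theta_mul_theta : theta D σ * theta D σ = 0 := TrivSqZeroExt.inr_mul_inr H _ _

theorem incl_mul_theta (h : H) :
    incl D σ h * theta D σ = theta D σ * incl D σ (D.hitL σ h) := by
  rw [← inr_eq]
  refine (TrivSqZeroExt.inl_mul_inr h (show ThetaBimod D σ from (1 : H))).trans ?_
  congr 1
  exact mul_one (D.hitL σ h)

/-- `H(θ)` is the algebra generated by `H` and `θ` with the relations `θ² = 0` and
`h θ = σ(h₁) θ h₂`. -/
theorem existsUnique_lift {R : Type w} [Ring R] [Algebra k R] (f : H →ₐ[k] R) (t : R)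
    (ht : t * t = 0) (hft : ∀ h, f h * t = t * f (D.hitL σ h)) :
    ∃! F : Theta D σ →ₐ[k] R, F.comp (incl D σ) = f ∧ F (theta D σ) = t := by
  let g : ThetaBimod D σ →ₗ[k] R := LinearMap.mulLeft k t ∘ₗ (f.toLinearMap : H →ₗ[k] R)
  have hg : ∀ x : H, g x = t * f x := fun _ => rfl
  refine ⟨TrivSqZeroExt.lift f g ?_ ?_ ?_, ⟨?_, ?_⟩, ?_⟩
  · intro (x : H) (y : H)
    change t * f x * (t * f y) = 0
    rw [mul_assoc, ← mul_assoc (f x), hft, mul_assoc, ← mul_assoc, ht, zero_mul]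
  · intro r (x : H)
    change t * f (D.hitL σ r * x) = f r * (t * f x)
    rw [map_mul, ← mul_assoc, ← mul_assoc, hft]
  · intro r (x : H)
    change t * f (x * r) = t * f x * f r
    rw [map_mul, mul_assoc]
  · exact TrivSqZeroExt.lift_comp_inlHom f g _ _ _
  · refine (TrivSqZeroExt.lift_apply_inr f g _ _ _ _).trans ((hg 1).trans ?_)
    rw [map_one, mul_one]
  · rintro F ⟨hF, hθ⟩
    have hF1 : ∀ h, F (incl D σ h) = f h := fun h => DFunLike.congr_fun hF h
    refine TrivSqZeroExt.algHom_ext' (AlgHom.ext fun z => ?_) (LinearMap.ext fun (z : H) => ?_)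
    · change F (incl D σ z) = f z + g 0
      rw [map_zero, add_zero, hF1]
    · change F (TrivSqZeroExt.inr z) = f 0 + g z
      rw [map_zero, zero_add, hg z]
      refine (congrArg F (inr_eq D σ z)).trans ?_
      rw [map_mul, hθ, hF1]

variable (v : H)

/-- `Δ(θ) = σ(X² x¹) v X¹ x² ⊗ θ X³ x³ + σ(x¹) θ x² ⊗ x³`. -/
def comulTheta : Theta D σ ⊗[k] Theta D σ :=
  (incl D σ v ⊗ₜ[k] theta D σ)
      * Algebra.TensorProduct.map (incl D σ) (incl D σ)
          (contract₂ σ D.Phi * contract₁ σ D.PhiInv)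
    + (theta D σ ⊗ₜ[k] 1)
      * Algebra.TensorProduct.map (incl D σ) (incl D σ) (contract₁ σ D.PhiInv)

/-- `σ(X² x¹₂) X¹ x¹₁ ⊗ X³ x² β S(x³)`. -/
def antipodeAux : H ⊗[k] H :=
  contract₂ σ D.Phi
    * TensorProduct.map (D.hitR σ)
        (LinearMap.mul' k H ∘ₗ (LinearMap.mulLeft k D.beta ∘ₗ D.antipode).lTensor H) D.PhiInv

/-- `S(θ) = -σ(X² x¹₂) S(X¹ x¹₁ v) α θ X³ x² β S(x³)`. -/
def antipodeTheta : Theta D σ :=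
  -LinearMap.mul' k (Theta D σ)
    (TensorProduct.map
      (LinearMap.mulRight k (theta D σ) ∘ₗ (incl D σ).toLinearMap
        ∘ₗ LinearMap.mulRight k D.alpha ∘ₗ D.antipode ∘ₗ LinearMap.mulRight k v)
      (incl D σ).toLinearMap (antipodeAux D σ))

end Theta

/-- The quasi-Hopf structure maps of `H(θ)` attached to the pair `(σ, v)`: they extend those
of `H`, `ε(θ) = 0`, and `Δ(θ)`, `S(θ)` are `Theta.comulTheta`, `Theta.antipodeTheta`. On a
general element `a + θ b` they are given by `Δ(a + θ b) = Δ(a) + Δ(θ) Δ(b)` and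
`S(a + θ b) = S(a) + S(b) S(θ)`. -/
def thetaData (v : H) : QuasiHopfData k (Theta D σ) where
  comul :=
    (Algebra.TensorProduct.map (Theta.incl D σ) (Theta.incl D σ)).toLinearMap
        ∘ₗ D.comul ∘ₗ Theta.fstPart D σ
      + LinearMap.mulLeft k (Theta.comulTheta D σ v)
        ∘ₗ (Algebra.TensorProduct.map (Theta.incl D σ) (Theta.incl D σ)).toLinearMap
        ∘ₗ D.comul ∘ₗ Theta.sndPart D σ
  counit := D.counit ∘ₗ Theta.fstPart D σ
  reassoc := Units.map
    (Algebra.TensorProduct.map (Theta.incl D σ)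
      (Algebra.TensorProduct.map (Theta.incl D σ) (Theta.incl D σ))).toRingHom.toMonoidHom
    D.reassoc
  antipode :=
    (Theta.incl D σ).toLinearMap ∘ₗ D.antipode ∘ₗ Theta.fstPart D σ
      + LinearMap.mulRight k (Theta.antipodeTheta D σ v)
        ∘ₗ (Theta.incl D σ).toLinearMap ∘ₗ D.antipode ∘ₗ Theta.sndPart D σ
  alpha := Theta.incl D σ D.alpha
  beta := Theta.incl D σ D.beta

end QuasiHopfData

/-! ## Yetter-Drinfeld modules and braided Hopf algebras -/

section YetterDrinfeld

variable {k : Type u} {H : Type v} [Field k] [Ring H] [Algebra k H]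

/-- A linear action `H → End(M)` and a linear coaction `M → H ⊗ M`, without axioms. -/
structure YDData (k : Type u) (H : Type v) (M : Type w) [Field k] [Ring H] [Algebra k H]
    [AddCommGroup M] [Module k M] where
  act : H →ₗ[k] M →ₗ[k] M
  coact : M →ₗ[k] H ⊗[k] M

namespace QuasiHopfData

variable (D : QuasiHopfData k H)
variable {M N P : Type*} [AddCommGroup M] [Module k M] [AddCommGroup N] [Module k N]
  [AddCommGroup P] [Module k P]

/-- The diagonal action `h · (m ⊗ n) = h₁ · m ⊗ h₂ · n`. -/
def tensorAct (ρM : H →ₗ[k] M →ₗ[k] M) (ρN : H →ₗ[k] N →ₗ[k] N) :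
    H →ₗ[k] (M ⊗[k] N) →ₗ[k] (M ⊗[k] N) :=
  TensorProduct.map₂ ρM ρN ∘ₗ D.comul

/-- The associativity constraint `(m ⊗ n) ⊗ p ↦ X¹ · m ⊗ (X² · n ⊗ X³ · p)`. -/
def assocMap (ρM : H →ₗ[k] M →ₗ[k] M) (ρN : H →ₗ[k] N →ₗ[k] N) (ρP : H →ₗ[k] P →ₗ[k] P) :
    (M ⊗[k] N) ⊗[k] P →ₗ[k] M ⊗[k] (N ⊗[k] P) :=
  TensorProduct.map₂ ρM (TensorProduct.map₂ ρN ρP) D.Phi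
    ∘ₗ (TensorProduct.assoc k M N P).toLinearMap

/-- The inverse constraint `m ⊗ (n ⊗ p) ↦ (x¹ · m ⊗ x² · n) ⊗ x³ · p`. -/
def assocInvMap (ρM : H →ₗ[k] M →ₗ[k] M) (ρN : H →ₗ[k] N →ₗ[k] N) (ρP : H →ₗ[k] P →ₗ[k] P) :
    M ⊗[k] (N ⊗[k] P) →ₗ[k] (M ⊗[k] N) ⊗[k] P :=
  (TensorProduct.assoc k M N P).symm.toLinearMap
    ∘ₗ TensorProduct.map₂ ρM (TensorProduct.map₂ ρN ρP) D.PhiInv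

/-- The regular left action of `H` on itself. -/
def regAct (k : Type u) (H : Type v) [Field k] [Ring H] [Algebra k H] : H →ₗ[k] H →ₗ[k] H :=
  LinearMap.mul k H

/-- The braiding `m ⊗ n ↦ m₍₋₁₎ · n ⊗ m₍₀₎`. -/
def braid (δM : M →ₗ[k] H ⊗[k] M) (ρN : H →ₗ[k] N →ₗ[k] N) : M ⊗[k] N →ₗ[k] N ⊗[k] M :=
  (TensorProduct.lift ρN).rTensor M ∘ₗ (TensorProduct.rightComm k H M N).toLinearMap
    ∘ₗ δM.rTensor N

/-- The axioms of a left Yetter-Drinfeld module over `H`. -/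
structure IsYD (V : YDData k H M) : Prop where
  act_one : V.act 1 = LinearMap.id
  act_mul : ∀ a b : H, V.act (a * b) = V.act a ∘ₗ V.act b
  /-- `ε(m₍₋₁₎) m₍₀₎ = m`. -/
  coact_counit : ∀ m : M, TensorProduct.lid k M (D.counit.rTensor M (V.coact m)) = m
  /-- `X¹ m₍₋₁₎ ⊗ (X² · m₍₀₎)₍₋₁₎ X³ ⊗ (X² · m₍₀₎)₍₀₎
  = X¹ (Y¹ · m)₍₋₁₎₁ Y² ⊗ X² (Y¹ · m)₍₋₁₎₂ Y³ ⊗ X³ · (Y¹ · m)₍₀₎`;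
  both sides are images of `(m ⊗ 1) ⊗ 1`. -/
  coact_coassoc : ∀ m : M,
    (braid V.coact (regAct k H)).lTensor H
        (D.assocMap (regAct k H) V.act (regAct k H)
          ((braid V.coact (regAct k H)).rTensor H ((m ⊗ₜ[k] (1 : H)) ⊗ₜ[k] (1 : H))))
      = D.assocMap (regAct k H) (regAct k H) V.act
          (braid V.coact (D.tensorAct (regAct k H) (regAct k H))
            (D.assocMap V.act (regAct k H) (regAct k H) ((m ⊗ₜ[k] (1 : H)) ⊗ₜ[k] (1 : H))))
  /-- `h₁ m₍₋₁₎ ⊗ h₂ · m₍₀₎ = (h₁ · m)₍₋₁₎ h₂ ⊗ (h₁ · m)₍₀₎`. -/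
  act_coact : ∀ (h : H) (m : M),
    D.tensorAct (regAct k H) V.act h (V.coact m)
      = braid V.coact (regAct k H) (D.tensorAct V.act (regAct k H) h (m ⊗ₜ[k] (1 : H)))

/-- The tensor product of Yetter-Drinfeld modules, with the diagonal action and the coaction
`m ⊗ n ↦ X¹ (x¹ Y¹ · m)₍₋₁₎ x² (Y² · n)₍₋₁₎ Y³ ⊗ X² · (x¹ Y¹ · m)₍₀₎ ⊗ X³ x³ · (Y² · n)₍₀₎`. -/
def tensorYD (V : YDData k H M) (W : YDData k H N) : YDData k H (M ⊗[k] N) where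
  act := D.tensorAct V.act W.act
  coact :=
    D.assocMap (regAct k H) V.act W.act
      ∘ₗ (braid V.coact (regAct k H)).rTensor N
      ∘ₗ D.assocInvMap V.act (regAct k H) W.act
      ∘ₗ (braid W.coact (regAct k H)).lTensor M
      ∘ₗ D.assocMap V.act W.act (regAct k H)
      ∘ₗ (TensorProduct.mk k (M ⊗[k] N) H).flip 1

end QuasiHopfData

/-- The structure maps of a Hopf algebra in the category of left Yetter-Drinfeld modules
over `H`, without the axioms. -/
structure BraidedHopfData (k : Type u) (H : Type v) (B : Type w) [Field k] [Ring H]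
    [Algebra k H] [AddCommGroup B] [Module k B] extends YDData k H B where
  mul : B ⊗[k] B →ₗ[k] B
  one : B
  comul : B →ₗ[k] B ⊗[k] B
  counit : B →ₗ[k] k
  antipode : B →ₗ[k] B

namespace BraidedHopfData

variable {B : Type w} [AddCommGroup B] [Module k B]

/-- The multiplication of `B ⊗ B` given by the braiding `c`:
`(B ⊗ B) ⊗ (B ⊗ B) ≅ B ⊗ ((B ⊗ B) ⊗ B) → B ⊗ ((B ⊗ B) ⊗ B) ≅ (B ⊗ B) ⊗ (B ⊗ B) → B ⊗ B`,
where the first arrow is `Id ⊗ (c ⊗ Id)` and the last one is `mul ⊗ mul`. -/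
def tensorMul (D : QuasiHopfData k H) (X : BraidedHopfData k H B) :
    (B ⊗[k] B) ⊗[k] (B ⊗[k] B) →ₗ[k] B ⊗[k] B :=
  TensorProduct.map X.mul X.mul
    ∘ₗ D.assocInvMap X.act X.act (D.tensorAct X.act X.act)
    ∘ₗ (D.assocMap X.act X.act X.act).lTensor B
    ∘ₗ ((QuasiHopfData.braid X.coact X.act).rTensor B).lTensor B
    ∘ₗ (D.assocInvMap X.act X.act X.act).lTensor B
    ∘ₗ D.assocMap X.act X.act (D.tensorAct X.act X.act)

/-- The axioms of a Hopf algebra in the category of left Yetter-Drinfeld modules over `H`. -/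
structure IsBraidedHopf (D : QuasiHopfData k H) (X : BraidedHopfData k H B) : Prop
    extends D.IsYD X.toYDData where
  one_mul : ∀ b : B, X.mul (X.one ⊗ₜ[k] b) = b
  mul_one : ∀ b : B, X.mul (b ⊗ₜ[k] X.one) = b
  mul_act : ∀ (h : H) (z : B ⊗[k] B),
    X.act h (X.mul z) = X.mul (D.tensorAct X.act X.act h z)
  one_act : ∀ h : H, X.act h X.one = D.counit h • X.one
  mul_assoc : X.mul ∘ₗ X.mul.rTensor B
    = X.mul ∘ₗ X.mul.lTensor B ∘ₗ D.assocMap X.act X.act X.act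
  mul_coact : ∀ z : B ⊗[k] B,
    X.coact (X.mul z) = X.mul.lTensor H ((D.tensorYD X.toYDData X.toYDData).coact z)
  one_coact : X.coact X.one = 1 ⊗ₜ[k] X.one
  comul_act : ∀ (h : H) (b : B),
    X.comul (X.act h b) = D.tensorAct X.act X.act h (X.comul b)
  counit_act : ∀ (h : H) (b : B), X.counit (X.act h b) = D.counit h * X.counit b
  counit_comul : ∀ b : B, TensorProduct.lid k B (X.counit.rTensor B (X.comul b)) = b
  comul_counit : ∀ b : B, TensorProduct.rid k B (X.counit.lTensor B (X.comul b)) = b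
  comul_coassoc : ∀ b : B,
    D.assocMap X.act X.act X.act (X.comul.rTensor B (X.comul b))
      = X.comul.lTensor B (X.comul b)
  comul_coact : ∀ b : B,
    X.comul.lTensor H (X.coact b) = (D.tensorYD X.toYDData X.toYDData).coact (X.comul b)
  counit_coact : ∀ b : B,
    TensorProduct.rid k H (X.counit.lTensor H (X.coact b)) = X.counit b • (1 : H)
  comul_one : X.comul X.one = X.one ⊗ₜ[k] X.one
  counit_one : X.counit X.one = 1
  counit_mul : ∀ a b : B, X.counit (X.mul (a ⊗ₜ[k] b)) = X.counit a * X.counit b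
  comul_mul : ∀ a b : B,
    X.comul (X.mul (a ⊗ₜ[k] b)) = tensorMul D X (X.comul a ⊗ₜ[k] X.comul b)
  antipode_act : ∀ (h : H) (b : B), X.antipode (X.act h b) = X.act h (X.antipode b)
  antipode_coact : ∀ b : B, X.coact (X.antipode b) = X.antipode.lTensor H (X.coact b)
  antipode_left : ∀ b : B, X.mul (X.antipode.rTensor B (X.comul b)) = X.counit b • X.one
  antipode_right : ∀ b : B, X.mul (X.antipode.lTensor B (X.comul b)) = X.counit b • X.one

/-- An ordinary Hopf algebra with the trivial action (through the counit of `H`) and the trivial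
coaction (through the unit of `H`). -/
def trivial (D : QuasiHopfData k H) (B : Type w) [Ring B] [HopfAlgebra k B] :
    BraidedHopfData k H B where
  act := D.counit.smulRight LinearMap.id
  coact := TensorProduct.mk k H B 1
  mul := LinearMap.mul' k B
  one := 1
  comul := Coalgebra.comul
  counit := Coalgebra.counit
  antipode := HopfAlgebra.antipode k

end BraidedHopfData

/-- An isomorphism of Hopf algebras in the category of left Yetter-Drinfeld modules over `H`. -/
structure BraidedHopfEquiv {B C : Type*} [AddCommGroup B] [Module k B] [AddCommGroup C]
    [Module k C] (X : BraidedHopfData k H B) (Y : BraidedHopfData k H C) extends B ≃ₗ[k] C where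
  map_act : ∀ (h : H) (b : B), toLinearEquiv (X.act h b) = Y.act h (toLinearEquiv b)
  map_coact : ∀ b : B,
    Y.coact (toLinearEquiv b) = toLinearEquiv.toLinearMap.lTensor H (X.coact b)
  map_mul : ∀ a b : B,
    toLinearEquiv (X.mul (a ⊗ₜ[k] b)) = Y.mul (toLinearEquiv a ⊗ₜ[k] toLinearEquiv b)
  map_one : toLinearEquiv X.one = Y.one
  map_comul : ∀ b : B, Y.comul (toLinearEquiv b)
    = TensorProduct.map toLinearEquiv.toLinearMap toLinearEquiv.toLinearMap (X.comul b)
  map_counit : ∀ b : B, Y.counit (toLinearEquiv b) = X.counit b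
  map_antipode : ∀ b : B, toLinearEquiv (X.antipode b) = Y.antipode (toLinearEquiv b)

end YetterDrinfeld

/-! ## The concrete quasi-Hopf algebras -/

section Idempotents

variable (k : Type u) {A : Type v} [Field k] [Ring A] [Algebra k A]

/-- `p₊ = (1 + g) / 2`. -/
def pPlus (g : A) : A := (2⁻¹ : k) • (1 + g)

/-- `p₋ = (1 - g) / 2`. -/
def pMinus (g : A) : A := (2⁻¹ : k) • (1 - g)

variable {k}

/-- `x ⊗ (p₊ + q p₋) + 1 ⊗ p₊ x + g ⊗ p₋ x`. -/
def comulGen (q : k) (g x : A) : A ⊗[k] A :=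
  x ⊗ₜ[k] (pPlus k g + q • pMinus k g) + 1 ⊗ₜ[k] (pPlus k g * x) + g ⊗ₜ[k] (pMinus k g * x)

/-- `-x (p₊ + q p₋)`. -/
def antipodeGen (q : k) (g x : A) : A := -(x * (pPlus k g + q • pMinus k g))

/-- `1 - 2 p₋ ⊗ p₋ ⊗ p₋`. -/
def phiGen (k : Type u) {A : Type v} [Field k] [Ring A] [Algebra k A] (g : A) :
    A ⊗[k] (A ⊗[k] A) :=
  1 - (2 : k) • (pMinus k g ⊗ₜ[k] (pMinus k g ⊗ₜ[k] pMinus k g))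

theorem pPlus_add_pMinus (h2 : (2 : k) ≠ 0) (g : A) : pPlus k g + pMinus k g = 1 := by
  simp only [pPlus, pMinus]
  match_scalars <;> field_simp <;> ring

theorem pPlus_sub_pMinus (h2 : (2 : k) ≠ 0) (g : A) : pPlus k g - pMinus k g = g := by
  simp only [pPlus, pMinus]
  match_scalars <;> field_simp <;> ring

theorem pPlus_mul_pPlus (h2 : (2 : k) ≠ 0) {g : A} (hg : g * g = 1) :
    pPlus k g * pPlus k g = pPlus k g := by
  simp only [pPlus, smul_mul_smul_comm, mul_add, add_mul, one_mul, mul_one, hg]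
  match_scalars <;> field_simp <;> ring

theorem pMinus_mul_pMinus (h2 : (2 : k) ≠ 0) {g : A} (hg : g * g = 1) :
    pMinus k g * pMinus k g = pMinus k g := by
  simp only [pMinus, smul_mul_smul_comm, mul_sub, sub_mul, one_mul, mul_one, hg]
  match_scalars <;> field_simp <;> ring

theorem pPlus_mul_pMinus {g : A} (hg : g * g = 1) : pPlus k g * pMinus k g = 0 := by
  simp only [pPlus, pMinus, smul_mul_smul_comm, mul_sub, add_mul, one_mul, mul_one, hg]
  match_scalars <;> ring

theorem pMinus_mul_pPlus {g : A} (hg : g * g = 1) : pMinus k g * pPlus k g = 0 := by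
  simp only [pPlus, pMinus, smul_mul_smul_comm, mul_add, sub_mul, one_mul, mul_one, hg]
  match_scalars <;> ring

theorem pPlus_mul {g x : A} (hx : g * x = -(x * g)) : pPlus k g * x = x * pMinus k g := by
  simp only [pPlus, pMinus, smul_mul_assoc, mul_smul_comm, add_mul, mul_sub, one_mul, mul_one, hx]
  module

theorem pMinus_mul {g x : A} (hx : g * x = -(x * g)) : pMinus k g * x = x * pPlus k g := by
  simp only [pPlus, pMinus, smul_mul_assoc, mul_smul_comm, sub_mul, mul_add, one_mul, mul_one, hx]
  module

theorem mul_pPlus {g : A} (hg : g * g = 1) : g * pPlus k g = pPlus k g := by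
  simp only [pPlus, mul_smul_comm, mul_add, mul_one, hg, add_comm]

theorem mul_pMinus {g : A} (hg : g * g = 1) : g * pMinus k g = -pMinus k g := by
  simp only [pMinus, mul_smul_comm, mul_sub, mul_one, hg]
  module

theorem pPlus_mul_self {g : A} (hg : g * g = 1) : pPlus k g * g = pPlus k g := by
  simp only [pPlus, smul_mul_assoc, add_mul, one_mul, hg, add_comm]

theorem pMinus_mul_self {g : A} (hg : g * g = 1) : pMinus k g * g = -pMinus k g := by
  simp only [pMinus, smul_mul_assoc, sub_mul, one_mul, hg]
  module

/-- If `b a = q a b` with `q² = -1` and `a⁴ = b⁴ = 0`, then `(a + b)⁴ = 0`. -/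
theorem add_pow_four_eq_zero {q : k} (hq : q ^ 2 = -1) {a b : A} (hab : b * a = q • (a * b))
    (ha : a ^ 4 = 0) (hb : b ^ 4 = 0) : (a + b) ^ 4 = 0 := by
  have hab2 : ∀ t : A, b * (a * t) = q • (a * (b * t)) := by
    intro t
    rw [← mul_assoc, hab, smul_mul_assoc, mul_assoc]
  have ha4 : a * (a * (a * a)) = 0 := by rw [← ha]; noncomm_ring
  have hb4 : b * (b * (b * b)) = 0 := by rw [← hb]; noncomm_ring
  have hsq : (a + b) ^ 4 = (a + b) * ((a + b) * ((a + b) * (a + b))) := by noncomm_ring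
  rw [hsq]
  simp only [mul_add, add_mul, hab, hab2, mul_smul_comm, ha4, hb4, smul_smul]
  match_scalars <;>
    first
      | linear_combination (q + 1) * hq
      | linear_combination (q ^ 2 + q + 1) * hq

theorem comulGen_anticomm (q : k) {g x : A} (hg : g * g = 1) (hx : g * x = -(x * g)) :
    (g ⊗ₜ[k] g) * comulGen q g x = -(comulGen q g x * (g ⊗ₜ[k] g)) := by
  have h1 : g * (pPlus k g * x) = -(pPlus k g * x * g) := by
    rw [mul_assoc, ← mul_neg, ← hx, ← mul_assoc, ← mul_assoc, mul_pPlus hg, pPlus_mul_self hg]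
  have h3 : g * (pMinus k g * x) = -(pMinus k g * x * g) := by
    rw [mul_assoc, ← mul_neg, ← hx, ← mul_assoc, ← mul_assoc, mul_pMinus hg, pMinus_mul_self hg]
  have h4 : g * (pPlus k g + q • pMinus k g) = (pPlus k g + q • pMinus k g) * g := by
    simp only [mul_add, add_mul, mul_smul_comm, smul_mul_assoc, mul_pPlus hg, mul_pMinus hg,
      pPlus_mul_self hg, pMinus_mul_self hg]
  simp only [comulGen, mul_add, add_mul, Algebra.TensorProduct.tmul_mul_tmul, one_mul, mul_one,
    h1, h3, h4, hx, TensorProduct.neg_tmul, TensorProduct.tmul_neg, neg_add]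

/-- The part `1 ⊗ p₊ x + g ⊗ p₋ x` of `Δ(x)`. -/
def comulGenAux (k : Type u) {A : Type v} [Field k] [Ring A] [Algebra k A] (g x : A) : A ⊗[k] A :=
  1 ⊗ₜ[k] (pPlus k g * x) + g ⊗ₜ[k] (pMinus k g * x)

theorem comulGen_eq (q : k) (g x : A) :
    comulGen q g x = x ⊗ₜ[k] (pPlus k g + q • pMinus k g) + comulGenAux k g x := by
  rw [comulGen, comulGenAux, add_assoc]

theorem comulGenAux_mul {q : k} (hq : q ^ 2 = -1) (h2 : (2 : k) ≠ 0) {g x y : A}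
    (hg : g * g = 1) (hx : g * x = -(x * g)) (hy : g * y = -(y * g)) :
    comulGenAux k g y * (x ⊗ₜ[k] (pPlus k g + q • pMinus k g))
      = q • ((x ⊗ₜ[k] (pPlus k g + q • pMinus k g)) * comulGenAux k g y) := by
  have e1 : pPlus k g * y * (pPlus k g + q • pMinus k g) = q • (pPlus k g * y) := by
    rw [pPlus_mul hy, mul_assoc, mul_add, pMinus_mul_pPlus hg, mul_smul_comm,
      pMinus_mul_pMinus h2 hg, zero_add, mul_smul_comm]
  have e2 : pMinus k g * y * (pPlus k g + q • pMinus k g) = pMinus k g * y := by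
    rw [pMinus_mul hy, mul_assoc, mul_add, pPlus_mul_pPlus h2 hg, mul_smul_comm,
      pPlus_mul_pMinus hg, smul_zero, add_zero]
  have e3 : (pPlus k g + q • pMinus k g) * (pPlus k g * y) = pPlus k g * y := by
    rw [← mul_assoc, add_mul, smul_mul_assoc, pPlus_mul_pPlus h2 hg, pMinus_mul_pPlus hg,
      smul_zero, add_zero]
  have e4 : (pPlus k g + q • pMinus k g) * (pMinus k g * y) = q • (pMinus k g * y) := by
    rw [← mul_assoc, add_mul, smul_mul_assoc, pMinus_mul_pMinus h2 hg, pPlus_mul_pMinus hg,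
      zero_add, smul_mul_assoc]
  generalize pPlus k g + q • pMinus k g = W at e1 e2 e3 e4 ⊢
  simp only [comulGenAux, add_mul, mul_add, Algebra.TensorProduct.tmul_mul_tmul, one_mul, mul_one,
    e1, e2, e3, e4, hx, TensorProduct.tmul_smul, TensorProduct.neg_tmul]
  rw [smul_add, smul_smul, ← pow_two, hq, neg_smul, one_smul]

theorem comulGenAux_mul_comulGenAux (h2 : (2 : k) ≠ 0) {g x y : A} (hg : g * g = 1)
    (hy : g * y = -(y * g)) :
    comulGenAux k g y * comulGenAux k g x = g ⊗ₜ[k] (y * x) := by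
  have e1 : pPlus k g * y * (pPlus k g * x) = 0 := by
    rw [pPlus_mul hy, mul_assoc, ← mul_assoc (pMinus k g), pMinus_mul_pPlus hg, zero_mul, mul_zero]
  have e2 : pMinus k g * y * (pMinus k g * x) = 0 := by
    rw [pMinus_mul hy, mul_assoc, ← mul_assoc (pPlus k g), pPlus_mul_pMinus hg, zero_mul, mul_zero]
  have e3 : pPlus k g * y * (pMinus k g * x) = y * (pMinus k g * x) := by
    rw [pPlus_mul hy, mul_assoc, ← mul_assoc (pMinus k g), pMinus_mul_pMinus h2 hg]
  have e4 : pMinus k g * y * (pPlus k g * x) = y * (pPlus k g * x) := by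
    rw [pMinus_mul hy, mul_assoc, ← mul_assoc (pPlus k g), pPlus_mul_pPlus h2 hg]
  simp only [comulGenAux, add_mul, mul_add, Algebra.TensorProduct.tmul_mul_tmul, one_mul, mul_one,
    e1, e2, e3, e4, TensorProduct.tmul_zero, zero_add, add_zero]
  rw [← TensorProduct.tmul_add, ← mul_add, ← add_mul, pPlus_add_pMinus h2, one_mul]

theorem comulGen_pow_four {q : k} (hq : q ^ 2 = -1) (h2 : (2 : k) ≠ 0) {g x : A}
    (hg : g * g = 1) (hx : g * x = -(x * g)) (hx4 : x ^ 4 = 0) : comulGen q g x ^ 4 = 0 := by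
  rw [comulGen_eq]
  refine add_pow_four_eq_zero hq (comulGenAux_mul hq h2 hg hx hx) ?_ ?_
  · rw [Algebra.TensorProduct.tmul_pow, hx4, TensorProduct.zero_tmul]
  · rw [show 4 = 2 * 2 from rfl, pow_mul, pow_two (comulGenAux k g x),
      comulGenAux_mul_comulGenAux (y := x) h2 hg hx, Algebra.TensorProduct.tmul_pow, ← pow_two x,
      ← pow_mul, hx4, TensorProduct.tmul_zero]

/-- If `y x = q x y`, the elements `Δ(x)` and `Δ(y)` satisfy the same relation. -/
theorem comulGen_mul_comulGen {q : k} (hq : q ^ 2 = -1) (h2 : (2 : k) ≠ 0) {g x y : A}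
    (hg : g * g = 1) (hx : g * x = -(x * g)) (hy : g * y = -(y * g)) (hyx : y * x = q • (x * y)) :
    comulGen (-q) g y * comulGen q g x = q • (comulGen q g x * comulGen (-q) g y) := by
  have hW : (pPlus k g + (-q) • pMinus k g) * (pPlus k g + q • pMinus k g)
      = (pPlus k g + q • pMinus k g) * (pPlus k g + (-q) • pMinus k g) := by
    simp only [mul_add, add_mul, mul_smul_comm, smul_mul_assoc, pPlus_mul_pMinus hg,
      pMinus_mul_pPlus hg]
    module
  have h1 := comulGenAux_mul hq h2 hg hx hy
  have h3 := comulGenAux_mul (q := -q) (by rw [neg_sq, hq]) h2 hg hy hx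
  have h4 := comulGenAux_mul_comulGenAux (x := x) h2 hg hy
  have h5 := comulGenAux_mul_comulGenAux (x := y) h2 hg hx
  rw [comulGen_eq, comulGen_eq]
  simp only [mul_add, add_mul, h1, h3, h4, h5, Algebra.TensorProduct.tmul_mul_tmul, hW, hyx,
    TensorProduct.tmul_smul, TensorProduct.smul_tmul', smul_add, smul_smul]
  rw [show q * -q = 1 by linear_combination -hq]
  module

theorem mul_wt (q : k) {g x : A} (hx : g * x = -(x * g)) :
    (pPlus k g + q • pMinus k g) * x = x * (pMinus k g + q • pPlus k g) := by
  rw [add_mul, smul_mul_assoc, pPlus_mul hx, pMinus_mul hx, mul_add, mul_smul_comm]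

theorem antipodeGen_anticomm (q : k) {g x : A} (hg : g * g = 1) (hx : g * x = -(x * g)) :
    antipodeGen q g x * g = -(g * antipodeGen q g x) := by
  simp only [antipodeGen, neg_mul, mul_neg, neg_neg, ← mul_assoc, hx]
  simp only [mul_assoc, mul_add, add_mul, mul_smul_comm, smul_mul_assoc, mul_pPlus hg,
    mul_pMinus hg, pPlus_mul_self hg, pMinus_mul_self hg]

theorem antipodeGen_mul (q r : k) (h2 : (2 : k) ≠ 0) {g x y : A} (hg : g * g = 1)
    (hy : g * y = -(y * g)) :
    antipodeGen q g x * antipodeGen r g y = x * y * (q • pPlus k g + r • pMinus k g) := by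
  have : (pMinus k g + q • pPlus k g) * (pPlus k g + r • pMinus k g)
      = q • pPlus k g + r • pMinus k g := by
    simp only [mul_add, add_mul, mul_smul_comm, smul_mul_assoc, pPlus_mul_pMinus hg,
      pMinus_mul_pPlus hg, pPlus_mul_pPlus h2 hg, pMinus_mul_pMinus h2 hg]
    module
  rw [antipodeGen, antipodeGen, neg_mul_neg, mul_assoc, ← mul_assoc _ y, mul_wt q hy,
    mul_assoc y, this, mul_assoc]

theorem antipodeGen_pow_four {q : k} (h2 : (2 : k) ≠ 0) {g x : A}
    (hg : g * g = 1) (hx : g * x = -(x * g)) (hx4 : x ^ 4 = 0) : antipodeGen q g x ^ 4 = 0 := by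
  have hc : Commute (x * x) (q • pPlus k g + q • pMinus k g) := by
    rw [← smul_add, pPlus_add_pMinus h2]
    exact (Commute.one_right _).smul_right q
  rw [show 4 = 2 * 2 from rfl, pow_mul, pow_two (antipodeGen q g x), antipodeGen_mul q q h2 hg hx,
    hc.mul_pow, ← pow_two x, ← pow_mul, hx4, zero_mul]

theorem antipodeGen_mul_antipodeGen {q : k} (hq : q ^ 2 = -1) (h2 : (2 : k) ≠ 0) {g x y : A}
    (hg : g * g = 1) (hx : g * x = -(x * g)) (hy : g * y = -(y * g)) (hyx : y * x = q • (x * y)) :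
    antipodeGen q g x * antipodeGen (-q) g y
      = q • (antipodeGen (-q) g y * antipodeGen q g x) := by
  rw [antipodeGen_mul q (-q) h2 hg hy, antipodeGen_mul (-q) q h2 hg hx, hyx, smul_mul_assoc,
    smul_smul, ← pow_two, hq, ← mul_smul_comm]
  congr 1
  module

theorem phiGen_mul_self (h2 : (2 : k) ≠ 0) {g : A} (hg : g * g = 1) :
    phiGen k g * phiGen k g = 1 := by
  have hp := pMinus_mul_pMinus h2 hg
  simp only [phiGen, mul_sub, sub_mul, one_mul, mul_one, smul_mul_smul_comm,
    Algebra.TensorProduct.tmul_mul_tmul, hp]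
  module

theorem two_ne_zero_of_primitive {q : k} (hq : IsPrimitiveRoot q 4) : (2 : k) ≠ 0 := by
  intro h2
  have h : (q ^ 2 - 1) ^ 2 = 0 := by
    have := hq.pow_eq_one
    linear_combination this + (1 - q ^ 2) * h2
  have h' : q ^ 2 = 1 := sub_eq_zero.mp (pow_eq_zero_iff (two_ne_zero) |>.mp h)
  exact absurd (hq.dvd_of_pow_eq_one 2 h') (by decide)

theorem sq_of_primitive {q : k} (hq : IsPrimitiveRoot q 4) : q ^ 2 = -1 := by
  have h : (q ^ 2 - 1) * (q ^ 2 + 1) = 0 := by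
    have := hq.pow_eq_one
    linear_combination this
  rcases mul_eq_zero.mp h with h | h
  · exact absurd (hq.dvd_of_pow_eq_one 2 (sub_eq_zero.mp h)) (by decide)
  · exact eq_neg_of_add_eq_zero_left h

end Idempotents

section Concrete

variable (k : Type u) [Field k]

/-- Names of two generators. -/
inductive Gen2 : Type
  | g
  | x

/-- Names of three generators. -/
inductive Gen3 : Type
  | g
  | x
  | y

/-! ### The Sweedler Hopf algebra `H₄` -/

open FreeAlgebra in
/-- `g² = 1`, `x² = 0`, `g x = -x g`. -/
inductive H4.Rel : FreeAlgebra k Gen2 → FreeAlgebra k Gen2 → Prop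
  | g_sq : H4.Rel (ι k Gen2.g * ι k Gen2.g) 1
  | x_sq : H4.Rel (ι k Gen2.x * ι k Gen2.x) 0
  | g_x : H4.Rel (ι k Gen2.g * ι k Gen2.x) (-(ι k Gen2.x * ι k Gen2.g))

/-- The algebra generated by `g`, `x` with relations `g² = 1`, `x² = 0`, `g x = -x g`. -/
def H4 : Type u := RingQuot (H4.Rel k)

instance : Ring (H4 k) := inferInstanceAs (Ring (RingQuot (H4.Rel k)))
instance : Algebra k (H4 k) := inferInstanceAs (Algebra k (RingQuot (H4.Rel k)))

namespace H4

def g : H4 k := RingQuot.mkAlgHom k (H4.Rel k) (FreeAlgebra.ι k Gen2.g)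
def x : H4 k := RingQuot.mkAlgHom k (H4.Rel k) (FreeAlgebra.ι k Gen2.x)

theorem g_sq : g k * g k = 1 := by
  have h := RingQuot.mkAlgHom_rel k (H4.Rel.g_sq (k := k))
  rw [map_mul, map_one] at h
  exact h

theorem x_sq : x k * x k = 0 := by
  have h := RingQuot.mkAlgHom_rel k (H4.Rel.x_sq (k := k))
  rw [map_mul, map_zero] at h
  exact h

theorem g_x : g k * x k = -(x k * g k) := by
  have h := RingQuot.mkAlgHom_rel k (H4.Rel.g_x (k := k))
  rw [map_neg, map_mul, map_mul] at h
  exact h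

variable {k}

/-- The morphism of algebras `H₄ → R` with `g ↦ a`, `x ↦ b`. -/
def lift {R : Type*} [Ring R] [Algebra k R] (a b : R) (ha : a * a = 1) (hb : b * b = 0)
    (hab : a * b = -(b * a)) : H4 k →ₐ[k] R :=
  RingQuot.liftAlgHom k ⟨FreeAlgebra.lift k (fun i => match i with | .g => a | .x => b), by
    rintro _ _ (_ | _ | _) <;> simp [ha, hb, hab]⟩

variable (k)

/-- `Δ(g) = g ⊗ g`, `Δ(x) = g ⊗ x + x ⊗ 1`, `ε(g) = 1`, `ε(x) = 0`, `S(g) = g`, `S(x) = -g x`,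
with trivial reassociator and `α = β = 1`. -/
def data : QuasiHopfData k (H4 k) where
  comul := (lift (g k ⊗ₜ[k] g k) (g k ⊗ₜ[k] x k + x k ⊗ₜ[k] 1)
    (by rw [Algebra.TensorProduct.tmul_mul_tmul, g_sq, Algebra.TensorProduct.one_def])
    (by
      simp only [mul_add, add_mul, Algebra.TensorProduct.tmul_mul_tmul, x_sq, g_x, mul_one,
        one_mul, TensorProduct.tmul_zero, TensorProduct.zero_tmul, TensorProduct.neg_tmul]
      abel)
    (by
      simp only [mul_add, add_mul, Algebra.TensorProduct.tmul_mul_tmul, g_x, mul_one,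
        one_mul, TensorProduct.neg_tmul, TensorProduct.tmul_neg]
      abel)).toLinearMap
  counit := (lift (1 : k) 0 (by simp) (by simp) (by simp)).toLinearMap
  reassoc := 1
  antipode := (MulOpposite.opLinearEquiv k).symm.toLinearMap ∘ₗ
    (lift (MulOpposite.op (g k)) (MulOpposite.op (-(g k * x k)))
      (by rw [← MulOpposite.op_mul, g_sq, MulOpposite.op_one])
      (by
        rw [← MulOpposite.op_mul, neg_mul_neg, g_x, neg_mul_neg, mul_assoc, ← mul_assoc (g k),
          g_x, neg_mul, mul_neg, ← mul_assoc, ← mul_assoc, x_sq]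
        simp)
      (by
        rw [← MulOpposite.op_mul, ← MulOpposite.op_mul, ← MulOpposite.op_neg]
        congr 1
        rw [neg_mul, mul_neg, neg_neg, mul_assoc, ← neg_eq_iff_eq_neg.mpr (g_x k), mul_neg,
          neg_neg])).toLinearMap
  alpha := 1
  beta := 1

end H4

/-! ### The quasi-Hopf algebra `H_q(8)` -/

open FreeAlgebra in
/-- `g² = 1`, `x⁴ = 0`, `g x = -x g`. -/
inductive H8.Rel : FreeAlgebra k Gen2 → FreeAlgebra k Gen2 → Prop
  | g_sq : H8.Rel (ι k Gen2.g * ι k Gen2.g) 1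
  | x_pow : H8.Rel (ι k Gen2.x ^ 4) 0
  | g_x : H8.Rel (ι k Gen2.g * ι k Gen2.x) (-(ι k Gen2.x * ι k Gen2.g))

/-- The algebra generated by `g`, `x` with relations `g² = 1`, `x⁴ = 0`, `g x = -x g`. -/
def H8 : Type u := RingQuot (H8.Rel k)

instance : Ring (H8 k) := inferInstanceAs (Ring (RingQuot (H8.Rel k)))
instance : Algebra k (H8 k) := inferInstanceAs (Algebra k (RingQuot (H8.Rel k)))

namespace H8

def g : H8 k := RingQuot.mkAlgHom k (H8.Rel k) (FreeAlgebra.ι k Gen2.g)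
def x : H8 k := RingQuot.mkAlgHom k (H8.Rel k) (FreeAlgebra.ι k Gen2.x)

theorem g_sq : g k * g k = 1 := by
  have h := RingQuot.mkAlgHom_rel k (H8.Rel.g_sq (k := k))
  rw [map_mul, map_one] at h
  exact h

theorem x_pow : x k ^ 4 = 0 := by
  have h := RingQuot.mkAlgHom_rel k (H8.Rel.x_pow (k := k))
  rw [map_pow, map_zero] at h
  exact h

theorem g_x : g k * x k = -(x k * g k) := by
  have h := RingQuot.mkAlgHom_rel k (H8.Rel.g_x (k := k))
  rw [map_neg, map_mul, map_mul] at h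
  exact h

variable {k}

/-- The morphism of algebras `H_q(8) → R` with `g ↦ a`, `x ↦ b`. -/
def lift {R : Type*} [Ring R] [Algebra k R] (a b : R) (ha : a * a = 1) (hb : b ^ 4 = 0)
    (hab : a * b = -(b * a)) : H8 k →ₐ[k] R :=
  RingQuot.liftAlgHom k ⟨FreeAlgebra.lift k (fun i => match i with | .g => a | .x => b), by
    rintro _ _ (_ | _ | _) <;> simp [ha, hb, hab]⟩

/-- `Δ(g) = g ⊗ g`, `Δ(x) = x ⊗ (p₊ + q p₋) + 1 ⊗ p₊ x + g ⊗ p₋ x`, `ε(g) = 1`, `ε(x) = 0`,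
`S(g) = g`, `S(x) = -x (p₊ + q p₋)`, `Φ = 1 - 2 p₋ ⊗ p₋ ⊗ p₋`, `α = g`, `β = 1`. -/
def data (q : k) (hq : IsPrimitiveRoot q 4) : QuasiHopfData k (H8 k) where
  comul := (lift (g k ⊗ₜ[k] g k) (comulGen q (g k) (x k))
    (by rw [Algebra.TensorProduct.tmul_mul_tmul, g_sq, Algebra.TensorProduct.one_def])
    (comulGen_pow_four (sq_of_primitive hq) (two_ne_zero_of_primitive hq) (g_sq k) (g_x k)
      (x_pow k))
    (comulGen_anticomm q (g_sq k) (g_x k))).toLinearMap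
  counit := (lift (1 : k) 0 (by simp) (by simp) (by simp)).toLinearMap
  reassoc := ⟨phiGen k (g k), phiGen k (g k),
    phiGen_mul_self (two_ne_zero_of_primitive hq) (g_sq k),
    phiGen_mul_self (two_ne_zero_of_primitive hq) (g_sq k)⟩
  antipode := (MulOpposite.opLinearEquiv k).symm.toLinearMap ∘ₗ
    (lift (MulOpposite.op (g k)) (MulOpposite.op (antipodeGen q (g k) (x k)))
      (by rw [← MulOpposite.op_mul, g_sq, MulOpposite.op_one])
      (by rw [← MulOpposite.op_pow, antipodeGen_pow_four (two_ne_zero_of_primitive hq) (g_sq k)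
        (g_x k) (x_pow k), MulOpposite.op_zero])
      (by rw [← MulOpposite.op_mul, ← MulOpposite.op_mul, ← MulOpposite.op_neg,
        antipodeGen_anticomm q (g_sq k) (g_x k)])).toLinearMap
  alpha := g k
  beta := 1

instance (q : k) (hq : IsPrimitiveRoot q 4) : (data q hq).IsMult where
  comul_one := map_one (lift _ _ _ _ _)
  comul_mul := map_mul (lift _ _ _ _ _)
  counit_one := map_one (lift _ _ _ _ _)
  counit_mul := map_mul (lift _ _ _ _ _)

end H8

/-! ### The quasi-Hopf algebra `H(32)` -/

section

variable {k} (q : k)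

open FreeAlgebra in
/-- `g² = 1`, `x⁴ = 0`, `y⁴ = 0`, `g x = -x g`, `g y = -y g`, `y x = q x y`. -/
inductive H32.Rel : FreeAlgebra k Gen3 → FreeAlgebra k Gen3 → Prop
  | g_sq : H32.Rel (ι k Gen3.g * ι k Gen3.g) 1
  | x_pow : H32.Rel (ι k Gen3.x ^ 4) 0
  | y_pow : H32.Rel (ι k Gen3.y ^ 4) 0
  | g_x : H32.Rel (ι k Gen3.g * ι k Gen3.x) (-(ι k Gen3.x * ι k Gen3.g))
  | g_y : H32.Rel (ι k Gen3.g * ι k Gen3.y) (-(ι k Gen3.y * ι k Gen3.g))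
  | y_x : H32.Rel (ι k Gen3.y * ι k Gen3.x) (q • (ι k Gen3.x * ι k Gen3.y))

/-- The algebra generated by `g`, `x`, `y` with relations `g² = 1`, `x⁴ = y⁴ = 0`, `g x = -x g`,
`g y = -y g`, `y x = q x y`. -/
def H32 : Type u := RingQuot (H32.Rel q)

instance : Ring (H32 q) := inferInstanceAs (Ring (RingQuot (H32.Rel q)))
instance : Algebra k (H32 q) := inferInstanceAs (Algebra k (RingQuot (H32.Rel q)))

namespace H32

def g : H32 q := RingQuot.mkAlgHom k (H32.Rel q) (FreeAlgebra.ι k Gen3.g)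
def x : H32 q := RingQuot.mkAlgHom k (H32.Rel q) (FreeAlgebra.ι k Gen3.x)
def y : H32 q := RingQuot.mkAlgHom k (H32.Rel q) (FreeAlgebra.ι k Gen3.y)

theorem g_sq : g q * g q = 1 := by
  have h := RingQuot.mkAlgHom_rel k (H32.Rel.g_sq (q := q))
  rw [map_mul, map_one] at h
  exact h

theorem x_pow : x q ^ 4 = 0 := by
  have h := RingQuot.mkAlgHom_rel k (H32.Rel.x_pow (q := q))
  rw [map_pow, map_zero] at h
  exact h

theorem y_pow : y q ^ 4 = 0 := by
  have h := RingQuot.mkAlgHom_rel k (H32.Rel.y_pow (q := q))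
  rw [map_pow, map_zero] at h
  exact h

theorem g_x : g q * x q = -(x q * g q) := by
  have h := RingQuot.mkAlgHom_rel k (H32.Rel.g_x (q := q))
  rw [map_neg, map_mul, map_mul] at h
  exact h

theorem g_y : g q * y q = -(y q * g q) := by
  have h := RingQuot.mkAlgHom_rel k (H32.Rel.g_y (q := q))
  rw [map_neg, map_mul, map_mul] at h
  exact h

theorem y_x : y q * x q = q • (x q * y q) := by
  have h := RingQuot.mkAlgHom_rel k (H32.Rel.y_x (q := q))
  rw [map_smul, map_mul, map_mul] at h
  exact h

variable {q}

/-- The morphism of algebras `H(32) → R` with `g ↦ a`, `x ↦ b`, `y ↦ c`. -/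
def lift {R : Type*} [Ring R] [Algebra k R] (a b c : R) (ha : a * a = 1) (hb : b ^ 4 = 0)
    (hc : c ^ 4 = 0) (hab : a * b = -(b * a)) (hac : a * c = -(c * a))
    (hcb : c * b = q • (b * c)) : H32 q →ₐ[k] R :=
  RingQuot.liftAlgHom k
    ⟨FreeAlgebra.lift k (fun i => match i with | .g => a | .x => b | .y => c), by
      rintro _ _ (_ | _ | _ | _ | _ | _) <;> simp [ha, hb, hc, hab, hac, hcb]⟩

/-- `g`, `x` are as in `H_q(8)`, and `Δ(y) = y ⊗ (p₊ - q p₋) + 1 ⊗ p₊ y + g ⊗ p₋ y`, `ε(y) = 0`,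
`S(y) = -y (p₊ - q p₋)`; `Φ = 1 - 2 p₋ ⊗ p₋ ⊗ p₋`, `α = g`, `β = 1`. -/
def data (hq : IsPrimitiveRoot q 4) : QuasiHopfData k (H32 q) where
  comul := (lift (g q ⊗ₜ[k] g q) (comulGen q (g q) (x q)) (comulGen (-q) (g q) (y q))
    (by rw [Algebra.TensorProduct.tmul_mul_tmul, g_sq, Algebra.TensorProduct.one_def])
    (comulGen_pow_four (sq_of_primitive hq) (two_ne_zero_of_primitive hq) (g_sq q) (g_x q)
      (x_pow q))
    (comulGen_pow_four (by rw [neg_sq, sq_of_primitive hq]) (two_ne_zero_of_primitive hq)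
      (g_sq q) (g_y q) (y_pow q))
    (comulGen_anticomm q (g_sq q) (g_x q))
    (comulGen_anticomm (-q) (g_sq q) (g_y q))
    (comulGen_mul_comulGen (sq_of_primitive hq) (two_ne_zero_of_primitive hq) (g_sq q) (g_x q)
      (g_y q) (y_x q))).toLinearMap
  counit := (lift (1 : k) 0 0 (by simp) (by simp) (by simp) (by simp) (by simp)
    (by simp)).toLinearMap
  reassoc := ⟨phiGen k (g q), phiGen k (g q),
    phiGen_mul_self (two_ne_zero_of_primitive hq) (g_sq q),
    phiGen_mul_self (two_ne_zero_of_primitive hq) (g_sq q)⟩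
  antipode := (MulOpposite.opLinearEquiv k).symm.toLinearMap ∘ₗ
    (lift (MulOpposite.op (g q)) (MulOpposite.op (antipodeGen q (g q) (x q)))
      (MulOpposite.op (antipodeGen (-q) (g q) (y q)))
      (by rw [← MulOpposite.op_mul, g_sq, MulOpposite.op_one])
      (by rw [← MulOpposite.op_pow, antipodeGen_pow_four (two_ne_zero_of_primitive hq) (g_sq q)
        (g_x q) (x_pow q), MulOpposite.op_zero])
      (by rw [← MulOpposite.op_pow, antipodeGen_pow_four (two_ne_zero_of_primitive hq) (g_sq q)
        (g_y q) (y_pow q), MulOpposite.op_zero])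
      (by rw [← MulOpposite.op_mul, ← MulOpposite.op_mul, ← MulOpposite.op_neg,
        antipodeGen_anticomm q (g_sq q) (g_x q)])
      (by rw [← MulOpposite.op_mul, ← MulOpposite.op_mul, ← MulOpposite.op_neg,
        antipodeGen_anticomm (-q) (g_sq q) (g_y q)])
      (by rw [← MulOpposite.op_mul, ← MulOpposite.op_mul, ← MulOpposite.op_smul,
        antipodeGen_mul_antipodeGen (sq_of_primitive hq) (two_ne_zero_of_primitive hq) (g_sq q)
          (g_x q) (g_y q) (y_x q)])).toLinearMap
  alpha := g q
  beta := 1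

end H32

end

/-! ### The group Hopf algebra `k[C₂]` and the quasi-Hopf algebra `H_q(16)` -/

/-- The group Hopf algebra `k[C₂]`. -/
abbrev GroupAlgC2 : Type u := MonoidAlgebra k (Multiplicative (ZMod 2))

/-- The underlying algebra of `H_q(16) = k[C₂] ⊗ H_q(8)`. -/
abbrev H16 : Type u := GroupAlgC2 k ⊗[k] H8 k

namespace H16

/-- The image of the generator `g` of `H_q(8)`. -/
def g₁ : H16 k := 1 ⊗ₜ[k] H8.g k

/-- The generator of `C₂`. -/
def g₂ : H16 k := MonoidAlgebra.of k (Multiplicative (ZMod 2)) (Multiplicative.ofAdd 1) ⊗ₜ[k] 1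

/-- The image of the generator `x` of `H_q(8)`. -/
def x : H16 k := 1 ⊗ₜ[k] H8.x k

variable {k}

/-- The tensor product of the Hopf algebra `k[C₂]` and the quasi-Hopf algebra `H_q(8)`. -/
def data (q : k) (hq : IsPrimitiveRoot q 4) : QuasiHopfData k (H16 k) :=
  (QuasiHopfData.ofHopf k (GroupAlgC2 k)).tensor (H8.data q hq)

instance (q : k) (hq : IsPrimitiveRoot q 4) : (data q hq).IsMult :=
  inferInstanceAs
    ((QuasiHopfData.ofHopf k (GroupAlgC2 k)).tensor (H8.data q hq)).IsMult

end H16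

end Concrete

end

end QH

/-! All the quasi-Hopf algebras here share a group-like involution g with Φ = 1 − 2 p₋ ⊗ p₋ ⊗ p₋, α
= g, β = 1 (`IsSignTwisted`). On eigenvectors of g this Φ is the 3-cocycle (−1)^(abc) of the group
of order two, which settles the pentagon and the antipode identities for Φ once and for all. The
other axioms concern an element h, and the elements that satisfy them form a subalgebra
(`axiomsSubalgebra`), so generators suffice. For the generators x and y the point is that ω = p₊ + q
p₋ fails to be group-like only by the sign q² = −1 on p₋ ⊗ p₋, and Φ corrects exactly this sign.

(1) A character σ of H_q(16) kills the nilpotent x and is ±1 on g₁ and g₂. If σ(g₁) = −1, then σ * σ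
= ε, and σ ⊗ σ applied to the formula for Δ(v) gives 1 = (−1)³ σ(v)² = −1. If σ = ε, then σ(v) = −1
contradicts ε(v) = 1. So σ = σ₀; its contractions of Φ are trivial, and v is group-like and commutes
with x. The element v is determined by its images in H_q(8) under g₂ ↦ 1 and g₂ ↦ −1. The first is
group-like and commutes with x, hence is 1 (`H8.eq_one_of_grouplike`); the second arises from the
first by the twist (Id ⊗ σ₀)Δ, which acts on v by −1.

(2) Since σ₀ is 1 on g₁ and −1 on g₂, the element θ commutes with g₁ and x, anticommutes with g₂,
and Δ(θ) = g₂ ⊗ θ + θ ⊗ 1. Thus g₂ and θ generate a copy of H₄ commuting with H_q(8).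

(3) A braided Hopf algebra of dimension two has a basis 1, b with ε(b) = 0, and its structure is a
character χ (action), an element s (coaction) and scalars l, m with b b = l b and Δ(b) = b ⊗ 1 + 1 ⊗
b + m b ⊗ b (`exists_isRankTwo`). The characters of H are ε and one with g ↦ −1. In the second case
parity forces l = m = 0, multiplicativity of Δ forces χ(s) = −1, and the coaction axiom evaluated by
χ ⊗ χ becomes −1 = 1. In the first case multiplicativity of Δ gives (lm + 1)(lm + 2) = 0; the root
−1 would make the group-like element 1 + m b idempotent and is excluded by the antipode, while the
root −2 makes it an involution. Finally s is group-like and idempotent, hence 1. -/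

namespace QH

noncomputable section

/-! ### Quasi-Hopf axioms checked on generators -/

section

namespace QuasiHopfData

variable {k : Type u} {H : Type v} [Field k] [Ring H] [Algebra k H]

section Hom

variable (D : QuasiHopfData k H) [hD : D.IsMult]

/-- The comultiplication as a morphism of algebras. -/
def comulHom : H →ₐ[k] H ⊗[k] H := AlgHom.ofLinearMap D.comul hD.comul_one hD.comul_mul

/-- The counit as a morphism of algebras. -/
def counitHom : H →ₐ[k] k := AlgHom.ofLinearMap D.counit hD.counit_one hD.counit_mul

/-- `(Δ ⊗ Id) Δ` as a morphism of algebras. -/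
def comulLeftHom : H →ₐ[k] H ⊗[k] (H ⊗[k] H) :=
  (Algebra.TensorProduct.assoc k k k H H H).toAlgHom.comp
    ((Algebra.TensorProduct.map D.comulHom (AlgHom.id k H)).comp D.comulHom)

/-- `(Id ⊗ Δ) Δ` as a morphism of algebras. -/
def comulRightHom : H →ₐ[k] H ⊗[k] (H ⊗[k] H) :=
  (Algebra.TensorProduct.map (AlgHom.id k H) D.comulHom).comp D.comulHom

theorem comulHom_apply (h : H) : D.comulHom h = D.comul h := rfl

theorem counitHom_apply (h : H) : D.counitHom h = D.counit h := rfl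

theorem comulLeftHom_apply (h : H) : D.comulLeftHom h = D.comulLeft h := rfl

theorem comulRightHom_apply (h : H) : D.comulRightHom h = D.comulRight h := rfl

/-- `(Id ⊗ ε) Δ` as a morphism of algebras. -/
def lTensorCounitHom : H →ₐ[k] H :=
  (Algebra.TensorProduct.rid k k H).toAlgHom.comp
    ((Algebra.TensorProduct.map (AlgHom.id k H) D.counitHom).comp D.comulHom)

/-- `(ε ⊗ Id) Δ` as a morphism of algebras. -/
def rTensorCounitHom : H →ₐ[k] H :=
  (Algebra.TensorProduct.lid k H).toAlgHom.comp
    ((Algebra.TensorProduct.map D.counitHom (AlgHom.id k H)).comp D.comulHom)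

theorem lTensorCounitHom_apply (h : H) :
    D.lTensorCounitHom h = TensorProduct.rid k H (D.counit.lTensor H (D.comul h)) := rfl

theorem rTensorCounitHom_apply (h : H) :
    D.rTensorCounitHom h = TensorProduct.lid k H (D.counit.rTensor H (D.comul h)) := rfl

end Hom

section AxiomsAt

variable (D : QuasiHopfData k H)

/-- `a ⊗ b ↦ S(a) α b`. -/
def alphaMap : H ⊗[k] H →ₗ[k] H :=
  LinearMap.mul' k H ∘ₗ TensorProduct.map D.antipode (LinearMap.mulLeft k D.alpha)

/-- `a ⊗ b ↦ a β S(b)`. -/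
def betaMap : H ⊗[k] H →ₗ[k] H :=
  LinearMap.mul' k H ∘ₗ TensorProduct.map LinearMap.id (LinearMap.mulLeft k D.beta ∘ₗ D.antipode)

theorem alphaMap_tmul (a b : H) : D.alphaMap (a ⊗ₜ[k] b) = D.antipode a * (D.alpha * b) := rfl

theorem betaMap_tmul (a b : H) : D.betaMap (a ⊗ₜ[k] b) = a * (D.beta * D.antipode b) := rfl

/-- The axioms of a quasi-Hopf algebra that involve an element `h`, for a given `h`. -/
structure AxiomsAt (h : H) : Prop where
  -- Written without Φ⁻¹, so that stability under products is immediate.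
  coassoc : D.comulRight h * D.Phi = D.Phi * D.comulLeft h
  lTensor_counit : TensorProduct.rid k H (D.counit.lTensor H (D.comul h)) = h
  rTensor_counit : TensorProduct.lid k H (D.counit.rTensor H (D.comul h)) = h
  antipode_alpha : D.alphaMap (D.comul h) = D.counit h • D.alpha
  antipode_beta : D.betaMap (D.comul h) = D.counit h • D.beta

/-- The antipode reverses products, so the inner expression S(y¹) α y² forms first and collapses to
c α. With y = Δ(a) and c = ε(a) this is the closure of the α-axiom under products. -/
theorem alphaMap_mul (hS : ∀ a b, D.antipode (a * b) = D.antipode b * D.antipode a)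
    {y : H ⊗[k] H} {c : k} (hy : D.alphaMap y = c • D.alpha) (z : H ⊗[k] H) :
    D.alphaMap (y * z) = c • D.alphaMap z := by
  induction z using TensorProduct.induction_on with
  | zero => simp
  | add z z' hz hz' => rw [mul_add, map_add, map_add, hz, hz', smul_add]
  | tmul a b =>
    have : ∀ y : H ⊗[k] H, D.alphaMap (y * a ⊗ₜ[k] b) = D.antipode a * (D.alphaMap y * b) := by
      intro y
      induction y using TensorProduct.induction_on with
      | zero => simp
      | add y y' h h' => rw [add_mul, map_add, map_add, h, h', add_mul, mul_add]
      | tmul c d =>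
        rw [Algebra.TensorProduct.tmul_mul_tmul, alphaMap_tmul, alphaMap_tmul, hS]
        simp only [mul_assoc]
    rw [this, hy, alphaMap_tmul, smul_mul_assoc, mul_smul_comm]

/-- Mirror image of `alphaMap_mul`: here the right factor sits inside and is absorbed. -/
theorem betaMap_mul (hS : ∀ a b, D.antipode (a * b) = D.antipode b * D.antipode a)
    {z : H ⊗[k] H} {c : k} (hz : D.betaMap z = c • D.beta) (y : H ⊗[k] H) :
    D.betaMap (y * z) = c • D.betaMap y := by
  induction y using TensorProduct.induction_on with
  | zero => simp
  | add y y' h h' => rw [add_mul, map_add, map_add, h, h', smul_add]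
  | tmul a b =>
    have : ∀ z : H ⊗[k] H, D.betaMap (a ⊗ₜ[k] b * z) = a * (D.betaMap z * D.antipode b) := by
      intro z
      induction z using TensorProduct.induction_on with
      | zero => simp
      | add y y' h h' => rw [mul_add, map_add, map_add, h, h', add_mul, mul_add]
      | tmul c d =>
        rw [Algebra.TensorProduct.tmul_mul_tmul, betaMap_tmul, betaMap_tmul, hS]
        simp only [mul_assoc]
    rw [this, hz, betaMap_tmul, smul_mul_assoc, mul_smul_comm]

/-- The elements at which the axioms of a quasi-Hopf algebra hold form a subalgebra. -/
def axiomsSubalgebra [hD : D.IsMult] (hS1 : D.antipode 1 = 1)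
    (hS : ∀ a b, D.antipode (a * b) = D.antipode b * D.antipode a) : Subalgebra k H where
  carrier := {h | D.AxiomsAt h}
  mul_mem' {a b} ha hb := by
    refine ⟨?_, ?_, ?_, ?_, ?_⟩
    · have h1 := ha.coassoc
      have h2 := hb.coassoc
      simp only [← comulLeftHom_apply, ← comulRightHom_apply, map_mul] at h1 h2 ⊢
      rw [mul_assoc, h2, ← mul_assoc, h1, mul_assoc]
    · have h1 := ha.lTensor_counit
      have h2 := hb.lTensor_counit
      rw [← lTensorCounitHom_apply] at h1 h2 ⊢
      rw [map_mul, h1, h2]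
    · have h1 := ha.rTensor_counit
      have h2 := hb.rTensor_counit
      rw [← rTensorCounitHom_apply] at h1 h2 ⊢
      rw [map_mul, h1, h2]
    · rw [hD.comul_mul, D.alphaMap_mul hS ha.antipode_alpha, hb.antipode_alpha, hD.counit_mul,
        smul_smul]
    · rw [hD.comul_mul, D.betaMap_mul hS hb.antipode_beta, ha.antipode_beta, hD.counit_mul,
        smul_smul, mul_comm]
  add_mem' {a b} ha hb := by
    refine ⟨?_, ?_, ?_, ?_, ?_⟩
    · rw [map_add, map_add, add_mul, mul_add, ha.coassoc, hb.coassoc]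
    · rw [map_add, map_add, map_add, ha.lTensor_counit, hb.lTensor_counit]
    · rw [map_add, map_add, map_add, ha.rTensor_counit, hb.rTensor_counit]
    · rw [map_add, map_add, map_add, ha.antipode_alpha, hb.antipode_alpha, add_smul]
    · rw [map_add, map_add, map_add, ha.antipode_beta, hb.antipode_beta, add_smul]
  algebraMap_mem' c := by
    refine ⟨?_, ?_, ?_, ?_, ?_⟩
    · rw [← comulLeftHom_apply, ← comulRightHom_apply, AlgHom.commutes, AlgHom.commutes]
      exact Algebra.commutes _ _
    · rw [← lTensorCounitHom_apply, AlgHom.commutes]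
    · rw [← rTensorCounitHom_apply, AlgHom.commutes]
    · rw [Algebra.algebraMap_eq_smul_one, map_smul, map_smul, map_smul, hD.comul_one,
        hD.counit_one, Algebra.TensorProduct.one_def, alphaMap_tmul, hS1, one_mul, mul_one,
        smul_eq_mul, mul_one]
    · rw [Algebra.algebraMap_eq_smul_one, map_smul, map_smul, map_smul, hD.comul_one,
        hD.counit_one, Algebra.TensorProduct.one_def, betaMap_tmul, hS1, one_mul, mul_one,
        smul_eq_mul, mul_one]

end AxiomsAt

/-- The structure maps of `D` on an involution `g` and its reassociator, `α` and `β` are those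
of the quasi-Hopf algebras `H_q(8)` and `H(32)`. -/
structure IsSignTwisted (D : QuasiHopfData k H) (g : H) : Prop where
  sq : g * g = 1
  comul_eq : D.comul g = g ⊗ₜ[k] g
  counit_eq : D.counit g = 1
  antipode_eq : D.antipode g = g
  Phi_eq : D.Phi = phiGen k g
  alpha_eq : D.alpha = g
  beta_eq : D.beta = 1

/-! ### Quasi-Hopf algebras with the sign reassociator -/

namespace IsSignTwisted

variable {D : QuasiHopfData k H} {g : H}

theorem PhiInv_eq (hg : D.IsSignTwisted g) (h2 : (2 : k) ≠ 0) : D.PhiInv = phiGen k g := by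
  have h := phiGen_mul_self h2 hg.sq
  have h' : D.PhiInv * D.Phi = 1 := D.reassoc.inv_mul
  rw [hg.Phi_eq] at h'
  exact left_inv_eq_right_inv h' h

/-- Serves to eliminate g, so that computations involve the single idempotent p₋ and the other
generators. -/
theorem eq_one_sub (h2 : (2 : k) ≠ 0) (g : H) : g = 1 - (2 : k) • pMinus k g := by
  rw [pMinus, smul_smul, mul_inv_cancel₀ h2, one_smul, sub_sub_cancel]

theorem pPlus_eq (h2 : (2 : k) ≠ 0) (g : H) : pPlus k g = 1 - pMinus k g := by
  rw [← pPlus_add_pMinus h2 g, add_sub_cancel_right]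

theorem counit_pMinus [hD : D.IsMult] (hg : D.IsSignTwisted g) : D.counit (pMinus k g) = 0 := by
  rw [pMinus, map_smul, map_sub, hD.counit_one, hg.counit_eq, sub_self, smul_zero]

/-- A product of two characters of ⟨g⟩ is odd when exactly one of them is, which is the polynomial a
+ b − 2ab in the parities. -/
theorem comul_pMinus [hD : D.IsMult] (hg : D.IsSignTwisted g) (h2 : (2 : k) ≠ 0) :
    D.comul (pMinus k g) = pMinus k g ⊗ₜ[k] 1 + 1 ⊗ₜ[k] pMinus k g
      - (2 : k) • pMinus k g ⊗ₜ[k] pMinus k g := by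
  have e := eq_one_sub h2 g
  have : D.comul g = g ⊗ₜ[k] g := hg.comul_eq
  generalize pMinus k g = M at *
  subst e
  rw [map_sub, map_smul, hD.comul_one, Algebra.TensorProduct.one_def] at this
  -- Substituting g = 1 − 2M in Δ(g) = g ⊗ g determines only 2Δ(M); the factor 2 is then cancelled.
  have h3 : (2 : k) • D.comul M = (2 : k) • (M ⊗ₜ[k] 1 + 1 ⊗ₜ[k] M - (2 : k) • M ⊗ₜ[k] M) := by
    rw [← sub_right_inj, this]
    simp only [TensorProduct.sub_tmul, TensorProduct.tmul_sub, ← TensorProduct.smul_tmul',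
      TensorProduct.tmul_smul]
    module
  exact smul_right_injective _ h2 h3

theorem antipode_pMinus (hg : D.IsSignTwisted g) (hS1 : D.antipode 1 = 1) :
    D.antipode (pMinus k g) = pMinus k g := by
  rw [pMinus, map_smul, map_sub, hS1, hg.antipode_eq]

/-- On eigenvectors of g of parities a, b, c, d this is the cocycle identity bcd + a(b + c)d + abc =
ab(c + d) + (a + b)cd modulo 2. The proof expands both sides as polynomials in copies of the
idempotent p₋. -/
theorem pentagon [hD : D.IsMult] (hg : D.IsSignTwisted g) (h2 : (2 : k) ≠ 0) :
    ((1 : H) ⊗ₜ[k] D.Phi)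
        * ((TensorProduct.assoc k H H H).toLinearMap ∘ₗ D.comul.rTensor H).lTensor H D.Phi
        * (TensorProduct.assoc k H H H).toLinearMap.lTensor H
            (TensorProduct.assoc k H (H ⊗[k] H) H (D.Phi ⊗ₜ[k] (1 : H)))
      = (D.comul.lTensor H).lTensor H D.Phi
        * TensorProduct.assoc k H H (H ⊗[k] H) (D.comul.rTensor (H ⊗[k] H) D.Phi) := by
  have hM := hg.comul_pMinus h2
  have hMM := pMinus_mul_pMinus h2 hg.sq
  have e1 : ∀ a b c : H ⊗[k] (H ⊗[k] (H ⊗[k] H)), a * (b - c) = a * b - a * c :=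
    fun a b c => mul_sub a b c
  have e2 : ∀ a b c : H ⊗[k] (H ⊗[k] (H ⊗[k] H)), (a - b) * c = a * c - b * c :=
    fun a b c => sub_mul a b c
  have e3 : ∀ a b c : H ⊗[k] (H ⊗[k] (H ⊗[k] H)), a * (b + c) = a * b + a * c :=
    fun a b c => Distrib.left_distrib a b c
  have e4 : ∀ a b c : H ⊗[k] (H ⊗[k] (H ⊗[k] H)), (a + b) * c = a * c + b * c :=
    fun a b c => Distrib.right_distrib a b c
  have e5 : ∀ (r : k) (a b : H ⊗[k] (H ⊗[k] (H ⊗[k] H))), r • a * b = r • (a * b) :=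
    smul_mul_assoc
  have e6 : ∀ (r : k) (a b : H ⊗[k] (H ⊗[k] (H ⊗[k] H))), a * r • b = r • (a * b) :=
    fun r a b => mul_smul_comm r a b
  have e7 : ∀ (a a' : H) (b b' : H ⊗[k] (H ⊗[k] H)),
      a ⊗ₜ[k] b * a' ⊗ₜ[k] b' = (a * a') ⊗ₜ[k] (b * b') :=
    Algebra.TensorProduct.tmul_mul_tmul
  rw [hg.Phi_eq, phiGen]
  generalize pMinus k g = M at *
  simp only [Algebra.TensorProduct.one_def, map_sub, map_add, map_smul, TensorProduct.tmul_sub,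
    TensorProduct.sub_tmul, TensorProduct.tmul_add, TensorProduct.add_tmul,
    TensorProduct.tmul_smul, ← TensorProduct.smul_tmul', hM, hD.comul_one,
    LinearMap.lTensor_tmul, LinearMap.rTensor_tmul, LinearMap.comp_apply, LinearEquiv.coe_coe,
    TensorProduct.assoc_tmul, e1, e2, e3, e4, e5, e6, e7,
    Algebra.TensorProduct.tmul_mul_tmul, hMM, mul_one, one_mul]
  module

theorem normalized [hD : D.IsMult] (hg : D.IsSignTwisted g) :
    ((TensorProduct.lid k H).toLinearMap ∘ₗ D.counit.rTensor H).lTensor H D.Phi = 1 := by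
  rw [hg.Phi_eq, phiGen]
  simp [Algebra.TensorProduct.one_def, hg.counit_pMinus, hD.counit_one]

/-- The pentagon, the normalization and the two antipode identities for Φ and Φ⁻¹ involve only g;
the rest spreads from the generators through `axiomsSubalgebra`. -/
theorem isQuasiHopf [hD : D.IsMult] (hg : D.IsSignTwisted g) (h2 : (2 : k) ≠ 0)
    (hS1 : D.antipode 1 = 1) (hS : ∀ a b, D.antipode (a * b) = D.antipode b * D.antipode a)
    {s : Set H} (hs : Algebra.adjoin k s = ⊤) (h : ∀ a ∈ s, D.AxiomsAt a) : D.IsQuasiHopf := by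
  have key : ∀ a, D.AxiomsAt a := by
    intro a
    have h1 : Algebra.adjoin k s ≤ D.axiomsSubalgebra hS1 hS := Algebra.adjoin_le h
    rw [hs] at h1
    exact h1 Algebra.mem_top
  have hMM := pMinus_mul_pMinus h2 hg.sq
  have hSM := hg.antipode_pMinus hS1
  have hgM := mul_pMinus (k := k) hg.sq
  exact
    { quasi_coassoc := fun a => by
        rw [← (key a).coassoc, mul_assoc]
        exact (mul_one _).symm.trans (congrArg _ D.reassoc.mul_inv.symm)
      lTensor_counit := fun a => (key a).lTensor_counit
      rTensor_counit := fun a => (key a).rTensor_counit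
      normalized := hg.normalized
      pentagon := hg.pentagon h2
      antipode_one := hS1
      antipode_mul := hS
      antipode_alpha := fun a => (key a).antipode_alpha
      antipode_beta := fun a => (key a).antipode_beta
      reassoc_antipode := by
        rw [hg.Phi_eq, phiGen, hg.alpha_eq, hg.beta_eq, Algebra.TensorProduct.one_def,
          Algebra.TensorProduct.one_def]
        simp only [map_sub, map_smul, TensorProduct.map_tmul, LinearMap.comp_apply,
          LinearMap.mul'_apply, LinearMap.mulLeft_apply, LinearMap.id_apply, hS1, hSM, hgM,
          one_mul, mul_one, mul_neg, hMM]
        -- What is left is g + 2 p₋ = 1, the sign of the second term coming from g p₋ = −p₋.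
        nth_rw 1 [eq_one_sub h2 g]
        module
      reassocInv_antipode := by
        rw [hg.PhiInv_eq h2, phiGen, hg.alpha_eq, hg.beta_eq, Algebra.TensorProduct.one_def,
          Algebra.TensorProduct.one_def]
        simp only [map_sub, map_smul, TensorProduct.map_tmul, LinearMap.comp_apply,
          LinearMap.mul'_apply, LinearMap.mulLeft_apply, hS1, hSM, hgM,
          one_mul, mul_one, mul_neg, neg_mul, hMM]
        nth_rw 1 [eq_one_sub h2 g]
        module }

/-- The axioms at a generator `x` with `Δ(x) = x ⊗ (p₊ + q p₋) + 1 ⊗ p₊ x + g ⊗ p₋ x`. -/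
theorem axiomsAt_comulGen [hD : D.IsMult] (hg : D.IsSignTwisted g) (h2 : (2 : k) ≠ 0)
    (hS1 : D.antipode 1 = 1) (hS : ∀ a b, D.antipode (a * b) = D.antipode b * D.antipode a)
    {q : k} (hq : q ^ 2 = -1) {x : H} (hx : g * x = -(x * g)) (hΔ : D.comul x = comulGen q g x)
    (hε : D.counit x = 0) (hSx : D.antipode x = antipodeGen q g x) : D.AxiomsAt x := by
  have hM := hg.comul_pMinus h2
  have hεM := hg.counit_pMinus
  have hMM := pMinus_mul_pMinus h2 hg.sq
  have hSM := hg.antipode_pMinus hS1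
  have hMx : pMinus k g * x = x - x * pMinus k g := by
    rw [pMinus_mul hx, pPlus_eq h2, mul_sub, mul_one]
  have hΦ := hg.Phi_eq
  have hα := hg.alpha_eq
  have hβ := hg.beta_eq
  have e := eq_one_sub h2 g
  rw [phiGen] at hΦ
  rw [comulGen, pPlus_eq h2] at hΔ
  rw [antipodeGen, pPlus_eq h2] at hSx
  -- From here on only x and the idempotent M occur, and M x = x − x M moves every M to the right of
  -- x.
  generalize pMinus k g = M at *
  subst e
  have hMx' : ∀ t, M * (x * t) = x * t - x * (M * t) := by
    intro t
    rw [← mul_assoc, hMx, sub_mul, mul_assoc]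
  refine ⟨?_, ?_, ?_, ?_, ?_⟩
  · rw [comulRight, comulLeft, hΦ]
    simp only [LinearMap.comp_apply, hΔ, LinearEquiv.coe_coe, map_add, map_sub, map_smul,
      TensorProduct.tmul_sub, TensorProduct.sub_tmul, TensorProduct.tmul_add,
      TensorProduct.add_tmul, mul_one, one_mul,
      TensorProduct.tmul_smul, ← TensorProduct.smul_tmul', hM, hD.comul_one, hD.comul_mul,
      LinearMap.lTensor_tmul, LinearMap.rTensor_tmul, Algebra.TensorProduct.one_def,
      TensorProduct.assoc_tmul, mul_sub, sub_mul, mul_add, add_mul, smul_mul_assoc, mul_smul_comm,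
      Algebra.TensorProduct.tmul_mul_tmul, hMM, mul_assoc, hMx, hMx']
    -- The relation q² = −1 is needed to compare x ⊗ Δ(ω) with x ⊗ ω ⊗ ω, where ω = p₊ + q p₋: on p₋
    -- ⊗ p₋ the factor is 1 in the first and q² in the second, and conjugation by Φ supplies the
    -- sign.
    match_scalars <;>
      first
        | ring1
        | linear_combination hq
        | linear_combination (-2) * hq
  · simp [hΔ, hD.counit_mul, hD.counit_one, hε, hεM]
  · simp [hΔ, hD.counit_one, hε, hεM, sub_mul]
  · simp only [hΔ, hα, map_add, map_sub, map_smul, alphaMap_tmul, hSx, hε, hS1, hSM, mul_sub,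
      sub_mul, mul_add, add_mul, smul_mul_assoc, mul_smul_comm, hMM, mul_assoc, hMx, hMx',
      mul_one, one_mul, neg_mul]
    -- The identity is −x ω g ω + p₊ x + p₋ x = 0, which holds because g ω² = p₊ − q² p₋ = 1.
    match_scalars <;>
      first
        | ring1
        | linear_combination hq
  · simp only [hΔ, hβ, map_add, map_sub, map_smul, betaMap_tmul, hS, hSx, hε, hS1, hSM, mul_sub,
      sub_mul, mul_add, smul_mul_assoc, mul_smul_comm, hMM, hMx, hMx',
      mul_one, one_mul, mul_neg]
    module

/-- The axioms at a group-like element that commutes with `g`. -/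
theorem axiomsAt_grouplike (hg : D.IsSignTwisted g) {a : H} (ha : g * a = a * g)
    (hΔ : D.comul a = a ⊗ₜ[k] a) (hε : D.counit a = 1) (hS : D.antipode a = a)
    (haa : a * a = 1) : D.AxiomsAt a := by
  have hMa : pMinus k g * a = a * pMinus k g := by
    rw [pMinus, smul_mul_assoc, mul_smul_comm, sub_mul, mul_sub, ha, one_mul, mul_one]
  refine ⟨?_, ?_, ?_, ?_, ?_⟩
  · rw [comulRight, comulLeft, hg.Phi_eq, phiGen]
    simp only [LinearMap.comp_apply, hΔ, LinearEquiv.coe_coe, LinearMap.lTensor_tmul,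
      LinearMap.rTensor_tmul, TensorProduct.assoc_tmul, mul_sub, sub_mul, mul_one, one_mul,
      smul_mul_assoc, mul_smul_comm, Algebra.TensorProduct.tmul_mul_tmul, hMa]
  · simp [hΔ, hε]
  · simp [hΔ, hε]
  · rw [hΔ, alphaMap_tmul, hS, hε, one_smul, hg.alpha_eq, ha, ← mul_assoc, haa, one_mul]
  · rw [hΔ, betaMap_tmul, hS, hε, one_smul, hg.beta_eq, one_mul, haa]

/-- The axioms at an element `t` with `Δ(t) = a ⊗ t + t ⊗ 1`, for a group-like element `a`, where
`a` and `t` commute with `g`. -/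
theorem axiomsAt_skewPrimitive [hD : D.IsMult] (hg : D.IsSignTwisted g) (hS1 : D.antipode 1 = 1)
    {a t : H} (ha : g * a = a * g) (ht : g * t = t * g)
    (hΔa : D.comul a = a ⊗ₜ[k] a) (hεa : D.counit a = 1) (hSa : D.antipode a = a)
    (haa : a * a = 1) (hΔ : D.comul t = a ⊗ₜ[k] t + t ⊗ₜ[k] 1) (hε : D.counit t = 0)
    (hS : D.antipode t = -(a * t)) : D.AxiomsAt t := by
  have hMa : pMinus k g * a = a * pMinus k g := by
    rw [pMinus, smul_mul_assoc, mul_smul_comm, sub_mul, mul_sub, ha, one_mul, mul_one]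
  have hMt : pMinus k g * t = t * pMinus k g := by
    rw [pMinus, smul_mul_assoc, mul_smul_comm, sub_mul, mul_sub, ht, one_mul, mul_one]
  refine ⟨?_, ?_, ?_, ?_, ?_⟩
  · rw [comulRight, comulLeft, hg.Phi_eq, phiGen]
    simp only [LinearMap.comp_apply, hΔ, hΔa, hD.comul_one, LinearEquiv.coe_coe, map_add,
      LinearMap.lTensor_tmul, LinearMap.rTensor_tmul, TensorProduct.assoc_tmul,
      TensorProduct.tmul_add, TensorProduct.add_tmul, Algebra.TensorProduct.one_def,
      mul_sub, sub_mul, mul_add, add_mul, mul_one, one_mul,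
      smul_mul_assoc, mul_smul_comm, Algebra.TensorProduct.tmul_mul_tmul, hMa, hMt]
    module
  · simp [hΔ, hε, hD.counit_one]
  · simp [hΔ, hε, hεa]
  · rw [hΔ, map_add, alphaMap_tmul, alphaMap_tmul, hSa, hS, hε, zero_smul, hg.alpha_eq, ht,
      mul_one, neg_mul, mul_assoc, add_neg_cancel]
  · rw [hΔ, map_add, betaMap_tmul, betaMap_tmul, hS, hε, hS1, zero_smul, hg.beta_eq, one_mul,
      one_mul, mul_one, mul_neg, ← mul_assoc, haa, one_mul, neg_add_cancel]

end IsSignTwisted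

end QuasiHopfData

end

/-! ### Naturality of the generator formulas, and tensor products of structure maps -/

section

section Naturality

variable {k : Type u} {A : Type v} {B : Type w} [Field k] [Ring A] [Algebra k A] [Ring B]
  [Algebra k B] (f : A →ₐ[k] B)

theorem map_pPlus (g : A) : f (pPlus k g) = pPlus k (f g) := by simp [pPlus]

theorem map_pMinus (g : A) : f (pMinus k g) = pMinus k (f g) := by simp [pMinus]

theorem map_comulGen (q : k) (g x : A) :
    Algebra.TensorProduct.map f f (comulGen q g x) = comulGen q (f g) (f x) := by
  simp [comulGen, map_pPlus, map_pMinus]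

theorem map_antipodeGen (q : k) (g x : A) :
    f (antipodeGen q g x) = antipodeGen q (f g) (f x) := by
  simp [antipodeGen, map_pPlus, map_pMinus]

theorem map_phiGen (g : A) :
    Algebra.TensorProduct.map f (Algebra.TensorProduct.map f f) (phiGen k g)
      = phiGen k (f g) := by
  simp [phiGen, map_pMinus]

/-- A morphism of algebras to the opposite algebra, as an anti-multiplicative map. -/
theorem unop_map_mul (f : A →ₐ[k] Aᵐᵒᵖ) (a b : A) :
    ((MulOpposite.opLinearEquiv k).symm.toLinearMap ∘ₗ f.toLinearMap) (a * b)
      = ((MulOpposite.opLinearEquiv k).symm.toLinearMap ∘ₗ f.toLinearMap) b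
        * ((MulOpposite.opLinearEquiv k).symm.toLinearMap ∘ₗ f.toLinearMap) a := by
  simp

theorem unop_map_one (f : A →ₐ[k] Aᵐᵒᵖ) :
    ((MulOpposite.opLinearEquiv k).symm.toLinearMap ∘ₗ f.toLinearMap) 1 = 1 := by
  simp

theorem adjoin_range_mkAlgHom {X : Type w} (r : FreeAlgebra k X → FreeAlgebra k X → Prop) :
    Algebra.adjoin k (Set.range fun i => RingQuot.mkAlgHom k r (FreeAlgebra.ι k i)) = ⊤ := by
  have h := AlgHom.map_adjoin (RingQuot.mkAlgHom k r) (Set.range (FreeAlgebra.ι k (X := X)))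
  rw [FreeAlgebra.adjoin_range_ι, Algebra.map_top, ← Set.range_comp] at h
  refine h.symm.trans ?_
  exact (AlgHom.range_eq_top _).mpr (RingQuot.mkAlgHom_surjective k r)

end Naturality

namespace QuasiHopfData

variable {k : Type u} {A : Type v} {B : Type w} [Field k] [Ring A] [Algebra k A] [Ring B]
  [Algebra k B] (D : QuasiHopfData k A) (E : QuasiHopfData k B)

theorem tensor_comul_one_tmul [hD : D.IsMult] (b : B) :
    (D.tensor E).comul (1 ⊗ₜ[k] b)
      = Algebra.TensorProduct.map (Algebra.TensorProduct.includeRight : B →ₐ[k] A ⊗[k] B)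
          Algebra.TensorProduct.includeRight (E.comul b) := by
  have key : ∀ z : B ⊗[k] B,
      TensorProduct.tensorTensorTensorComm k A A B B ((1 ⊗ₜ[k] 1) ⊗ₜ[k] z)
      = Algebra.TensorProduct.map (Algebra.TensorProduct.includeRight : B →ₐ[k] A ⊗[k] B)
          Algebra.TensorProduct.includeRight z := by
    intro z
    induction z using TensorProduct.induction_on with
    | zero => simp
    | add a b ha hb => rw [TensorProduct.tmul_add, map_add, map_add, ha, hb]
    | tmul a b => simp
  rw [← key]
  change TensorProduct.tensorTensorTensorComm k _ _ _ _ (TensorProduct.map _ _ _) = _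
  rw [TensorProduct.map_tmul, hD.comul_one, Algebra.TensorProduct.one_def]

theorem tensor_comul_tmul_one [hE : E.IsMult] (a : A) :
    (D.tensor E).comul (a ⊗ₜ[k] 1)
      = Algebra.TensorProduct.map (Algebra.TensorProduct.includeLeft : A →ₐ[k] A ⊗[k] B)
          Algebra.TensorProduct.includeLeft (D.comul a) := by
  have key : ∀ z : A ⊗[k] A,
      TensorProduct.tensorTensorTensorComm k A A B B (z ⊗ₜ[k] (1 ⊗ₜ[k] 1))
      = Algebra.TensorProduct.map (Algebra.TensorProduct.includeLeft : A →ₐ[k] A ⊗[k] B)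
          Algebra.TensorProduct.includeLeft z := by
    intro z
    induction z using TensorProduct.induction_on with
    | zero => simp
    | add a b ha hb => rw [TensorProduct.add_tmul, map_add, map_add, ha, hb]
    | tmul a b => simp
  rw [← key]
  change TensorProduct.tensorTensorTensorComm k _ _ _ _ (TensorProduct.map _ _ _) = _
  rw [TensorProduct.map_tmul, hE.comul_one, Algebra.TensorProduct.one_def]

/-- Only the right factor carries a reassociator. This keeps the sign-twisted shape of H_q(8) in
both k[C₂] ⊗ H_q(8) and H₄ ⊗ H_q(8). -/
theorem tensor_Phi (hD : D.reassoc = 1) :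
    (D.tensor E).Phi = Algebra.TensorProduct.map
      (Algebra.TensorProduct.includeRight : B →ₐ[k] A ⊗[k] B)
      (Algebra.TensorProduct.map (Algebra.TensorProduct.includeRight : B →ₐ[k] A ⊗[k] B)
        Algebra.TensorProduct.includeRight) E.Phi := by
  unfold QuasiHopfData.Phi
  simp only [QuasiHopfData.tensor, hD, map_one, one_mul]
  rfl

theorem tensor_antipode_mul
    (hD : ∀ a b, D.antipode (a * b) = D.antipode b * D.antipode a)
    (hE : ∀ a b, E.antipode (a * b) = E.antipode b * E.antipode a) (a b : A ⊗[k] B) :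
    (D.tensor E).antipode (a * b) = (D.tensor E).antipode b * (D.tensor E).antipode a := by
  have e : ∀ a b, (D.tensor E).antipode (a ⊗ₜ[k] b) = D.antipode a ⊗ₜ[k] E.antipode b :=
    fun _ _ => rfl
  induction a using TensorProduct.induction_on with
  | zero => simp
  | add a a' ha ha' => rw [add_mul, map_add, map_add, ha, ha', mul_add]
  | tmul a h =>
    induction b using TensorProduct.induction_on with
    | zero => simp
    | add b b' hb hb' => rw [mul_add, map_add, map_add, hb, hb', add_mul]
    | tmul b h' =>
      rw [Algebra.TensorProduct.tmul_mul_tmul, e, e, e, hD, hE,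
        Algebra.TensorProduct.tmul_mul_tmul]

end QuasiHopfData

/-! ### Generators and structure maps -/

namespace H4

variable {k : Type u} [Field k]

theorem adjoin_eq_top : Algebra.adjoin k {g k, x k} = ⊤ := by
  have h : Algebra.adjoin k (Set.range fun i =>
      (RingQuot.mkAlgHom k (H4.Rel k) (FreeAlgebra.ι k i) : H4 k)) = ⊤ :=
    adjoin_range_mkAlgHom _
  refine top_le_iff.mp (h.symm.le.trans (Algebra.adjoin_mono ?_))
  rintro _ ⟨_ | _, rfl⟩
  · exact Or.inl rfl
  · exact Or.inr rfl

section
variable {R : Type*} [Ring R] [Algebra k R] (a b : R) (ha : a * a = 1) (hb : b * b = 0)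
    (hab : a * b = -(b * a))

theorem lift_g : lift a b ha hb hab (g k) = a :=
  (RingQuot.liftAlgHom_mkAlgHom_apply _ _ _ _).trans (FreeAlgebra.lift_ι_apply _ _)

theorem lift_x : lift a b ha hb hab (x k) = b :=
  (RingQuot.liftAlgHom_mkAlgHom_apply _ _ _ _).trans (FreeAlgebra.lift_ι_apply _ _)

end

variable (k)

instance : (data k).IsMult where
  comul_one := map_one (lift _ _ _ _ _)
  comul_mul := map_mul (lift _ _ _ _ _)
  counit_one := map_one (lift _ _ _ _ _)
  counit_mul := map_mul (lift _ _ _ _ _)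

theorem comul_g : (data k).comul (g k) = g k ⊗ₜ[k] g k := lift_g _ _ _ _ _

theorem comul_x : (data k).comul (x k) = g k ⊗ₜ[k] x k + x k ⊗ₜ[k] 1 := lift_x _ _ _ _ _

theorem counit_g : (data k).counit (g k) = 1 := lift_g _ _ _ _ _

theorem counit_x : (data k).counit (x k) = 0 := lift_x _ _ _ _ _

theorem antipode_g : (data k).antipode (g k) = g k :=
  congrArg MulOpposite.unop (lift_g (k := k) _ _ _ _ _)

theorem antipode_x : (data k).antipode (x k) = -(g k * x k) :=
  congrArg MulOpposite.unop (lift_x (k := k) _ _ _ _ _)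

theorem antipode_one : (data k).antipode 1 = 1 := unop_map_one _

theorem antipode_mul (a b : H4 k) :
    (data k).antipode (a * b) = (data k).antipode b * (data k).antipode a := unop_map_mul _ a b

end H4

namespace H8

variable {k : Type u} [Field k]

theorem adjoin_eq_top : Algebra.adjoin k {g k, x k} = ⊤ := by
  have h : Algebra.adjoin k (Set.range fun i =>
      (RingQuot.mkAlgHom k (H8.Rel k) (FreeAlgebra.ι k i) : H8 k)) = ⊤ :=
    adjoin_range_mkAlgHom _
  refine top_le_iff.mp (h.symm.le.trans (Algebra.adjoin_mono ?_))
  rintro _ ⟨_ | _, rfl⟩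
  · exact Or.inl rfl
  · exact Or.inr rfl

section
variable {R : Type*} [Ring R] [Algebra k R] (a b : R) (ha : a * a = 1) (hb : b ^ 4 = 0)
    (hab : a * b = -(b * a))

theorem lift_g : lift a b ha hb hab (g k) = a :=
  (RingQuot.liftAlgHom_mkAlgHom_apply _ _ _ _).trans (FreeAlgebra.lift_ι_apply _ _)

theorem lift_x : lift a b ha hb hab (x k) = b :=
  (RingQuot.liftAlgHom_mkAlgHom_apply _ _ _ _).trans (FreeAlgebra.lift_ι_apply _ _)

end

variable (q : k) (hq : IsPrimitiveRoot q 4)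

theorem comul_g : (data q hq).comul (g k) = g k ⊗ₜ[k] g k := lift_g _ _ _ _ _

theorem comul_x : (data q hq).comul (x k) = comulGen q (g k) (x k) := lift_x _ _ _ _ _

theorem counit_g : (data q hq).counit (g k) = 1 := lift_g _ _ _ _ _

theorem counit_x : (data q hq).counit (x k) = 0 := lift_x _ _ _ _ _

theorem antipode_g : (data q hq).antipode (g k) = g k :=
  congrArg MulOpposite.unop (lift_g (k := k) _ _ _ _ _)

theorem antipode_x : (data q hq).antipode (x k) = antipodeGen q (g k) (x k) :=
  congrArg MulOpposite.unop (lift_x (k := k) _ _ _ _ _)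

theorem antipode_one : (data q hq).antipode 1 = 1 := unop_map_one _

theorem antipode_mul (a b : H8 k) :
    (data q hq).antipode (a * b) = (data q hq).antipode b * (data q hq).antipode a :=
  unop_map_mul _ a b

theorem isSignTwisted : (data q hq).IsSignTwisted (g k) where
  sq := g_sq k
  comul_eq := comul_g q hq
  counit_eq := counit_g q hq
  antipode_eq := antipode_g q hq
  Phi_eq := rfl
  alpha_eq := rfl
  beta_eq := rfl

theorem isQuasiHopf : (data q hq).IsQuasiHopf := by
  have h2 := two_ne_zero_of_primitive hq
  have hS1 := antipode_one q hq
  have hS := antipode_mul q hq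
  refine (isSignTwisted q hq).isQuasiHopf h2 hS1 hS adjoin_eq_top ?_
  rintro a (rfl | rfl)
  · exact (isSignTwisted q hq).axiomsAt_grouplike rfl (comul_g q hq) (counit_g q hq)
      (antipode_g q hq) (g_sq k)
  · exact (isSignTwisted q hq).axiomsAt_comulGen h2 hS1 hS (sq_of_primitive hq) (g_x k)
      (comul_x q hq) (counit_x q hq) (antipode_x q hq)

end H8

namespace H32

variable {k : Type u} [Field k] {q : k}

theorem adjoin_eq_top : Algebra.adjoin k {g q, x q, y q} = ⊤ := by
  have h : Algebra.adjoin k (Set.range fun i =>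
      (RingQuot.mkAlgHom k (H32.Rel q) (FreeAlgebra.ι k i) : H32 q)) = ⊤ :=
    adjoin_range_mkAlgHom _
  refine top_le_iff.mp (h.symm.le.trans (Algebra.adjoin_mono ?_))
  rintro _ ⟨_ | _ | _, rfl⟩
  · exact Or.inl rfl
  · exact Or.inr (Or.inl rfl)
  · exact Or.inr (Or.inr rfl)

section
variable {R : Type*} [Ring R] [Algebra k R] (a b c : R) (ha : a * a = 1) (hb : b ^ 4 = 0)
    (hc : c ^ 4 = 0) (hab : a * b = -(b * a)) (hac : a * c = -(c * a))
    (hcb : c * b = q • (b * c))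

theorem lift_g : lift a b c ha hb hc hab hac hcb (g q) = a :=
  (RingQuot.liftAlgHom_mkAlgHom_apply _ _ _ _).trans (FreeAlgebra.lift_ι_apply _ _)

theorem lift_x : lift a b c ha hb hc hab hac hcb (x q) = b :=
  (RingQuot.liftAlgHom_mkAlgHom_apply _ _ _ _).trans (FreeAlgebra.lift_ι_apply _ _)

theorem lift_y : lift a b c ha hb hc hab hac hcb (y q) = c :=
  (RingQuot.liftAlgHom_mkAlgHom_apply _ _ _ _).trans (FreeAlgebra.lift_ι_apply _ _)

end

variable (hq : IsPrimitiveRoot q 4)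

instance : (data hq).IsMult where
  comul_one := map_one (lift _ _ _ _ _ _ _ _ _)
  comul_mul := map_mul (lift _ _ _ _ _ _ _ _ _)
  counit_one := map_one (lift _ _ _ _ _ _ _ _ _)
  counit_mul := map_mul (lift _ _ _ _ _ _ _ _ _)

theorem comul_g : (data hq).comul (g q) = g q ⊗ₜ[k] g q := lift_g _ _ _ _ _ _ _ _ _

theorem comul_x : (data hq).comul (x q) = comulGen q (g q) (x q) := lift_x _ _ _ _ _ _ _ _ _

theorem comul_y : (data hq).comul (y q) = comulGen (-q) (g q) (y q) := lift_y _ _ _ _ _ _ _ _ _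

theorem counit_g : (data hq).counit (g q) = 1 := lift_g _ _ _ _ _ _ _ _ _

theorem counit_x : (data hq).counit (x q) = 0 := lift_x _ _ _ _ _ _ _ _ _

theorem counit_y : (data hq).counit (y q) = 0 := lift_y _ _ _ _ _ _ _ _ _

theorem antipode_g : (data hq).antipode (g q) = g q :=
  congrArg MulOpposite.unop (lift_g (q := q) _ _ _ _ _ _ _ _ _)

theorem antipode_x : (data hq).antipode (x q) = antipodeGen q (g q) (x q) :=
  congrArg MulOpposite.unop (lift_x (q := q) _ _ _ _ _ _ _ _ _)

theorem antipode_y : (data hq).antipode (y q) = antipodeGen (-q) (g q) (y q) :=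
  congrArg MulOpposite.unop (lift_y (q := q) _ _ _ _ _ _ _ _ _)

theorem antipode_one : (data hq).antipode 1 = 1 := unop_map_one _

theorem antipode_mul (a b : H32 q) :
    (data hq).antipode (a * b) = (data hq).antipode b * (data hq).antipode a :=
  unop_map_mul _ a b

theorem isSignTwisted : (data hq).IsSignTwisted (g q) where
  sq := g_sq q
  comul_eq := comul_g hq
  counit_eq := counit_g hq
  antipode_eq := antipode_g hq
  Phi_eq := rfl
  alpha_eq := rfl
  beta_eq := rfl

theorem isQuasiHopf : (data hq).IsQuasiHopf := by
  have h2 := two_ne_zero_of_primitive hq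
  have hS1 := antipode_one hq
  have hS := antipode_mul hq
  refine (isSignTwisted hq).isQuasiHopf h2 hS1 hS adjoin_eq_top ?_
  rintro a (rfl | rfl | rfl)
  · exact (isSignTwisted hq).axiomsAt_grouplike rfl (comul_g hq) (counit_g hq)
      (antipode_g hq) (g_sq q)
  · exact (isSignTwisted hq).axiomsAt_comulGen h2 hS1 hS (sq_of_primitive hq) (g_x q)
      (comul_x hq) (counit_x hq) (antipode_x hq)
  -- The generator y is of the same kind as x, for the other square root −q of −1.
  · exact (isSignTwisted hq).axiomsAt_comulGen h2 hS1 hS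
      (by rw [neg_sq, sq_of_primitive hq]) (g_y q)
      (comul_y hq) (counit_y hq) (antipode_y hq)

end H32

/-! ### The group algebra of the cyclic group of order two -/

namespace GroupAlgC2

variable {k : Type u} [Field k]

variable (k) in
/-- The generator of `C₂` in `k[C₂]`. -/
def gen : GroupAlgC2 k := MonoidAlgebra.of k (Multiplicative (ZMod 2)) (Multiplicative.ofAdd 1)

theorem gen_mul_gen : gen k * gen k = 1 := by
  rw [gen, ← map_mul, ← ofAdd_add]
  exact map_one _

theorem adjoin_eq_top : Algebra.adjoin k {gen k} = ⊤ := by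
  rw [eq_top_iff]
  rintro a -
  induction a using MonoidAlgebra.induction_on with
  | of m =>
    obtain ⟨n, rfl⟩ := Multiplicative.ofAdd.surjective m
    fin_cases n
    · exact one_mem (Algebra.adjoin k {gen k})
    · exact Algebra.subset_adjoin rfl
  | add a b ha hb => exact add_mem ha hb
  | smul r a ha => exact Subalgebra.smul_mem _ ha r

/-- The morphism of algebras `k[C₂] → R` that sends the generator to `a`. -/
def lift {R : Type*} [Ring R] [Algebra k R] (a : R) (ha : a * a = 1) : GroupAlgC2 k →ₐ[k] R :=
  MonoidAlgebra.lift k R (Multiplicative (ZMod 2))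
    { toFun := fun n => a ^ n.toAdd.val
      map_one' := pow_zero a
      map_mul' := by
        intro m n
        obtain ⟨m, rfl⟩ := Multiplicative.ofAdd.surjective m
        obtain ⟨n, rfl⟩ := Multiplicative.ofAdd.surjective n
        change a ^ (m + n).val = a ^ m.val * a ^ n.val
        -- Exponents are the representatives 0 and 1, so only the case 1 + 1 = 0 uses a² = 1.
        fin_cases m <;> fin_cases n
        · change a ^ 0 = a ^ 0 * a ^ 0
          rw [pow_zero, one_mul]
        · change a ^ 1 = a ^ 0 * a ^ 1
          rw [pow_zero, one_mul]
        · change a ^ 1 = a ^ 1 * a ^ 0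
          rw [pow_zero, mul_one]
        · change a ^ 0 = a ^ 1 * a ^ 1
          rw [pow_one, pow_zero, ha] }

theorem lift_gen {R : Type*} [Ring R] [Algebra k R] (a : R) (ha : a * a = 1) :
    lift (k := k) a ha (gen k) = a :=
  (MonoidAlgebra.lift_of _ _).trans (pow_one a)

theorem comul_gen : (Coalgebra.comul (gen k) : GroupAlgC2 k ⊗[k] GroupAlgC2 k)
    = gen k ⊗ₜ[k] gen k := by
  simp [gen]

theorem counit_gen : (Coalgebra.counit (gen k) : k) = 1 := by
  simp [gen]

theorem antipode_gen : HopfAlgebra.antipode k (gen k) = gen k := by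
  rw [gen, MonoidAlgebra.of_apply, MonoidAlgebra.antipode_single]
  rfl

theorem finrank_eq : Module.finrank k (GroupAlgC2 k) = 2 := by
  rw [(MonoidAlgebra.coeffLinearEquiv k).finrank_eq, Module.finrank_finsupp_self]
  rfl

end GroupAlgC2

namespace H16

variable {k : Type u} [Field k]

theorem g₂_eq : g₂ k = GroupAlgC2.gen k ⊗ₜ[k] 1 := rfl

theorem adjoin_eq_top : Algebra.adjoin k {g₁ k, g₂ k, x k} = ⊤ := by
  rw [eq_top_iff]
  rintro a -
  set S := Algebra.adjoin k {g₁ k, g₂ k, x k} with hS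
  have h1 : (⊤ : Subalgebra k (GroupAlgC2 k)) ≤ S.comap Algebra.TensorProduct.includeLeft := by
    rw [← GroupAlgC2.adjoin_eq_top]
    refine Algebra.adjoin_le ?_
    rintro _ rfl
    exact Algebra.subset_adjoin (Or.inr (Or.inl rfl))
  have h2 : (⊤ : Subalgebra k (H8 k)) ≤
      S.comap (Algebra.TensorProduct.includeRight : H8 k →ₐ[k] H16 k) := by
    rw [← H8.adjoin_eq_top]
    refine Algebra.adjoin_le ?_
    rintro _ (rfl | rfl)
    · exact Algebra.subset_adjoin (Or.inl rfl)
    · exact Algebra.subset_adjoin (Or.inr (Or.inr rfl))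
  induction a using TensorProduct.induction_on with
  | zero => exact zero_mem S
  | add a b ha hb => exact add_mem ha hb
  | tmul a b =>
    have ha : a ⊗ₜ[k] (1 : H8 k) ∈ S := @h1 a Algebra.mem_top
    have hb : (1 : GroupAlgC2 k) ⊗ₜ[k] b ∈ S := @h2 b Algebra.mem_top
    simpa using mul_mem ha hb

variable (k) in
theorem g₁_sq : g₁ k * g₁ k = 1 := by
  rw [g₁, Algebra.TensorProduct.tmul_mul_tmul, H8.g_sq, one_mul, Algebra.TensorProduct.one_def]

variable (k) in
theorem g₂_sq : g₂ k * g₂ k = 1 := by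
  rw [g₂_eq, Algebra.TensorProduct.tmul_mul_tmul, GroupAlgC2.gen_mul_gen, one_mul,
    Algebra.TensorProduct.one_def]

variable (k) in
theorem g₁_x : g₁ k * x k = -(x k * g₁ k) := by
  rw [g₁, x, Algebra.TensorProduct.tmul_mul_tmul, Algebra.TensorProduct.tmul_mul_tmul, H8.g_x,
    TensorProduct.tmul_neg]

variable (k) in
theorem g₁_g₂ : g₁ k * g₂ k = g₂ k * g₁ k := by
  rw [g₁, g₂_eq, Algebra.TensorProduct.tmul_mul_tmul, Algebra.TensorProduct.tmul_mul_tmul]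
  simp only [one_mul, mul_one]

variable (k) in
theorem x_pow : x k ^ 4 = 0 := by
  rw [x, Algebra.TensorProduct.tmul_pow, H8.x_pow, TensorProduct.tmul_zero]

variable (q : k) (hq : IsPrimitiveRoot q 4)

theorem comul_one_tmul (h : H8 k) :
    (data q hq).comul (1 ⊗ₜ[k] h)
      = Algebra.TensorProduct.map Algebra.TensorProduct.includeRight
          Algebra.TensorProduct.includeRight ((H8.data q hq).comul h) :=
  QuasiHopfData.tensor_comul_one_tmul _ _ h

theorem comul_g₁ : (data q hq).comul (g₁ k) = g₁ k ⊗ₜ[k] g₁ k := by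
  rw [g₁, comul_one_tmul, H8.comul_g, Algebra.TensorProduct.map_tmul]
  rfl

theorem comul_x : (data q hq).comul (x k) = comulGen q (g₁ k) (x k) := by
  rw [x, comul_one_tmul, H8.comul_x, map_comulGen]
  rfl

theorem comul_g₂ : (data q hq).comul (g₂ k) = g₂ k ⊗ₜ[k] g₂ k := by
  rw [g₂_eq]
  refine (QuasiHopfData.tensor_comul_tmul_one _ _ _).trans ?_
  change Algebra.TensorProduct.map _ _ (Coalgebra.comul _) = _
  rw [GroupAlgC2.comul_gen, Algebra.TensorProduct.map_tmul]
  rfl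

theorem counit_tmul (a : GroupAlgC2 k) (h : H8 k) :
    (data q hq).counit (a ⊗ₜ[k] h) = Coalgebra.counit (R := k) a * (H8.data q hq).counit h := rfl

theorem antipode_tmul (a : GroupAlgC2 k) (h : H8 k) :
    (data q hq).antipode (a ⊗ₜ[k] h)
      = HopfAlgebra.antipode k a ⊗ₜ[k] (H8.data q hq).antipode h := rfl

theorem counit_g₁ : (data q hq).counit (g₁ k) = 1 := by
  rw [g₁, counit_tmul, H8.counit_g, Bialgebra.counit_one, mul_one]

theorem counit_x : (data q hq).counit (x k) = 0 := by
  rw [x, counit_tmul, H8.counit_x, mul_zero]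

theorem counit_g₂ : (data q hq).counit (g₂ k) = 1 := by
  rw [g₂_eq, counit_tmul, (inferInstance : (H8.data q hq).IsMult).counit_one,
    GroupAlgC2.counit_gen, mul_one]

theorem antipode_g₁ : (data q hq).antipode (g₁ k) = g₁ k := by
  rw [g₁, antipode_tmul, H8.antipode_g, HopfAlgebra.antipode_one]

theorem antipode_x : (data q hq).antipode (x k) = antipodeGen q (g₁ k) (x k) := by
  rw [x, antipode_tmul, H8.antipode_x, HopfAlgebra.antipode_one]
  exact map_antipodeGen (Algebra.TensorProduct.includeRight : H8 k →ₐ[k] H16 k) _ _ _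

theorem antipode_g₂ : (data q hq).antipode (g₂ k) = g₂ k := by
  rw [g₂_eq, antipode_tmul, GroupAlgC2.antipode_gen, H8.antipode_one]

theorem antipode_one : (data q hq).antipode 1 = 1 := by
  rw [Algebra.TensorProduct.one_def, antipode_tmul, HopfAlgebra.antipode_one, H8.antipode_one]

theorem antipode_mul (a b : H16 k) :
    (data q hq).antipode (a * b) = (data q hq).antipode b * (data q hq).antipode a :=
  QuasiHopfData.tensor_antipode_mul _ _ HopfAlgebra.antipode_mul_antidistrib
    (H8.antipode_mul q hq) a b

theorem Phi_eq : (data q hq).Phi = phiGen k (g₁ k) :=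
  (QuasiHopfData.tensor_Phi _ _ rfl).trans
    (map_phiGen (Algebra.TensorProduct.includeRight : H8 k →ₐ[k] H16 k) (H8.g k))

theorem isSignTwisted : (data q hq).IsSignTwisted (g₁ k) where
  sq := g₁_sq k
  comul_eq := comul_g₁ q hq
  counit_eq := counit_g₁ q hq
  antipode_eq := antipode_g₁ q hq
  Phi_eq := Phi_eq q hq
  alpha_eq := rfl
  beta_eq := rfl

theorem isQuasiHopf : (data q hq).IsQuasiHopf := by
  have h2 := two_ne_zero_of_primitive hq
  have hS1 := antipode_one q hq
  have hS := antipode_mul q hq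
  refine (isSignTwisted q hq).isQuasiHopf h2 hS1 hS adjoin_eq_top ?_
  rintro a (rfl | rfl | rfl)
  · exact (isSignTwisted q hq).axiomsAt_grouplike rfl (comul_g₁ q hq) (counit_g₁ q hq)
      (antipode_g₁ q hq) (g₁_sq k)
  · exact (isSignTwisted q hq).axiomsAt_grouplike (g₁_g₂ k) (comul_g₂ q hq) (counit_g₂ q hq)
      (antipode_g₂ q hq) (g₂_sq k)
  · exact (isSignTwisted q hq).axiomsAt_comulGen h2 hS1 hS (sq_of_primitive hq) (g₁_x k)
      (comul_x q hq) (counit_x q hq) (antipode_x q hq)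

end H16

end

section

namespace H8

variable {k : Type u} [Field k]

/-! ### A basis of `H_q(8)` -/

variable (k) in
/-- The nilpotent shift of `k⁴`. -/
def shift : Matrix (Fin 4) (Fin 4) k := !![0, 0, 0, 0; 1, 0, 0, 0; 0, 1, 0, 0; 0, 0, 1, 0]

variable (k) in
/-- The diagonal matrix with entries `1, -1, 1, -1`. -/
def alternating : Matrix (Fin 4) (Fin 4) k :=
  !![1, 0, 0, 0; 0, -1, 0, 0; 0, 0, 1, 0; 0, 0, 0, -1]

theorem shift_pow_four : shift k ^ 4 = 0 := by
  rw [pow_succ, pow_succ, pow_two, shift]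
  ext i j
  fin_cases i <;> fin_cases j <;> simp [Matrix.mul_apply, Fin.sum_univ_four]

theorem alternating_mul_self : alternating k * alternating k = 1 := by
  rw [alternating]
  ext i j
  fin_cases i <;> fin_cases j <;> simp [Matrix.mul_apply, Fin.sum_univ_four]

theorem alternating_mul_shift : alternating k * shift k = -(shift k * alternating k) := by
  rw [alternating, shift]
  ext i j
  fin_cases i <;> fin_cases j <;> simp [Matrix.mul_apply, Fin.sum_univ_four]

variable (k) in
/-- The representation `g ↦ diag(1, -1, 1, -1)`, `x ↦` shift. -/
def repPlus : H8 k →ₐ[k] Matrix (Fin 4) (Fin 4) k :=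
  lift (alternating k) (shift k) alternating_mul_self shift_pow_four alternating_mul_shift

variable (k) in
/-- The representation `g ↦ -diag(1, -1, 1, -1)`, `x ↦` shift. -/
def repMinus : H8 k →ₐ[k] Matrix (Fin 4) (Fin 4) k :=
  lift (-alternating k) (shift k) (by rw [neg_mul_neg, alternating_mul_self]) shift_pow_four
    (by rw [neg_mul, mul_neg, alternating_mul_shift])

/-- The first columns of the matrices of an element in the two representations. -/
def coords : H8 k →ₗ[k] (Fin 4 → k) × (Fin 4 → k) where
  toFun h := (fun i => repPlus k h i 0, fun i => repMinus k h i 0)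
  map_add' a b := by
    rw [map_add, map_add]
    rfl
  map_smul' c a := by
    rw [map_smul, map_smul]
    rfl

/-- `∑ xⁱ (aᵢ p₊ + bᵢ p₋)`. -/
def ofCoords : (Fin 4 → k) × (Fin 4 → k) →ₗ[k] H8 k where
  toFun c := ∑ i : Fin 4, (c.1 i • (x k ^ (i : ℕ) * pPlus k (g k))
    + c.2 i • (x k ^ (i : ℕ) * pMinus k (g k)))
  map_add' a b := by
    simp only [Prod.fst_add, Prod.snd_add, Pi.add_apply, add_smul, ← Finset.sum_add_distrib]
    exact Finset.sum_congr rfl fun _ _ => by abel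
  map_smul' c a := by
    simp only [Prod.smul_fst, Prod.smul_snd, Pi.smul_apply, smul_assoc, ← smul_add,
      ← Finset.smul_sum, RingHom.id_apply]

theorem ofCoords_apply (c : (Fin 4 → k) × (Fin 4 → k)) :
    ofCoords c = (c.1 0 • pPlus k (g k) + c.2 0 • pMinus k (g k))
      + (c.1 1 • (x k * pPlus k (g k)) + c.2 1 • (x k * pMinus k (g k)))
      + (c.1 2 • (x k ^ 2 * pPlus k (g k)) + c.2 2 • (x k ^ 2 * pMinus k (g k)))
      + (c.1 3 • (x k ^ 3 * pPlus k (g k)) + c.2 3 • (x k ^ 3 * pMinus k (g k))) := by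
  rw [ofCoords, LinearMap.coe_mk, AddHom.coe_mk, Fin.sum_univ_four]
  simp

theorem shift_sq : shift k ^ 2 = !![0, 0, 0, 0; 0, 0, 0, 0; 1, 0, 0, 0; 0, 1, 0, 0] := by
  rw [pow_two, shift]
  ext i j
  fin_cases i <;> fin_cases j <;> simp [Matrix.mul_apply, Fin.sum_univ_four]

theorem shift_cube : shift k ^ 3 = !![0, 0, 0, 0; 0, 0, 0, 0; 0, 0, 0, 0; 1, 0, 0, 0] := by
  rw [pow_succ, shift_sq, shift]
  ext i j
  fin_cases i <;> fin_cases j <;> simp [Matrix.mul_apply, Fin.sum_univ_four]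

theorem pPlus_alternating (h2 : (2 : k) ≠ 0) :
    pPlus k (alternating k) = !![1, 0, 0, 0; 0, 0, 0, 0; 0, 0, 1, 0; 0, 0, 0, 0] := by
  have e : (2 : k)⁻¹ * (1 + 1) = 1 := by
    rw [one_add_one_eq_two, inv_mul_cancel₀ h2]
  rw [pPlus, alternating]
  ext i j
  fin_cases i <;> fin_cases j <;> simp [e]

theorem pMinus_alternating (h2 : (2 : k) ≠ 0) :
    pMinus k (alternating k) = !![0, 0, 0, 0; 0, 1, 0, 0; 0, 0, 0, 0; 0, 0, 0, 1] := by
  have e : (2 : k)⁻¹ * (1 + 1) = 1 := by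
    rw [one_add_one_eq_two, inv_mul_cancel₀ h2]
  rw [pMinus, alternating]
  ext i j
  fin_cases i <;> fin_cases j <;> simp [e]

theorem pPlus_neg {A : Type*} [Ring A] [Algebra k A] (a : A) :
    pPlus k (-a) = pMinus k a := by rw [pPlus, pMinus, sub_eq_add_neg]

theorem pMinus_neg {A : Type*} [Ring A] [Algebra k A] (a : A) :
    pMinus k (-a) = pPlus k a := by rw [pPlus, pMinus, sub_neg_eq_add]

theorem repPlus_g : repPlus k (g k) = alternating k := lift_g _ _ _ _ _

theorem repPlus_x : repPlus k (x k) = shift k := lift_x _ _ _ _ _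

theorem repMinus_g : repMinus k (g k) = -alternating k := lift_g _ _ _ _ _

theorem repMinus_x : repMinus k (x k) = shift k := lift_x _ _ _ _ _

/-- The two representations model the left ideals spanned by the xⁱ p₊ and by the xⁱ p₋. The first
column is the image of p₊, respectively p₋, and so reads off one family of coefficients while the
other family contributes zero. -/
theorem coords_ofCoords (h2 : (2 : k) ≠ 0) (c : (Fin 4 → k) × (Fin 4 → k)) :
    coords (ofCoords c) = c := by
  have h1 : ∀ i, repPlus k (ofCoords c) i 0 = c.1 i := by
    intro i
    rw [ofCoords_apply]
    simp only [map_add, map_smul, map_mul, map_pow, map_pPlus, map_pMinus, repPlus_g, repPlus_x,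
      shift_sq, shift_cube, pPlus_alternating h2, pMinus_alternating h2]
    rw [shift]
    fin_cases i <;> simp
  have h3 : ∀ i, repMinus k (ofCoords c) i 0 = c.2 i := by
    intro i
    rw [ofCoords_apply]
    simp only [map_add, map_smul, map_mul, map_pow, map_pPlus, map_pMinus, repMinus_g, repMinus_x,
      shift_sq, shift_cube, pPlus_neg, pMinus_neg, pPlus_alternating h2, pMinus_alternating h2]
    rw [shift]
    fin_cases i <;> simp
  exact Prod.ext (funext h1) (funext h3)

theorem ofCoords_injective (h2 : (2 : k) ≠ 0) :
    Function.Injective (ofCoords : (Fin 4 → k) × (Fin 4 → k) →ₗ[k] H8 k) :=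
  Function.LeftInverse.injective (coords_ofCoords h2)

theorem x_mul_ofCoords (c : (Fin 4 → k) × (Fin 4 → k)) :
    x k * ofCoords c = ofCoords (![0, c.1 0, c.1 1, c.1 2], ![0, c.2 0, c.2 1, c.2 2]) := by
  have h4 : x k * x k ^ 3 = 0 := by rw [← pow_succ', x_pow]
  have h3 : x k * x k ^ 2 = x k ^ 3 := by rw [← pow_succ']
  have h2 : x k * x k = x k ^ 2 := by rw [← pow_two]
  rw [ofCoords_apply, ofCoords_apply]
  simp only [mul_add, mul_smul_comm, ← mul_assoc, h2, h3, h4, zero_mul, smul_zero, add_zero]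
  simp

/-- Moving x to the left across p₊ or p₋ exchanges the two idempotents, hence the two families of
coefficients. -/
theorem ofCoords_mul_x (c : (Fin 4 → k) × (Fin 4 → k)) :
    ofCoords c * x k = ofCoords (![0, c.2 0, c.2 1, c.2 2], ![0, c.1 0, c.1 1, c.1 2]) := by
  have h4 : x k ^ 3 * x k = 0 := by rw [← pow_succ, x_pow]
  have h3 : x k ^ 2 * x k = x k ^ 3 := by rw [← pow_succ]
  have h2 : x k * x k = x k ^ 2 := by rw [← pow_two]
  have hp : pPlus k (g k) * x k = x k * pMinus k (g k) := pPlus_mul (g_x k)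
  have hm : pMinus k (g k) * x k = x k * pPlus k (g k) := pMinus_mul (g_x k)
  rw [ofCoords_apply, ofCoords_apply]
  simp only [add_mul, smul_mul_assoc, mul_assoc, hp, hm]
  simp only [← mul_assoc, h2, h3, h4, zero_mul, smul_zero, add_zero]
  simp
  abel

theorem g_mul_ofCoords (c : (Fin 4 → k) × (Fin 4 → k)) :
    g k * ofCoords c = ofCoords (![c.1 0, -c.1 1, c.1 2, -c.1 3],
      ![-c.2 0, c.2 1, -c.2 2, c.2 3]) := by
  have hp : g k * pPlus k (g k) = pPlus k (g k) := mul_pPlus (g_sq k)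
  have hm : g k * pMinus k (g k) = -pMinus k (g k) := mul_pMinus (g_sq k)
  have hx : ∀ t, g k * (x k * t) = -(x k * (g k * t)) := by
    intro t
    rw [← mul_assoc, g_x, neg_mul, mul_assoc]
  rw [ofCoords_apply, ofCoords_apply]
  simp only [pow_succ, pow_zero, one_mul, mul_assoc, mul_add, mul_smul_comm, hx, hp, hm]
  simp

/-- The span of the xⁱ p± contains 1 = p₊ + p₋ and is stable under left multiplication by g and x.
-/
theorem ofCoords_surjective (h2 : (2 : k) ≠ 0) :
    Function.Surjective (ofCoords : (Fin 4 → k) × (Fin 4 → k) →ₗ[k] H8 k) := by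
  have h1 : (1 : H8 k) ∈ LinearMap.range (ofCoords (k := k)) := by
    refine ⟨(![1, 0, 0, 0], ![1, 0, 0, 0]), ?_⟩
    rw [ofCoords_apply]
    simp [pPlus_add_pMinus h2]
  have key : ∀ a : H8 k, a ∈ Algebra.adjoin k {g k, x k} →
      ∀ b ∈ LinearMap.range (ofCoords (k := k)), a * b ∈ LinearMap.range (ofCoords (k := k)) := by
    intro a ha
    induction ha using Algebra.adjoin_induction with
    | mem a ha =>
      rintro _ ⟨c, rfl⟩
      rcases ha with rfl | rfl
      · exact ⟨_, (g_mul_ofCoords c).symm⟩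
      · exact ⟨_, (x_mul_ofCoords c).symm⟩
    | algebraMap r =>
      intro b hb
      rw [← Algebra.smul_def]
      exact Submodule.smul_mem _ r hb
    | add a a' _ _ h h' =>
      intro b hb
      rw [add_mul]
      exact Submodule.add_mem _ (h b hb) (h' b hb)
    | mul a a' _ _ h h' =>
      intro b hb
      rw [mul_assoc]
      exact h _ (h' b hb)
  intro a
  have := key a (adjoin_eq_top (k := k) ▸ Algebra.mem_top) 1 h1
  rwa [mul_one] at this

theorem finrank_eq (h2 : (2 : k) ≠ 0) : Module.finrank k (H8 k) = 8 := by
  rw [← (LinearEquiv.ofBijective ofCoords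
    ⟨ofCoords_injective h2, ofCoords_surjective h2⟩).finrank_eq]
  simp

/-! ### Group-like elements of `H_q(8)` that commute with `x` -/

variable (k) in
/-- The character `g ↦ -1`, `x ↦ 0` of `H_q(8)`. -/
def sign : H8 k →ₐ[k] k := lift (-1) 0 (by simp) (by simp) (by simp)

theorem sign_g : sign k (g k) = -1 := lift_g _ _ _ _ _

theorem sign_x : sign k (x k) = 0 := lift_x _ _ _ _ _

end H8

namespace QuasiHopfData

variable {k : Type u} {H : Type v} [Field k] [Ring H] [Algebra k H]

theorem hitR_of_comul_eq (D : QuasiHopfData k H) (χ : H →ₐ[k] k) {v : H}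
    (hv : D.comul v = v ⊗ₜ[k] v) : D.hitR χ v = χ v • v := by
  simp [hitR, hv]

/-- `h ↦ σ(h₂) h₁` as a morphism of algebras. -/
def hitRHom (D : QuasiHopfData k H) [D.IsMult] (χ : H →ₐ[k] k) : H →ₐ[k] H :=
  (Algebra.TensorProduct.rid k k H).toAlgHom.comp
    ((Algebra.TensorProduct.map (AlgHom.id k H) χ).comp D.comulHom)

theorem hitRHom_apply (D : QuasiHopfData k H) [D.IsMult] (χ : H →ₐ[k] k) (h : H) :
    D.hitRHom χ h = D.hitR χ h := rfl

end QuasiHopfData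

namespace H8

variable {k : Type u} [Field k] (q : k) (hq : IsPrimitiveRoot q 4)

theorem hitRHom_sign_g : (data q hq).hitRHom (sign k) (g k) = -g k := by
  rw [QuasiHopfData.hitRHom_apply, QuasiHopfData.hitR]
  simp [comul_g, sign_g]

/-- Only the term x ⊗ (p₊ + q p₋) survives, and the sign character takes its second leg to q. -/
theorem hitRHom_sign_x : (data q hq).hitRHom (sign k) (x k) = q • x k := by
  have h2 := two_ne_zero_of_primitive hq
  rw [QuasiHopfData.hitRHom_apply, QuasiHopfData.hitR]
  have e1 : sign k (pPlus k (g k)) = 0 := by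
    rw [map_pPlus, sign_g, pPlus, add_neg_cancel, smul_zero]
  have e2 : sign k (pMinus k (g k)) = 1 := by
    rw [map_pMinus, sign_g, pMinus, sub_neg_eq_add, one_add_one_eq_two, smul_eq_mul,
      inv_mul_cancel₀ h2]
  simp [comul_x, comulGen, sign_x, e1, e2]

/-- Write u = ∑ xⁱ(aᵢ p₊ + bᵢ p₋). Commutation with x gives aᵢ = bᵢ for i ≤ 2, and the counit gives
a₀ = 1. The endomorphism τ = (Id ⊗ `sign`)Δ takes g to −g and x to q x, and a group-like u is an
eigenvector of τ, with eigenvalue 1 by comparison of constant terms. Comparing the other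
coefficients of τ(u) and u kills them, as q, q² and q⁶ differ from 1. -/
theorem eq_one_of_grouplike {u : H8 k} (hu : (data q hq).comul u = u ⊗ₜ[k] u)
    (hε : (data q hq).counit u = 1) (hx : x k * u = u * x k) : u = 1 := by
  have h2 := two_ne_zero_of_primitive hq
  have hq2 := sq_of_primitive hq
  obtain ⟨c, rfl⟩ := ofCoords_surjective h2 u
  have hinj := ofCoords_injective h2
  have hcomm := hx
  rw [x_mul_ofCoords, ofCoords_mul_x] at hcomm
  -- Because x⁴ = 0, commutation with x says nothing about the coefficients of x³.
  have hcomm := congrArg Prod.fst (hinj hcomm)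
  have c0 : c.1 0 = c.2 0 := congrFun hcomm 1
  have c1 : c.1 1 = c.2 1 := congrFun hcomm 2
  have c2 : c.1 2 = c.2 2 := congrFun hcomm 3
  have hε0 : c.1 0 = 1 := by
    have hεg : (data q hq).counitHom (g k) = 1 := counit_g q hq
    have hεx : (data q hq).counitHom (x k) = 0 := counit_x q hq
    rw [← QuasiHopfData.counitHom_apply, ofCoords_apply] at hε
    have e1 : pPlus k (1 : k) = 1 := by
      rw [pPlus, one_add_one_eq_two, smul_eq_mul, inv_mul_cancel₀ h2]
    have e2 : pMinus k (1 : k) = 0 := by rw [pMinus, sub_self, smul_zero]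
    simpa only [map_add, map_smul, map_mul, map_pow, map_pPlus, map_pMinus, hεg, hεx, e1, e2,
      smul_eq_mul, mul_one, mul_zero, zero_mul, add_zero, ne_eq, OfNat.ofNat_ne_zero,
      not_false_eq_true, zero_pow] using hε
  have hhit := QuasiHopfData.hitR_of_comul_eq (data q hq) (sign k) hu
  generalize sign k (ofCoords c) = r at hhit
  -- The twist exchanges p₊ and p₋ and multiplies xⁱ by qⁱ.
  have hτ : (data q hq).hitR (sign k) (ofCoords c)
      = ofCoords (![c.2 0, q * c.2 1, q ^ 2 * c.2 2, q ^ 3 * c.2 3],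
          ![c.1 0, q * c.1 1, q ^ 2 * c.1 2, q ^ 3 * c.1 3]) := by
    rw [← QuasiHopfData.hitRHom_apply, ofCoords_apply, ofCoords_apply]
    simp only [map_add, map_smul, map_mul, map_pow, map_pPlus, map_pMinus, hitRHom_sign_g,
      hitRHom_sign_x, pPlus_neg, pMinus_neg, smul_pow, smul_mul_assoc, smul_smul]
    simp only [Matrix.cons_val_zero, Matrix.cons_val_one, Matrix.cons_val]
    module
  rw [hτ, ← map_smul] at hhit
  have hhit := hinj hhit
  have hp : ∀ i, ![c.2 0, q * c.2 1, q ^ 2 * c.2 2, q ^ 3 * c.2 3] i = r * c.1 i :=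
    fun i => congrFun (congrArg Prod.fst hhit) i
  have hm : ∀ i, ![c.1 0, q * c.1 1, q ^ 2 * c.1 2, q ^ 3 * c.1 3] i = r * c.2 i :=
    fun i => congrFun (congrArg Prod.snd hhit) i
  have p0 : c.2 0 = r * c.1 0 := hp 0
  have p1 : q * c.2 1 = r * c.1 1 := hp 1
  have p2 : q ^ 2 * c.2 2 = r * c.1 2 := hp 2
  have p3 : q ^ 3 * c.2 3 = r * c.1 3 := hp 3
  have m3 : q ^ 3 * c.1 3 = r * c.2 3 := hm 3
  have hr : r = 1 := by rw [← c0, hε0, mul_one] at p0; exact p0.symm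
  subst hr
  have z1 : c.1 1 = 0 := by
    have : (2 : k) * c.1 1 = 0 := by
      rw [← c1] at p1
      linear_combination (-1 - q) * p1 + c.1 1 * hq2
    exact (mul_eq_zero.mp this).resolve_left h2
  have z2 : c.1 2 = 0 := by
    have : (2 : k) * c.1 2 = 0 := by
      rw [← c2] at p2
      linear_combination - p2 + c.1 2 * hq2
    exact (mul_eq_zero.mp this).resolve_left h2
  -- Here a₃ and b₃ are not known to agree, but q³ b₃ = a₃ and q³ a₃ = b₃ give q⁶ a₃ = a₃ with q⁶ =
  -- −1.
  have z3 : c.1 3 = 0 := by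
    have : (2 : k) * c.1 3 = 0 := by
      linear_combination (-1) * p3 - q ^ 3 * m3 + c.1 3 * (q ^ 4 - q ^ 2 + 1) * hq2
    exact (mul_eq_zero.mp this).resolve_left h2
  have z3' : c.2 3 = 0 := by
    rw [z3, mul_zero, one_mul] at m3
    exact m3.symm
  rw [ofCoords_apply, ← c0, ← c1, ← c2, hε0, z1, z2, z3, z3']
  simp [pPlus_add_pMinus h2]

end H8

end

section

theorem pPlus_one {k : Type u} [Field k] (h2 : (2 : k) ≠ 0) : pPlus k (1 : k) = 1 := by
  rw [pPlus, one_add_one_eq_two, smul_eq_mul, inv_mul_cancel₀ h2]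

theorem pMinus_one {k : Type u} [Field k] : pMinus k (1 : k) = 0 := by
  rw [pMinus, sub_self, smul_zero]

theorem pMinus_neg_one {k : Type u} [Field k] (h2 : (2 : k) ≠ 0) : pMinus k (-1 : k) = 1 := by
  rw [H8.pMinus_neg, pPlus_one h2]

theorem eq_pPlus_add_pMinus_mul_neg_one {k : Type u} {A : Type v} [Field k] [Ring A]
    [Algebra k A] (h2 : (2 : k) ≠ 0) (g : A) : g = pPlus k g + pMinus k g * -1 := by
  rw [mul_neg_one, ← sub_eq_add_neg, pPlus_sub_pMinus h2]

/-! ### Admissible pairs -/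

namespace QuasiHopfData

variable {k : Type u} {H : Type v} [Field k] [Ring H] [Algebra k H]

/-- `σ ⊗ σ`, as a character of `H ⊗ H`. -/
def tensorSq (σ : H →ₐ[k] k) : H ⊗[k] H →ₐ[k] k :=
  Algebra.TensorProduct.lift σ σ fun _ _ => Commute.all _ _

theorem tensorSq_tmul (σ : H →ₐ[k] k) (a b : H) : tensorSq σ (a ⊗ₜ[k] b) = σ a * σ b :=
  Algebra.TensorProduct.lift_tmul _ _ _ _ _

theorem contract₁_tmul (σ : H →ₐ[k] k) (a b c : H) :
    contract₁ σ (a ⊗ₜ[k] (b ⊗ₜ[k] c)) = σ a • b ⊗ₜ[k] c := rfl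

theorem contract₂_tmul (σ : H →ₐ[k] k) (a b c : H) :
    contract₂ σ (a ⊗ₜ[k] (b ⊗ₜ[k] c)) = a ⊗ₜ[k] (σ b • c) := rfl

theorem contract₃_tmul (σ : H →ₐ[k] k) (a b c : H) :
    contract₃ σ (a ⊗ₜ[k] (b ⊗ₜ[k] c)) = a ⊗ₜ[k] (σ c • b) := rfl

/-- The reassociator is symmetric in its three legs, so the three contractions take the same form;
they are trivial as soon as σ(g) = 1. -/
theorem contract₁_phiGen (σ : H →ₐ[k] k) (g : H) : contract₁ σ (phiGen k g)
    = 1 - (2 * σ (pMinus k g)) • pMinus k g ⊗ₜ[k] pMinus k g := by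
  simp only [phiGen, Algebra.TensorProduct.one_def, map_sub, map_smul, contract₁_tmul, map_one,
    one_smul, smul_smul]

theorem contract₂_phiGen (σ : H →ₐ[k] k) (g : H) : contract₂ σ (phiGen k g)
    = 1 - (2 * σ (pMinus k g)) • pMinus k g ⊗ₜ[k] pMinus k g := by
  simp only [phiGen, Algebra.TensorProduct.one_def, map_sub, map_smul, contract₂_tmul, map_one,
    one_smul, TensorProduct.tmul_smul, smul_smul]

theorem contract₃_phiGen (σ : H →ₐ[k] k) (g : H) : contract₃ σ (phiGen k g)
    = 1 - (2 * σ (pMinus k g)) • pMinus k g ⊗ₜ[k] pMinus k g := by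
  simp only [phiGen, Algebra.TensorProduct.one_def, map_sub, map_smul, contract₃_tmul, map_one,
    one_smul, TensorProduct.tmul_smul, smul_smul]

namespace IsSignTwisted

variable {D : QuasiHopfData k H} {g : H} (hg : D.IsSignTwisted g) (h2 : (2 : k) ≠ 0)
  {σ : H →ₐ[k] k}

include hg in
theorem contract₂_Phi (hσ : σ g = 1) : contract₂ σ D.Phi = 1 := by
  rw [hg.Phi_eq, contract₂_phiGen, map_pMinus, hσ, pMinus_one, mul_zero, zero_smul, sub_zero]

include hg h2 in
theorem contract₁_PhiInv (hσ : σ g = 1) : contract₁ σ D.PhiInv = 1 := by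
  rw [hg.PhiInv_eq h2, contract₁_phiGen, map_pMinus, hσ, pMinus_one, mul_zero, zero_smul,
    sub_zero]

include hg h2 in
theorem contract₃_PhiInv (hσ : σ g = 1) : contract₃ σ D.PhiInv = 1 := by
  rw [hg.PhiInv_eq h2, contract₃_phiGen, map_pMinus, hσ, pMinus_one, mul_zero, zero_smul,
    sub_zero]

include hg h2 in
/-- There is no admissible pair `(σ, v)` with `σ(g) = -1` and `σ * σ = ε`. -/
theorem not_isAdmissible [D.IsMult] (hσ : σ g = -1)
    (hσσ : ∀ h, tensorSq σ (D.comul h) = D.counit h) (v : H) : ¬ D.IsAdmissible σ v := by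
  intro h
  -- Each contraction is 1 − 2 p₋ ⊗ p₋, on which σ ⊗ σ is −1. The left side is ε(v) = 1 and the
  -- right side is (−1)³ σ(v)² = −1.
  have e := congrArg (tensorSq σ) h.comul_eq
  rw [hσσ, h.counit_eq, hg.PhiInv_eq h2, hg.Phi_eq, contract₁_phiGen, contract₂_phiGen,
    contract₃_phiGen] at e
  simp only [map_mul, map_sub, map_one, map_smul, tensorSq_tmul, map_pMinus, hσ,
    pMinus_neg_one h2, h.apply_eq, smul_eq_mul] at e
  exact h2 (by linear_combination e)

end IsSignTwisted

end QuasiHopfData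

namespace H16

open QuasiHopfData

variable {k : Type u} [Field k]

variable (k) in
/-- The character `g₁ ↦ 1`, `g₂ ↦ -1`, `x ↦ 0` of `H_q(16)`. -/
def character : H16 k →ₐ[k] k :=
  Algebra.TensorProduct.lift (GroupAlgC2.lift (-1) (by simp))
    (H8.lift 1 0 (by simp) (by simp) (by simp)) fun _ _ => Commute.all _ _

theorem character_g₁ : character k (g₁ k) = 1 := by
  rw [character, g₁, Algebra.TensorProduct.lift_tmul, map_one, H8.lift_g, one_mul]

theorem character_g₂ : character k (g₂ k) = -1 := by
  rw [character, g₂_eq, Algebra.TensorProduct.lift_tmul, map_one, GroupAlgC2.lift_gen, mul_one]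

theorem character_x : character k (x k) = 0 := by
  rw [character, x, Algebra.TensorProduct.lift_tmul, map_one, H8.lift_x, mul_zero]

theorem algHom_ext {R : Type*} [Ring R] [Algebra k R] {φ ψ : H16 k →ₐ[k] R}
    (h₁ : φ (g₁ k) = ψ (g₁ k)) (h₂ : φ (g₂ k) = ψ (g₂ k)) (hx : φ (x k) = ψ (x k)) : φ = ψ := by
  refine AlgHom.ext_of_adjoin_eq_top adjoin_eq_top ?_
  rintro _ (rfl | rfl | rfl)
  exacts [h₁, h₂, hx]

theorem g₂_mul_comm (h : H16 k) : g₂ k * h = h * g₂ k := by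
  rw [g₂_eq]
  induction h using TensorProduct.induction_on with
  | zero => simp
  | add a b ha hb => rw [mul_add, add_mul, ha, hb]
  | tmul a b =>
    rw [Algebra.TensorProduct.tmul_mul_tmul, Algebra.TensorProduct.tmul_mul_tmul, one_mul,
      mul_one, mul_comm]

variable (q : k) (hq : IsPrimitiveRoot q 4)

theorem hitR_g₁ (χ : H16 k →ₐ[k] k) :
    (data q hq).hitRHom χ (g₁ k) = χ (g₁ k) • g₁ k :=
  (data q hq).hitR_of_comul_eq χ (comul_g₁ q hq)

theorem hitR_g₂ (χ : H16 k →ₐ[k] k) :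
    (data q hq).hitRHom χ (g₂ k) = χ (g₂ k) • g₂ k :=
  (data q hq).hitR_of_comul_eq χ (comul_g₂ q hq)

theorem hitR_x {χ : H16 k →ₐ[k] k} (h₁ : χ (g₁ k) = 1) (hx : χ (x k) = 0) :
    (data q hq).hitRHom χ (x k) = x k := by
  have h2 := two_ne_zero_of_primitive hq
  rw [hitRHom_apply, hitR]
  simp [comul_x, comulGen, map_pPlus, map_pMinus, h₁, hx, pPlus_one h2, pMinus_one]

theorem hitL_g₁ (χ : H16 k →ₐ[k] k) : (data q hq).hitL χ (g₁ k) = χ (g₁ k) • g₁ k := by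
  simp [hitL, comul_g₁]

theorem hitL_g₂ (χ : H16 k →ₐ[k] k) : (data q hq).hitL χ (g₂ k) = χ (g₂ k) • g₂ k := by
  simp [hitL, comul_g₂]

theorem hitL_x {χ : H16 k →ₐ[k] k} (h₁ : χ (g₁ k) = 1) (hx : χ (x k) = 0) :
    (data q hq).hitL χ (x k) = x k := by
  have h2 := two_ne_zero_of_primitive hq
  simp only [hitL, LinearMap.comp_apply, comul_x, comulGen, map_add, LinearMap.rTensor_tmul,
    AlgHom.toLinearMap_apply, LinearEquiv.coe_coe, TensorProduct.lid_tmul, h₁, hx, zero_smul,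
    map_one, one_smul, zero_add]
  rw [← add_mul, pPlus_add_pMinus h2, one_mul]

/-- Both twists by σ₀ fix g₁ and x and negate g₂. As g₂ is central, this yields the commutation
condition for the pair (σ₀, g₂). -/
theorem hitR_eq_hitL (h : H16 k) :
    (data q hq).hitR (character k) h = (data q hq).hitL (character k) h := by
  have : (data q hq).hitRHom (character k) = (data q hq).hitLHom (character k) := by
    refine algHom_ext ?_ ?_ ?_
    · exact (hitR_g₁ q hq _).trans (hitL_g₁ q hq _).symm
    · exact (hitR_g₂ q hq _).trans (hitL_g₂ q hq _).symm
    · exact (hitR_x q hq character_g₁ character_x).trans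
        (hitL_x q hq character_g₁ character_x).symm
  exact DFunLike.congr_fun this h

theorem isAdmissible : (data q hq).IsAdmissible (character k) (g₂ k) where
  apply_eq := character_g₂
  counit_eq := counit_g₂ q hq
  comul_eq := by
    have h2 := two_ne_zero_of_primitive hq
    have hg := isSignTwisted q hq
    rw [hg.contract₁_PhiInv h2 character_g₁, hg.contract₂_Phi character_g₁,
      hg.contract₃_PhiInv h2 character_g₁, comul_g₂, one_mul, mul_one, mul_one,
      Algebra.TensorProduct.tmul_mul_tmul, one_mul, mul_one]
  commute h := by rw [hitR_eq_hitL, g₂_mul_comm]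

/-- The projection `H_q(16) → H_q(8)` that sends `g₂` to a scalar `c` with `c² = 1`. -/
def proj (c : k) (hc : c * c = 1) : H16 k →ₐ[k] H8 k :=
  (Algebra.TensorProduct.lid k (H8 k)).toAlgHom.comp
    (Algebra.TensorProduct.map (GroupAlgC2.lift c hc) (AlgHom.id k (H8 k)))

theorem proj_tmul (c : k) (hc : c * c = 1) (a : GroupAlgC2 k) (h : H8 k) :
    proj c hc (a ⊗ₜ[k] h) = GroupAlgC2.lift c hc a • h := rfl

theorem proj_one_tmul (c : k) (hc : c * c = 1) (h : H8 k) : proj c hc (1 ⊗ₜ[k] h) = h := by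
  rw [proj_tmul, map_one, one_smul]

theorem proj_g₂ (c : k) (hc : c * c = 1) : proj c hc (g₂ k) = c • (1 : H8 k) := by
  rw [g₂_eq, proj_tmul, GroupAlgC2.lift_gen]

variable (k) in
/-- The projection `H_q(16) → H_q(8)` with `g₂ ↦ 1`. -/
def projPlus : H16 k →ₐ[k] H8 k := proj 1 (one_mul 1)

variable (k) in
/-- The projection `H_q(16) → H_q(8)` with `g₂ ↦ -1`. -/
def projMinus : H16 k →ₐ[k] H8 k := proj (-1) (by rw [neg_mul_neg, one_mul])

theorem projPlus_one_tmul (h : H8 k) : projPlus k (1 ⊗ₜ[k] h) = h := proj_one_tmul _ _ h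

theorem projMinus_one_tmul (h : H8 k) : projMinus k (1 ⊗ₜ[k] h) = h := proj_one_tmul _ _ h

theorem projPlus_g₁ : projPlus k (g₁ k) = H8.g k := projPlus_one_tmul _

theorem projMinus_g₁ : projMinus k (g₁ k) = H8.g k := projMinus_one_tmul _

theorem projPlus_x : projPlus k (x k) = H8.x k := projPlus_one_tmul _

theorem projMinus_x : projMinus k (x k) = H8.x k := projMinus_one_tmul _

theorem projPlus_g₂ : projPlus k (g₂ k) = 1 := by
  rw [projPlus, proj_g₂, one_smul]

theorem projMinus_g₂ : projMinus k (g₂ k) = -1 := by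
  rw [projMinus, proj_g₂, neg_smul, one_smul]

/-- The element g₂ is a central involution and 2 is invertible, so the idempotents (1 ± g₂)/2 split
H_q(16) into two copies of H_q(8), on which g₂ is 1 and −1. -/
theorem eq_of_proj_eq (h2 : (2 : k) ≠ 0) {a b : H16 k} (h₁ : projPlus k a = projPlus k b)
    (h₂ : projMinus k a = projMinus k b) : a = b := by
  let j : H8 k →ₐ[k] H16 k := Algebra.TensorProduct.includeRight
  have key : ∀ z : H16 k, z = pPlus k (g₂ k) * j (projPlus k z)
      + pMinus k (g₂ k) * j (projMinus k z) := by
    have hj : ∀ (a : GroupAlgC2 k) (h : H8 k), a ⊗ₜ[k] h = a ⊗ₜ[k] 1 * j h := by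
      intro a h
      change _ = a ⊗ₜ[k] 1 * 1 ⊗ₜ[k] h
      rw [Algebra.TensorProduct.tmul_mul_tmul, mul_one, one_mul]
    have ep : ∀ h, projPlus k (j h) = h := projPlus_one_tmul
    have em : ∀ h, projMinus k (j h) = h := projMinus_one_tmul
    intro z
    induction z using TensorProduct.induction_on with
    | zero => simp
    | add a b ha hb =>
      simp only [map_add, mul_add]
      nth_rw 1 [ha, hb]
      abel
    | tmul a h =>
      induction a using MonoidAlgebra.induction_on with
      | of m =>
        rw [hj]
        simp only [map_mul, ep, em]
        rw [← mul_assoc, ← mul_assoc, ← add_mul]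
        congr 1
        obtain ⟨n, rfl⟩ := Multiplicative.ofAdd.surjective m
        fin_cases n
        · change (1 : H16 k) = _ * j (projPlus k 1) + _ * j (projMinus k 1)
          simp only [map_one, mul_one, pPlus_add_pMinus h2]
        · change g₂ k = _ * j (projPlus k (g₂ k)) + _ * j (projMinus k (g₂ k))
          rw [projPlus_g₂, projMinus_g₂, map_one, map_neg, map_one, mul_one]
          exact eq_pPlus_add_pMinus_mul_neg_one h2 (g₂ k)
      | add a b ha hb =>
        rw [TensorProduct.add_tmul]
        simp only [map_add, mul_add]
        nth_rw 1 [ha, hb]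
        abel
      | smul r a ha =>
        rw [← TensorProduct.smul_tmul']
        simp only [map_smul, mul_smul_comm, ← smul_add]
        rw [← ha]
  rw [key a, key b, h₁, h₂]

/-- The projection g₂ ↦ 1 respects Δ because 1 is group-like. The projection g₂ ↦ −1 does not, as −1
is not group-like; it is reached through `proj_neg_one`. -/
theorem comul_proj (h : H16 k) : (H8.data q hq).comul (projPlus k h)
    = Algebra.TensorProduct.map (projPlus k) (projPlus k) ((data q hq).comul h) := by
  have : (H8.data q hq).comulHom.comp (projPlus k)
      = (Algebra.TensorProduct.map (projPlus k) (projPlus k)).comp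
        (data q hq).comulHom := by
    refine algHom_ext ?_ ?_ ?_
    · simp only [AlgHom.comp_apply, comulHom_apply, comul_g₁, projPlus_g₁, H8.comul_g,
        Algebra.TensorProduct.map_tmul]
    · simp only [AlgHom.comp_apply, comulHom_apply, comul_g₂, projPlus_g₂,
        Algebra.TensorProduct.map_tmul]
      exact (inferInstance : (H8.data q hq).IsMult).comul_one
    · simp only [AlgHom.comp_apply, comulHom_apply, comul_x, projPlus_x, projPlus_g₁, H8.comul_x,
        map_comulGen]
  exact DFunLike.congr_fun this h

theorem counit_proj (h : H16 k) :
    (H8.data q hq).counit (projPlus k h) = (data q hq).counit h := by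
  have : (H8.data q hq).counitHom.comp (projPlus k) = (data q hq).counitHom := by
    refine algHom_ext ?_ ?_ ?_
    · simp only [AlgHom.comp_apply, counitHom_apply, counit_g₁, projPlus_g₁, H8.counit_g]
    · simp only [AlgHom.comp_apply, counitHom_apply, counit_g₂, projPlus_g₂]
      exact (inferInstance : (H8.data q hq).IsMult).counit_one
    · simp only [AlgHom.comp_apply, counitHom_apply, counit_x, projPlus_x, H8.counit_x]
  exact DFunLike.congr_fun this h

/-- The twist (Id ⊗ σ₀)Δ fixes g₁ and x and negates g₂. It acts on a group-like v by the scalar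
σ₀(v), so the second image of v follows from the first. -/
theorem proj_neg_one (h : H16 k) : projMinus k h
    = projPlus k ((data q hq).hitR (character k) h) := by
  have : projMinus k = (projPlus k).comp
      ((data q hq).hitRHom (character k)) := by
    refine algHom_ext ?_ ?_ ?_
    · rw [AlgHom.comp_apply, hitR_g₁, character_g₁, one_smul, projMinus_g₁, projPlus_g₁]
    · rw [AlgHom.comp_apply, hitR_g₂, character_g₂, map_smul, projMinus_g₂, projPlus_g₂,
        neg_smul, one_smul]
    · rw [AlgHom.comp_apply, hitR_x q hq character_g₁ character_x, projMinus_x, projPlus_x]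
  exact DFunLike.congr_fun this h

/-- Since g₁ and g₂ are group-like involutions and every term of Δ(x) contains a factor x, a
character that kills x is its own convolution inverse. -/
theorem tensorSq_comul {σ : H16 k →ₐ[k] k} (hx : σ (x k) = 0) (h : H16 k) :
    tensorSq σ ((data q hq).comul h) = (data q hq).counit h := by
  have : (tensorSq σ).comp (data q hq).comulHom = (data q hq).counitHom := by
    refine algHom_ext ?_ ?_ ?_
    · rw [AlgHom.comp_apply, comulHom_apply, counitHom_apply, comul_g₁, counit_g₁, tensorSq_tmul,
        ← map_mul, g₁_sq, map_one]
    · rw [AlgHom.comp_apply, comulHom_apply, counitHom_apply, comul_g₂, counit_g₂, tensorSq_tmul,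
        ← map_mul, g₂_sq, map_one]
    · simp only [AlgHom.comp_apply, comulHom_apply, counitHom_apply, comul_x, counit_x, comulGen,
        map_add, tensorSq_tmul, map_mul, hx, mul_zero, zero_mul, add_zero]
  exact DFunLike.congr_fun this h

theorem isAdmissible_iff (σ : H16 k →ₐ[k] k) (v : H16 k) :
    (data q hq).IsAdmissible σ v ↔ σ = character k ∧ v = g₂ k := by
  have h2 := two_ne_zero_of_primitive hq
  have hg := isSignTwisted q hq
  refine ⟨fun h => ?_, ?_⟩
  swap
  · rintro ⟨rfl, rfl⟩
    exact isAdmissible q hq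
  have hx : σ (x k) = 0 := by
    have : σ (x k) ^ 4 = 0 := by rw [← map_pow, x_pow, map_zero]
    exact pow_eq_zero_iff (by norm_num) |>.mp this
  have h₁ : σ (g₁ k) = 1 := by
    have : σ (g₁ k) * σ (g₁ k) = 1 := by rw [← map_mul, g₁_sq, map_one]
    refine (mul_self_eq_one_iff.mp this).resolve_right fun h' => ?_
    exact hg.not_isAdmissible h2 h' (tensorSq_comul q hq hx) v h
  have h₂ : σ (g₂ k) = -1 := by
    have : σ (g₂ k) * σ (g₂ k) = 1 := by rw [← map_mul, g₂_sq, map_one]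
    refine (mul_self_eq_one_iff.mp this).resolve_left fun h' => ?_
    -- With σ(g₁) = σ(g₂) = 1 the character would be the counit, and ε(v) = 1 would contradict σ(v)
    -- = −1.
    have e : σ = (data q hq).counitHom :=
      algHom_ext (h₁.trans (counit_g₁ q hq).symm) (h'.trans (counit_g₂ q hq).symm)
        (hx.trans (counit_x q hq).symm)
    have e1 := h.apply_eq
    rw [e, counitHom_apply, h.counit_eq] at e1
    exact h2 (by linear_combination e1)
  have hσ : σ = character k :=
    algHom_ext (h₁.trans character_g₁.symm) (h₂.trans character_g₂.symm)
      (hx.trans character_x.symm)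
  refine ⟨hσ, ?_⟩
  subst hσ
  -- As σ(g₁) = 1, all three contractions are 1 and the formula for Δ(v) says that v is group-like.
  have hv : (data q hq).comul v = v ⊗ₜ[k] v := by
    rw [h.comul_eq, hg.contract₁_PhiInv h2 h₁, hg.contract₂_Phi h₁, hg.contract₃_PhiInv h2 h₁,
      one_mul, mul_one, mul_one, Algebra.TensorProduct.tmul_mul_tmul, one_mul, mul_one]
  have hvx : x k * v = v * x k := by
    have := h.commute (x k)
    rwa [← hitRHom_apply, hitR_x q hq h₁ hx, hitL_x q hq h₁ hx] at this
  have hu : projPlus k v = 1 := by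
    refine H8.eq_one_of_grouplike q hq ?_ ?_ ?_
    · rw [comul_proj, hv, Algebra.TensorProduct.map_tmul]
    · rw [counit_proj, h.counit_eq]
    · rw [← projPlus_x, ← map_mul, hvx, map_mul]
  -- The image of v under g₂ ↦ 1 is 1, and its image under g₂ ↦ −1 is the first image of (Id ⊗
  -- σ)Δ(v) = −v, hence −1.
  refine eq_of_proj_eq h2 ?_ ?_
  · rw [hu, projPlus_g₂]
  · rw [proj_neg_one q hq, hitR_of_comul_eq _ _ hv, h.apply_eq, map_smul, hu, projMinus_g₂,
      neg_smul, one_smul]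

end H16

end

section

/-! ### The quasi-Hopf algebra `H(θ)` -/

/-- A twisted commutation relation `f(a) t = t f(τ(a))` extends from generators. -/
theorem twisted_commute_of_adjoin_eq_top {k : Type u} {A : Type v} {B : Type w} [Field k] [Ring A]
    [Algebra k A] [Semiring B] [Algebra k B] (f : A →ₐ[k] B) (τ : A →ₐ[k] A) (t : B) {s : Set A}
    (hs : Algebra.adjoin k s = ⊤) (h : ∀ a ∈ s, f a * t = t * f (τ a)) (a : A) :
    f a * t = t * f (τ a) := by
  have ha : a ∈ Algebra.adjoin k s := hs ▸ Algebra.mem_top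
  induction ha using Algebra.adjoin_induction with
  | mem a ha => exact h a ha
  | algebraMap r =>
    rw [AlgHom.commutes, AlgHom.commutes, AlgHom.commutes]
    exact Algebra.commutes r t
  | add a b _ _ ha hb => rw [map_add, map_add, map_add, add_mul, mul_add, ha, hb]
  | mul a b _ _ ha hb =>
    rw [map_mul, map_mul, map_mul, mul_assoc, hb, ← mul_assoc, ha, mul_assoc]

/-! ### Skew-primitive elements -/

section SkewPrimitive

variable {k : Type u} {A : Type v} [Field k] [Ring A] [Algebra k A]

/-- The cross terms v t ⊗ t and t v ⊗ t cancel. -/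
theorem skewPrimitive_mul_self {v t : A} (hvt : v * t = -(t * v)) (ht : t * t = 0) :
    (v ⊗ₜ[k] t + t ⊗ₜ[k] 1) * (v ⊗ₜ[k] t + t ⊗ₜ[k] 1) = 0 := by
  simp only [mul_add, add_mul, Algebra.TensorProduct.tmul_mul_tmul, ht, hvt, mul_one, one_mul,
    TensorProduct.tmul_zero, TensorProduct.zero_tmul, TensorProduct.neg_tmul]
  abel

/-- With c = σ(a) and t = θ, this is the image under Δ of the relation h θ = σ(h₁) θ h₂ at a
group-like h = a. -/
theorem grouplike_mul_skewPrimitive {a v t : A} {c : k} (hav : a * v = v * a)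
    (hat : a * t = c • (t * a)) :
    (a ⊗ₜ[k] a) * (v ⊗ₜ[k] t + t ⊗ₜ[k] 1)
      = (v ⊗ₜ[k] t + t ⊗ₜ[k] 1) * (c • a ⊗ₜ[k] a) := by
  simp only [mul_add, add_mul, Algebra.TensorProduct.tmul_mul_tmul, mul_smul_comm, hav, hat,
    mul_one, one_mul, TensorProduct.tmul_smul, TensorProduct.smul_tmul']

theorem commute_pPlus {g t : A} (h : Commute g t) : Commute (pPlus k g) t :=
  ((Commute.one_left t).add_left h).smul_left _

theorem commute_pMinus {g t : A} (h : Commute g t) : Commute (pMinus k g) t :=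
  ((Commute.one_left t).sub_left h).smul_left _

theorem commute_tmul {a b c d : A} (h : Commute a c) (h' : Commute b d) :
    Commute (a ⊗ₜ[k] b) (c ⊗ₜ[k] d) := by
  rw [Commute, SemiconjBy, Algebra.TensorProduct.tmul_mul_tmul,
    Algebra.TensorProduct.tmul_mul_tmul, h.eq, h'.eq]

/-- Every leg of Δ(x) is built from g and x, which commute with v and t. It treats the generator x,
on which the twist by σ₀ is the identity. -/
theorem commute_comulGen (q : k) {g x v t : A} (hgv : Commute g v) (hgt : Commute g t)
    (hxv : Commute x v) (hxt : Commute x t) :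
    Commute (comulGen q g x) (v ⊗ₜ[k] t + t ⊗ₜ[k] 1) := by
  have hp : ∀ {s : A}, Commute g s → Commute (pPlus k g + q • pMinus k g) s := fun h =>
    (commute_pPlus h).add_left ((commute_pMinus h).smul_left q)
  refine Commute.add_left (Commute.add_left ?_ ?_) ?_
  · exact (commute_tmul hxv (hp hgt)).add_right (commute_tmul hxt (Commute.one_right _))
  · exact (commute_tmul (Commute.one_left _) ((commute_pPlus hgt).mul_left hxt)).add_right
      (commute_tmul (Commute.one_left _) (Commute.one_right _))
  · exact (commute_tmul hgv ((commute_pMinus hgt).mul_left hxt)).add_right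
      (commute_tmul hgt (Commute.one_right _))

theorem commute_antipodeGen (q : k) {g x t : A} (hg : Commute g t) (hx : Commute x t) :
    Commute (antipodeGen q g x) t :=
  (hx.mul_left ((commute_pPlus hg).add_left ((commute_pMinus hg).smul_left q))).neg_left

theorem neg_one_smul_eq (a : A) : (-1 : k) • a = -a := by rw [neg_smul, one_smul]

theorem mul_neg_one_smul (a t : A) : t * ((-1 : k) • a) = -(t * a) := by
  rw [neg_smul, one_smul, mul_neg]

theorem antipode_skewPrimitive_mul_self {v t : A} (hvt : v * t = -(t * v)) (ht : t * t = 0) :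
    -(v * t) * -(v * t) = 0 := by
  rw [neg_mul_neg]
  nth_rw 2 [hvt]
  rw [mul_neg, mul_assoc, ← mul_assoc t, ht, zero_mul, mul_zero, neg_zero]

/-- This is the relation v t = −t v carried to the opposite algebra by the antipode, with v fixed
and t sent to −v t. -/
theorem op_mul_antipode_skewPrimitive {v t : A} (hvt : v * t = -(t * v)) :
    MulOpposite.op v * MulOpposite.op (-(v * t))
      = MulOpposite.op (-(v * t)) * ((-1 : k) • MulOpposite.op v) := by
  rw [mul_neg_one_smul, ← MulOpposite.op_mul, ← MulOpposite.op_mul, ← MulOpposite.op_neg,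
    neg_mul, mul_neg, neg_neg, mul_assoc, ← mul_neg, ← hvt]

/-- Evaluates the formula for S(θ), with a = S(v), m = p₋ and t = θ. Moving g and m to the right of
t leaves a t (g + 2m). -/
theorem mul_sub_two_smul_mul {a g m t : A} (hg : g * t = t * g) (hm : m * t = t * m)
    (hmg : m * g = -m) (hmm : m * m = m) (h : g + (2 : k) • m = 1) :
    a * g * t - (2 : k) • (a * m * g * t * m) = a * t := by
  rw [mul_assoc, hg, mul_assoc a m, hmg, mul_neg, neg_mul, neg_mul, mul_assoc a m, hm, mul_assoc,
    mul_assoc, hmm, smul_neg, sub_neg_eq_add, ← mul_smul_comm, ← mul_smul_comm, ← mul_add,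
    ← mul_add, h, mul_one]

end SkewPrimitive

namespace QuasiHopfData

variable {k : Type u} {H : Type v} [Field k] [Ring H] [Algebra k H]
variable (D : QuasiHopfData k H) [hD : D.IsMult] (σ : H →ₐ[k] k)

theorem hitLHom_apply (h : H) : D.hitLHom σ h = D.hitL σ h := rfl

namespace Theta

theorem fstPart_incl (h : H) : fstPart D σ (incl D σ h) = h := rfl

theorem sndPart_incl (h : H) : sndPart D σ (incl D σ h) = 0 := rfl

omit hD in
theorem fstPart_theta : fstPart D σ (theta D σ) = 0 := rfl

omit hD in
theorem sndPart_theta : sndPart D σ (theta D σ) = 1 := rfl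

/-- `Δ` on `H`, with values in `H(θ) ⊗ H(θ)`. -/
def comulIncl : H →ₐ[k] Theta D σ ⊗[k] Theta D σ :=
  (Algebra.TensorProduct.map (incl D σ) (incl D σ)).comp D.comulHom

theorem adjoin_eq_top {s : Set H} (hs : Algebra.adjoin k s = ⊤) :
    Algebra.adjoin k (insert (theta D σ) (incl D σ '' s)) = ⊤ := by
  rw [eq_top_iff]
  rintro z -
  have hi : ∀ h, incl D σ h ∈ Algebra.adjoin k (insert (theta D σ) (incl D σ '' s)) := by
    intro h
    have h1 : incl D σ h ∈ (Algebra.adjoin k s).map (incl D σ) :=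
      ⟨h, hs ▸ Algebra.mem_top, rfl⟩
    rw [AlgHom.map_adjoin] at h1
    exact Algebra.adjoin_mono (Set.subset_insert _ _) h1
  rw [eq_fstPart_add D σ z]
  exact add_mem (hi _) (mul_mem (Algebra.subset_adjoin (Set.mem_insert _ _)) (hi _))

variable (v : H)

theorem comul_incl (h : H) : (D.thetaData σ v).comul (incl D σ h)
    = Algebra.TensorProduct.map (incl D σ) (incl D σ) (D.comul h) := by
  change Algebra.TensorProduct.map (incl D σ) (incl D σ) (D.comul (fstPart D σ (incl D σ h)))
    + comulTheta D σ v * Algebra.TensorProduct.map (incl D σ) (incl D σ)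
      (D.comul (sndPart D σ (incl D σ h))) = _
  rw [sndPart_incl, fstPart_incl, map_zero, map_zero]
  exact (congrArg _ (mul_zero (comulTheta D σ v))).trans (add_zero _)

theorem comul_theta : (D.thetaData σ v).comul (theta D σ) = comulTheta D σ v := by
  change Algebra.TensorProduct.map (incl D σ) (incl D σ) (D.comul (fstPart D σ (theta D σ)))
    + comulTheta D σ v * Algebra.TensorProduct.map (incl D σ) (incl D σ)
      (D.comul (sndPart D σ (theta D σ))) = _
  rw [sndPart_theta, fstPart_theta, map_zero, map_zero, hD.comul_one, map_one, mul_one]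
  exact zero_add _

theorem counit_incl (h : H) : (D.thetaData σ v).counit (incl D σ h) = D.counit h := rfl

theorem counit_theta : (D.thetaData σ v).counit (theta D σ) = 0 := map_zero D.counit

theorem antipode_incl (h : H) :
    (D.thetaData σ v).antipode (incl D σ h) = incl D σ (D.antipode h) := by
  change incl D σ (D.antipode (fstPart D σ (incl D σ h)))
    + incl D σ (D.antipode (sndPart D σ (incl D σ h))) * antipodeTheta D σ v = _
  rw [sndPart_incl, fstPart_incl, map_zero, map_zero, zero_mul, add_zero]

theorem antipode_theta (hS1 : D.antipode 1 = 1) :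
    (D.thetaData σ v).antipode (theta D σ) = antipodeTheta D σ v := by
  change incl D σ (D.antipode (fstPart D σ (theta D σ)))
    + incl D σ (D.antipode (sndPart D σ (theta D σ))) * antipodeTheta D σ v = _
  rw [sndPart_theta, fstPart_theta, map_zero, map_zero, zero_add, hS1, map_one, one_mul]

/-- If the relations between `θ` and `H` are respected by `Δ`, the structure maps of `H(θ)` are
multiplicative. -/
theorem isMult (h1 : comulTheta D σ v * comulTheta D σ v = 0)
    (h2 : ∀ h, comulIncl D σ h * comulTheta D σ v = comulTheta D σ v * comulIncl D σ (D.hitL σ h)) :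
    (D.thetaData σ v).IsMult := by
  obtain ⟨F, ⟨hF, hθ⟩, -⟩ := existsUnique_lift D σ (comulIncl D σ) (comulTheta D σ v) h1 h2
  -- The formula Δ(a + θ b) = Δ(a) + Δ(θ) Δ(b) is what the morphism given by the universal property
  -- computes.
  have key : ∀ z, (D.thetaData σ v).comul z = F z := by
    intro z
    have hF' : ∀ h, F (incl D σ h) = comulIncl D σ h := fun h => DFunLike.congr_fun hF h
    conv_rhs => rw [eq_fstPart_add D σ z, map_add, map_mul, hθ, hF', hF']
    rfl
  exact
    { comul_one := by rw [key, map_one]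
      comul_mul := fun a b => by rw [key, key, key, map_mul]
      counit_one := hD.counit_one
      counit_mul := fun a b => hD.counit_mul a.fst b.fst }

/-- An anti-multiplicative map is a morphism to the opposite algebra. The hypotheses on
`antipodeTheta` are the relations of H(θ) read there, so the universal property applies. -/
theorem antipode_mul (hS1 : D.antipode 1 = 1)
    (hS : ∀ a b, D.antipode (a * b) = D.antipode b * D.antipode a)
    (h1 : antipodeTheta D σ v * antipodeTheta D σ v = 0)
    (h2 : ∀ h, antipodeTheta D σ v * incl D σ (D.antipode h)
      = incl D σ (D.antipode (D.hitL σ h)) * antipodeTheta D σ v) (a b : Theta D σ) :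
    (D.thetaData σ v).antipode (a * b)
      = (D.thetaData σ v).antipode b * (D.thetaData σ v).antipode a := by
  let f : H →ₐ[k] (Theta D σ)ᵐᵒᵖ := AlgHom.ofLinearMap
    ((MulOpposite.opLinearEquiv k).toLinearMap ∘ₗ (incl D σ).toLinearMap ∘ₗ D.antipode)
    (by
      change MulOpposite.op (incl D σ (D.antipode 1)) = 1
      rw [hS1, map_one, MulOpposite.op_one])
    (fun a b => by
      change MulOpposite.op (incl D σ (D.antipode (a * b)))
        = MulOpposite.op (incl D σ (D.antipode a)) * MulOpposite.op (incl D σ (D.antipode b))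
      rw [hS, map_mul, MulOpposite.op_mul])
  have hf : ∀ h, f h = MulOpposite.op (incl D σ (D.antipode h)) := fun _ => rfl
  obtain ⟨F, ⟨hF, hθ⟩, -⟩ := existsUnique_lift D σ f (MulOpposite.op (antipodeTheta D σ v))
    (by rw [← MulOpposite.op_mul, h1, MulOpposite.op_zero])
    (fun h => by rw [hf, hf, ← MulOpposite.op_mul, ← MulOpposite.op_mul, h2])
  have key : ∀ z, (D.thetaData σ v).antipode z = (F z).unop := by
    intro z
    have hF' : ∀ h, F (incl D σ h) = f h := fun h => DFunLike.congr_fun hF h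
    conv_rhs => rw [eq_fstPart_add D σ z, map_add, map_mul, hθ, hF', hF']
    rfl
  rw [key, key, key, map_mul, MulOpposite.unop_mul]

variable {D} {σ} {g : H}

theorem comulTheta_eq (hg : D.IsSignTwisted g) (h2 : (2 : k) ≠ 0) (hσ : σ g = 1) :
    comulTheta D σ v = incl D σ v ⊗ₜ[k] theta D σ + theta D σ ⊗ₜ[k] 1 := by
  rw [comulTheta, hg.contract₂_Phi hσ, hg.contract₁_PhiInv h2 hσ, mul_one, map_one, mul_one,
    mul_one]

/-- Since σ(g) = 1, both twists fix p₋, so `antipodeAux` reduces to 1 − 2 p₋ ⊗ p₋; its two terms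
combine by `mul_sub_two_smul_mul`. -/
theorem antipodeTheta_eq (hg : D.IsSignTwisted g) (h2 : (2 : k) ≠ 0) (hσ : σ g = 1)
    (hS1 : D.antipode 1 = 1) (hS : ∀ a b, D.antipode (a * b) = D.antipode b * D.antipode a) :
    antipodeTheta D σ v = -(incl D σ (D.antipode v) * theta D σ) := by
  have hR1 : D.hitR σ 1 = 1 := by
    rw [← hitRHom_apply, map_one]
  have hRM : D.hitR σ (pMinus k g) = pMinus k g := by
    rw [← hitRHom_apply, map_pMinus, hitRHom_apply, hitR_of_comul_eq _ _ hg.comul_eq, hσ, one_smul]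
  have hLg : D.hitL σ g = g := by simp [hitL, hg.comul_eq, hσ]
  have hLM : D.hitL σ (pMinus k g) = pMinus k g := by
    rw [pMinus, map_smul, map_sub, hLg, ← hitLHom_apply, map_one]
  have hMM := pMinus_mul_pMinus h2 hg.sq
  have haux : antipodeAux D σ = 1 - (2 : k) • pMinus k g ⊗ₜ[k] pMinus k g := by
    rw [antipodeAux, hg.contract₂_Phi hσ, one_mul, hg.PhiInv_eq h2, phiGen, hg.beta_eq]
    simp only [Algebra.TensorProduct.one_def, map_sub, map_smul, TensorProduct.map_tmul,
      LinearMap.comp_apply, LinearMap.lTensor_tmul, LinearMap.mul'_apply,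
      LinearMap.mulLeft_apply, hR1, hRM, hS1, hg.antipode_pMinus hS1, one_mul, hMM]
  have hθg : incl D σ g * theta D σ = theta D σ * incl D σ g := by rw [incl_mul_theta, hLg]
  have hgM : g + (2 : k) • (pMinus k g) = 1 := by
    nth_rw 1 [IsSignTwisted.eq_one_sub h2 g]
    rw [sub_add_cancel]
  have e : pMinus k g * g = -pMinus k g := pMinus_mul_self hg.sq
  rw [antipodeTheta, haux]
  congr 1
  simp only [Algebra.TensorProduct.one_def, map_sub, map_smul, TensorProduct.map_tmul,
    LinearMap.comp_apply, LinearMap.mul'_apply, LinearMap.mulRight_apply,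
    AlgHom.toLinearMap_apply, one_mul, hg.alpha_eq, hS, hg.antipode_pMinus hS1, map_one, mul_one]
  rw [map_mul, map_mul, map_mul]
  refine mul_sub_two_smul_mul hθg (by rw [incl_mul_theta, hLM]) ?_ (by rw [← map_mul, hMM]) ?_
  · rw [← map_mul, e, map_neg]
  · rw [← map_smul, ← map_add, hgM, map_one]

theorem isSignTwisted [(D.thetaData σ v).IsMult] (hg : D.IsSignTwisted g) :
    (D.thetaData σ v).IsSignTwisted (incl D σ g) where
  sq := by rw [← map_mul, hg.sq, map_one]
  comul_eq := by rw [comul_incl, hg.comul_eq, Algebra.TensorProduct.map_tmul]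
  counit_eq := by rw [counit_incl, hg.counit_eq]
  antipode_eq := by rw [antipode_incl, hg.antipode_eq]
  Phi_eq := by
    refine Eq.trans ?_ (map_phiGen (incl D σ) g)
    rw [← hg.Phi_eq]
    rfl
  alpha_eq := congrArg (incl D σ) hg.alpha_eq
  beta_eq := (congrArg (incl D σ) hg.beta_eq).trans (map_one _)

end Theta

end QuasiHopfData

/-! ### The quasi-Hopf algebra H_q(16)(θ) -/

namespace H16

open QuasiHopfData

variable {k : Type u} [Field k] (q : k) (hq : IsPrimitiveRoot q 4)

/-- The inclusion of `H_q(16)` in `H_q(16)(θ)`. -/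
abbrev inclTheta : H16 k →ₐ[k] (data q hq).Theta (character k) :=
  Theta.incl (data q hq) (character k)

/-- The generator `θ` of `H_q(16)(θ)`. -/
abbrev θ : (data q hq).Theta (character k) := Theta.theta (data q hq) (character k)

theorem g₁_θ : Commute (inclTheta q hq (g₁ k)) (θ q hq) := by
  rw [Commute, SemiconjBy, Theta.incl_mul_theta, hitL_g₁, character_g₁, one_smul]

theorem g₂_θ : inclTheta q hq (g₂ k) * θ q hq = -(θ q hq * inclTheta q hq (g₂ k)) := by
  rw [Theta.incl_mul_theta, hitL_g₂, character_g₂, map_smul]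
  exact mul_neg_one_smul _ _

theorem x_θ : Commute (inclTheta q hq (x k)) (θ q hq) := by
  rw [Commute, SemiconjBy, Theta.incl_mul_theta, hitL_x q hq character_g₁ character_x]

theorem comulTheta_eq : Theta.comulTheta (data q hq) (character k) (g₂ k)
    = inclTheta q hq (g₂ k) ⊗ₜ[k] θ q hq + θ q hq ⊗ₜ[k] 1 :=
  Theta.comulTheta_eq (g₂ k) (isSignTwisted q hq) (two_ne_zero_of_primitive hq) character_g₁

theorem antipodeTheta_eq : Theta.antipodeTheta (data q hq) (character k) (g₂ k)
    = -(inclTheta q hq (g₂ k) * θ q hq) := by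
  rw [Theta.antipodeTheta_eq (g₂ k) (isSignTwisted q hq) (two_ne_zero_of_primitive hq)
    character_g₁ (antipode_one q hq) (antipode_mul q hq), antipode_g₂]

theorem commute_incl_g₂ (h : H16 k) : Commute (inclTheta q hq h) (inclTheta q hq (g₂ k)) := by
  rw [Commute, SemiconjBy, ← map_mul, ← map_mul, g₂_mul_comm]

instance : ((data q hq).thetaData (character k) (g₂ k)).IsMult := by
  refine Theta.isMult _ _ _ ?_ ?_
  · rw [comulTheta_eq]
    exact skewPrimitive_mul_self (g₂_θ q hq) (Theta.theta_mul_theta _ _)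
  · rw [comulTheta_eq]
    refine twisted_commute_of_adjoin_eq_top (Theta.comulIncl (data q hq) (character k)) ((data q hq).hitLHom (character k)) _
      adjoin_eq_top ?_
    rintro _ (rfl | rfl | rfl)
    · rw [hitLHom_apply, hitL_g₁, character_g₁, map_smul, Theta.comulIncl, AlgHom.comp_apply,
        comulHom_apply, comul_g₁, Algebra.TensorProduct.map_tmul]
      refine grouplike_mul_skewPrimitive (commute_incl_g₂ q hq _).eq ?_
      rw [one_smul]
      exact (g₁_θ q hq).eq
    · rw [hitLHom_apply, hitL_g₂, character_g₂, map_smul, Theta.comulIncl, AlgHom.comp_apply,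
        comulHom_apply, comul_g₂, Algebra.TensorProduct.map_tmul]
      refine grouplike_mul_skewPrimitive (commute_incl_g₂ q hq _).eq ?_
      exact (g₂_θ q hq).trans (neg_one_smul_eq _).symm
    · rw [hitLHom_apply, hitL_x q hq character_g₁ character_x, Theta.comulIncl, AlgHom.comp_apply,
        comulHom_apply, comul_x, map_comulGen]
      exact (commute_comulGen q (commute_incl_g₂ q hq _) (g₁_θ q hq) (commute_incl_g₂ q hq _)
        (x_θ q hq)).eq

theorem theta_antipode_one :
    ((data q hq).thetaData (character k) (g₂ k)).antipode 1 = 1 := by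
  have h := Theta.antipode_incl (data q hq) (character k) (g₂ k) 1
  rwa [antipode_one, map_one] at h

theorem theta_antipode_theta : ((data q hq).thetaData (character k) (g₂ k)).antipode (θ q hq)
    = -(inclTheta q hq (g₂ k) * θ q hq) := by
  rw [Theta.antipode_theta _ _ _ (antipode_one q hq), antipodeTheta_eq]

theorem theta_comul_theta : ((data q hq).thetaData (character k) (g₂ k)).comul (θ q hq)
    = inclTheta q hq (g₂ k) ⊗ₜ[k] θ q hq + θ q hq ⊗ₜ[k] 1 := by
  rw [Theta.comul_theta, comulTheta_eq]

theorem theta_antipode_mul (a b : (data q hq).Theta (character k)) :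
    ((data q hq).thetaData (character k) (g₂ k)).antipode (a * b)
      = ((data q hq).thetaData (character k) (g₂ k)).antipode b
        * ((data q hq).thetaData (character k) (g₂ k)).antipode a := by
  have h2 := g₂_θ q hq
  have hθ := Theta.theta_mul_theta (data q hq) (character k)
  refine Theta.antipode_mul _ _ _ (antipode_one q hq) (antipode_mul q hq) ?_ ?_ a b
  · rw [antipodeTheta_eq]
    exact antipode_skewPrimitive_mul_self h2 hθ
  · rw [antipodeTheta_eq]
    -- Regarding S as a morphism to the opposite algebra reduces the commutation relation to g₁, g₂
    -- and x.
    let f : H16 k →ₐ[k] ((data q hq).Theta (character k))ᵐᵒᵖ := AlgHom.ofLinearMap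
      ((MulOpposite.opLinearEquiv k).toLinearMap ∘ₗ (inclTheta q hq).toLinearMap
        ∘ₗ (data q hq).antipode)
      (by
        change MulOpposite.op (inclTheta q hq ((data q hq).antipode 1)) = 1
        rw [antipode_one, map_one, MulOpposite.op_one])
      (fun a b => by
        change MulOpposite.op (inclTheta q hq ((data q hq).antipode (a * b)))
          = MulOpposite.op (inclTheta q hq ((data q hq).antipode a))
            * MulOpposite.op (inclTheta q hq ((data q hq).antipode b))
        rw [antipode_mul, map_mul, MulOpposite.op_mul])
    have key := twisted_commute_of_adjoin_eq_top f ((data q hq).hitLHom (character k))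
      (MulOpposite.op (-(inclTheta q hq (g₂ k) * θ q hq))) adjoin_eq_top (by
        have hf : ∀ h, f h = MulOpposite.op (inclTheta q hq ((data q hq).antipode h)) :=
          fun _ => rfl
        rintro _ (rfl | rfl | rfl)
        · rw [hitLHom_apply, hitL_g₁, character_g₁, one_smul, hf, antipode_g₁,
            ← MulOpposite.op_mul, ← MulOpposite.op_mul,
            (((commute_incl_g₂ q hq _).mul_right (g₁_θ q hq)).neg_right).eq]
        · rw [hitLHom_apply, hitL_g₂, character_g₂, map_smul, hf, antipode_g₂]
          exact op_mul_antipode_skewPrimitive h2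
        · rw [hitLHom_apply, hitL_x q hq character_g₁ character_x, hf, antipode_x,
            map_antipodeGen, ← MulOpposite.op_mul, ← MulOpposite.op_mul,
            ((commute_antipodeGen q ((commute_incl_g₂ q hq _).mul_right (g₁_θ q hq))
              ((commute_incl_g₂ q hq _).mul_right (x_θ q hq))).neg_right).eq])
    intro h
    exact congrArg MulOpposite.unop (key h)

/-- The algebra H(θ) is again sign-twisted with respect to g₁. Among its generators only θ is new,
and it is skew-primitive relative to the group-like g₂. -/
theorem theta_isQuasiHopf :
    ((data q hq).thetaData (character k) (g₂ k)).IsQuasiHopf := by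
  have h2 := two_ne_zero_of_primitive hq
  have hg := Theta.isSignTwisted (σ := character k) (g₂ k) (isSignTwisted q hq)
  have hS1 := theta_antipode_one q hq
  have hS := theta_antipode_mul q hq
  have hΔg₂ : ((data q hq).thetaData (character k) (g₂ k)).comul (inclTheta q hq (g₂ k))
      = inclTheta q hq (g₂ k) ⊗ₜ[k] inclTheta q hq (g₂ k) := by
    rw [Theta.comul_incl, comul_g₂, Algebra.TensorProduct.map_tmul]
  have hεg₂ : ((data q hq).thetaData (character k) (g₂ k)).counit (inclTheta q hq (g₂ k)) = 1 := by
    rw [Theta.counit_incl, counit_g₂]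
  have hSg₂ : ((data q hq).thetaData (character k) (g₂ k)).antipode (inclTheta q hq (g₂ k))
      = inclTheta q hq (g₂ k) := by
    rw [Theta.antipode_incl, antipode_g₂]
  have hg₂ : inclTheta q hq (g₂ k) * inclTheta q hq (g₂ k) = 1 := by
    rw [← map_mul, g₂_sq, map_one]
  refine hg.isQuasiHopf h2 hS1 hS (Theta.adjoin_eq_top _ _ adjoin_eq_top) ?_
  rintro _ (rfl | ⟨_, rfl | rfl | rfl, rfl⟩)
  · exact hg.axiomsAt_skewPrimitive hS1 (commute_incl_g₂ q hq _).eq (g₁_θ q hq).eq hΔg₂ hεg₂ hSg₂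
      hg₂ (theta_comul_theta q hq) (Theta.counit_theta _ _ _) (theta_antipode_theta q hq)
  · exact hg.axiomsAt_grouplike rfl hg.comul_eq hg.counit_eq hg.antipode_eq hg.sq
  · exact hg.axiomsAt_grouplike (commute_incl_g₂ q hq _).eq hΔg₂ hεg₂ hSg₂ hg₂
  · refine hg.axiomsAt_comulGen h2 hS1 hS (sq_of_primitive hq)
      (by rw [← map_mul, g₁_x, map_neg, map_mul]) ?_ ?_ ?_
    · rw [Theta.comul_incl, comul_x, map_comulGen]
    · rw [Theta.counit_incl, counit_x]
    · rw [Theta.antipode_incl, antipode_x, map_antipodeGen]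

theorem theta_finrank : Module.finrank k ((data q hq).Theta (character k)) = 32 := by
  have h2 := two_ne_zero_of_primitive hq
  have h8 : Module.finrank k (H8 k) ≠ 0 := by rw [H8.finrank_eq h2]; norm_num
  have : Module.Finite k (H8 k) := Module.finite_of_finrank_pos (Nat.pos_of_ne_zero h8)
  have h16 : Module.finrank k (H16 k) = 16 := by
    rw [Module.finrank_tensorProduct, H8.finrank_eq h2, GroupAlgC2.finrank_eq]
  have : Module.Finite k (H16 k) := Module.finite_of_finrank_pos (by rw [h16]; norm_num)
  -- As a vector space H(θ) is H ⊕ θ H.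
  change Module.finrank k (H16 k × H16 k) = 32
  rw [Module.finrank_prod, h16]

end H16

end

section

/-! ### The isomorphism of `H_q(16)(θ)` with `H₄ ⊗ H_q(8)` -/

/-- Two anti-multiplicative linear maps agree if they agree on generators. -/
theorem antiHom_ext {k : Type u} {A : Type v} {B : Type w} [Field k] [Ring A] [Algebra k A]
    [Ring B] [Algebra k B] {f f' : A →ₗ[k] B} (h1 : f 1 = 1) (h1' : f' 1 = 1)
    (hf : ∀ a b, f (a * b) = f b * f a) (hf' : ∀ a b, f' (a * b) = f' b * f' a) {s : Set A}
    (hs : Algebra.adjoin k s = ⊤) (h : ∀ a ∈ s, f a = f' a) (a : A) : f a = f' a := by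
  have ha : a ∈ Algebra.adjoin k s := hs ▸ Algebra.mem_top
  induction ha using Algebra.adjoin_induction with
  | mem a ha => exact h a ha
  | algebraMap r => rw [Algebra.algebraMap_eq_smul_one, map_smul, map_smul, h1, h1']
  | add a b _ _ ha hb => rw [map_add, map_add, ha, hb]
  | mul a b _ _ ha hb => rw [hf, hf', ha, hb]

section

variable {k : Type u} {A : Type v} {B : Type w} [Field k] [Ring A] [Algebra k A] [Ring B]
  [Algebra k B]

theorem commute_of_adjoin_eq_top {C : Type*} [Ring C] [Algebra k C] (f : A →ₐ[k] C)
    (f' : B →ₐ[k] C) {s : Set A} {t : Set B} (hs : Algebra.adjoin k s = ⊤)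
    (ht : Algebra.adjoin k t = ⊤) (h : ∀ a ∈ s, ∀ b ∈ t, Commute (f a) (f' b)) (a : A) (b : B) :
    Commute (f a) (f' b) := by
  refine twisted_commute_of_adjoin_eq_top f (AlgHom.id k A) (f' b) hs (fun a ha => ?_) a
  exact (twisted_commute_of_adjoin_eq_top f' (AlgHom.id k B) (f a) ht
    (fun b hb => (h a ha b hb).symm) b).symm

end

namespace H16

open QuasiHopfData

variable {k : Type u} [Field k] (q : k) (hq : IsPrimitiveRoot q 4)

variable (k) in
/-- The morphism of algebras `H_q(16) → H₄ ⊗ H_q(8)` with `g₂ ↦ g ⊗ 1`. -/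
def toTensor : H16 k →ₐ[k] H4 k ⊗[k] H8 k :=
  Algebra.TensorProduct.map (GroupAlgC2.lift (H4.g k) (H4.g_sq k)) (AlgHom.id k (H8 k))

theorem toTensor_g₁ : toTensor k (g₁ k) = 1 ⊗ₜ[k] H8.g k := by
  rw [toTensor, g₁, Algebra.TensorProduct.map_tmul, map_one, AlgHom.id_apply]

theorem toTensor_g₂ : toTensor k (g₂ k) = H4.g k ⊗ₜ[k] 1 := by
  rw [toTensor, g₂_eq, Algebra.TensorProduct.map_tmul, map_one, GroupAlgC2.lift_gen]

theorem toTensor_x : toTensor k (x k) = 1 ⊗ₜ[k] H8.x k := by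
  rw [toTensor, x, Algebra.TensorProduct.map_tmul, map_one, AlgHom.id_apply]

/-- The twist fixes g₁ and x, whose images lie in the factor H_q(8) and commute with x ⊗ 1. It
negates g₂, whose image g ⊗ 1 anticommutes with x ⊗ 1 in H₄. -/
theorem toTensor_commute (h : H16 k) : toTensor k h * H4.x k ⊗ₜ[k] 1
    = H4.x k ⊗ₜ[k] 1 * toTensor k ((data q hq).hitL (character k) h) := by
  refine twisted_commute_of_adjoin_eq_top (toTensor k) ((data q hq).hitLHom (character k)) _
    adjoin_eq_top ?_ h
  rintro _ (rfl | rfl | rfl)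
  · rw [hitLHom_apply, hitL_g₁, character_g₁, one_smul, toTensor_g₁,
      Algebra.TensorProduct.tmul_mul_tmul, Algebra.TensorProduct.tmul_mul_tmul, one_mul, mul_one,
      one_mul, mul_one]
  · rw [hitLHom_apply, hitL_g₂, character_g₂, map_smul, toTensor_g₂]
    refine Eq.trans ?_ (mul_neg_one_smul _ _).symm
    rw [Algebra.TensorProduct.tmul_mul_tmul, Algebra.TensorProduct.tmul_mul_tmul, H4.g_x,
      TensorProduct.neg_tmul]
  · rw [hitLHom_apply, hitL_x q hq character_g₁ character_x, toTensor_x,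
      Algebra.TensorProduct.tmul_mul_tmul, Algebra.TensorProduct.tmul_mul_tmul, one_mul, mul_one,
      one_mul, mul_one]

theorem exists_thetaToTensor : ∃ F : (data q hq).Theta (character k) →ₐ[k] H4 k ⊗[k] H8 k,
    F.comp (inclTheta q hq) = toTensor k ∧ F (θ q hq) = H4.x k ⊗ₜ[k] 1 :=
  (Theta.existsUnique_lift (data q hq) (character k) (toTensor k) (H4.x k ⊗ₜ[k] 1)
    (by rw [Algebra.TensorProduct.tmul_mul_tmul, H4.x_sq, TensorProduct.zero_tmul])
    (toTensor_commute q hq)).exists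

/-- The morphism of algebras `H_q(16)(θ) → H₄ ⊗ H_q(8)` with `θ ↦ x ⊗ 1`. -/
def thetaToTensor : (data q hq).Theta (character k) →ₐ[k] H4 k ⊗[k] H8 k :=
  (exists_thetaToTensor q hq).choose

theorem thetaToTensor_incl (h : H16 k) :
    thetaToTensor q hq (inclTheta q hq h) = toTensor k h :=
  DFunLike.congr_fun (exists_thetaToTensor q hq).choose_spec.1 h

theorem thetaToTensor_θ : thetaToTensor q hq (θ q hq) = H4.x k ⊗ₜ[k] 1 :=
  (exists_thetaToTensor q hq).choose_spec.2

/-- The morphism of algebras `H₄ → H_q(16)(θ)` with `g ↦ g₂`, `x ↦ θ`. -/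
def ofH4 : H4 k →ₐ[k] (data q hq).Theta (character k) :=
  H4.lift (inclTheta q hq (g₂ k)) (θ q hq) (by rw [← map_mul, g₂_sq, map_one])
    (Theta.theta_mul_theta _ _) (g₂_θ q hq)

theorem ofH4_g : ofH4 q hq (H4.g k) = inclTheta q hq (g₂ k) := H4.lift_g _ _ _ _ _

theorem ofH4_x : ofH4 q hq (H4.x k) = θ q hq := H4.lift_x _ _ _ _ _

/-- The morphism of algebras `H_q(8) → H_q(16)(θ)` with `g ↦ g₁`, `x ↦ x`. -/
def ofH8 : H8 k →ₐ[k] (data q hq).Theta (character k) :=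
  (inclTheta q hq).comp (Algebra.TensorProduct.includeRight : H8 k →ₐ[k] H16 k)

theorem ofH8_g : ofH8 q hq (H8.g k) = inclTheta q hq (g₁ k) := rfl

theorem ofH8_x : ofH8 q hq (H8.x k) = inclTheta q hq (x k) := rfl

/-- The morphism of algebras `H₄ ⊗ H_q(8) → H_q(16)(θ)` with `g ⊗ 1 ↦ g₂`, `x ⊗ 1 ↦ θ`. -/
def tensorToTheta : H4 k ⊗[k] H8 k →ₐ[k] (data q hq).Theta (character k) :=
  Algebra.TensorProduct.lift (ofH4 q hq) (ofH8 q hq)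
    (commute_of_adjoin_eq_top _ _ H4.adjoin_eq_top H8.adjoin_eq_top (by
      rintro _ (rfl | rfl) _ (rfl | rfl)
      · rw [ofH4_g]
        exact (commute_incl_g₂ q hq _).symm
      · rw [ofH4_g]
        exact (commute_incl_g₂ q hq _).symm
      · rw [ofH4_x]
        exact (g₁_θ q hq).symm
      · rw [ofH4_x]
        exact (x_θ q hq).symm))

theorem tensorToTheta_tmul_one (a : H4 k) : tensorToTheta q hq (a ⊗ₜ[k] 1) = ofH4 q hq a := by
  rw [tensorToTheta, Algebra.TensorProduct.lift_tmul, map_one, mul_one]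

theorem tensorToTheta_one_tmul (b : H8 k) : tensorToTheta q hq (1 ⊗ₜ[k] b) = ofH8 q hq b := by
  rw [tensorToTheta, Algebra.TensorProduct.lift_tmul, map_one, one_mul]

theorem theta_algHom_ext {R : Type*} [Ring R] [Algebra k R]
    {φ ψ : (data q hq).Theta (character k) →ₐ[k] R} (hθ : φ (θ q hq) = ψ (θ q hq))
    (h₁ : φ (inclTheta q hq (g₁ k)) = ψ (inclTheta q hq (g₁ k)))
    (h₂ : φ (inclTheta q hq (g₂ k)) = ψ (inclTheta q hq (g₂ k)))
    (hx : φ (inclTheta q hq (x k)) = ψ (inclTheta q hq (x k))) : φ = ψ := by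
  refine AlgHom.ext_of_adjoin_eq_top (Theta.adjoin_eq_top _ _ adjoin_eq_top) ?_
  rintro _ (rfl | ⟨_, rfl | rfl | rfl, rfl⟩)
  exacts [hθ, h₁, h₂, hx]

/-- `H_q(16)(θ) ≃ H₄ ⊗ H_q(8)`, as algebras. -/
def thetaAlgEquiv : (data q hq).Theta (character k) ≃ₐ[k] H4 k ⊗[k] H8 k :=
  AlgEquiv.ofAlgHom (thetaToTensor q hq) (tensorToTheta q hq)
    (by
      refine Algebra.TensorProduct.ext ?_ ?_
      · refine AlgHom.ext_of_adjoin_eq_top H4.adjoin_eq_top ?_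
        rintro _ (rfl | rfl)
        · change thetaToTensor q hq (tensorToTheta q hq (_ ⊗ₜ[k] 1)) = _ ⊗ₜ[k] 1
          rw [tensorToTheta_tmul_one, ofH4_g, thetaToTensor_incl, toTensor_g₂]
        · change thetaToTensor q hq (tensorToTheta q hq (_ ⊗ₜ[k] 1)) = _ ⊗ₜ[k] 1
          rw [tensorToTheta_tmul_one, ofH4_x, thetaToTensor_θ]
      · refine AlgHom.ext_of_adjoin_eq_top H8.adjoin_eq_top ?_
        rintro _ (rfl | rfl)
        · change thetaToTensor q hq (tensorToTheta q hq (1 ⊗ₜ[k] _)) = 1 ⊗ₜ[k] _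
          rw [tensorToTheta_one_tmul, ofH8_g, thetaToTensor_incl, toTensor_g₁]
        · change thetaToTensor q hq (tensorToTheta q hq (1 ⊗ₜ[k] _)) = 1 ⊗ₜ[k] _
          rw [tensorToTheta_one_tmul, ofH8_x, thetaToTensor_incl, toTensor_x])
    (by
      refine theta_algHom_ext q hq ?_ ?_ ?_ ?_
      · rw [AlgHom.comp_apply, thetaToTensor_θ, tensorToTheta_tmul_one, ofH4_x, AlgHom.id_apply]
      · rw [AlgHom.comp_apply, thetaToTensor_incl, toTensor_g₁, tensorToTheta_one_tmul, ofH8_g,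
          AlgHom.id_apply]
      · rw [AlgHom.comp_apply, thetaToTensor_incl, toTensor_g₂, tensorToTheta_tmul_one, ofH4_g,
          AlgHom.id_apply]
      · rw [AlgHom.comp_apply, thetaToTensor_incl, toTensor_x, tensorToTheta_one_tmul, ofH8_x,
          AlgHom.id_apply])

theorem thetaToTensor_comul (a : (data q hq).Theta (character k)) :
    ((H4.data k).tensor (H8.data q hq)).comul (thetaToTensor q hq a)
      = Algebra.TensorProduct.map (thetaToTensor q hq) (thetaToTensor q hq)
        (((data q hq).thetaData (character k) (g₂ k)).comul a) := by
  have : ((H4.data k).tensor (H8.data q hq)).comulHom.comp (thetaToTensor q hq)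
      = (Algebra.TensorProduct.map (thetaToTensor q hq) (thetaToTensor q hq)).comp
        ((data q hq).thetaData (character k) (g₂ k)).comulHom := by
    refine theta_algHom_ext q hq ?_ ?_ ?_ ?_
    · simp only [AlgHom.comp_apply, comulHom_apply]
      rw [theta_comul_theta, thetaToTensor_θ, tensor_comul_tmul_one, H4.comul_x]
      simp only [map_add, Algebra.TensorProduct.map_tmul, thetaToTensor_θ, thetaToTensor_incl,
        toTensor_g₂, map_one, Algebra.TensorProduct.includeLeft_apply]
    · simp only [AlgHom.comp_apply, comulHom_apply]
      rw [Theta.comul_incl, comul_g₁, thetaToTensor_incl, toTensor_g₁, tensor_comul_one_tmul,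
        H8.comul_g]
      simp only [Algebra.TensorProduct.map_tmul, thetaToTensor_incl, toTensor_g₁,
        Algebra.TensorProduct.includeRight_apply]
    · simp only [AlgHom.comp_apply, comulHom_apply]
      rw [Theta.comul_incl, comul_g₂, thetaToTensor_incl, toTensor_g₂, tensor_comul_tmul_one,
        H4.comul_g]
      simp only [Algebra.TensorProduct.map_tmul, thetaToTensor_incl, toTensor_g₂,
        Algebra.TensorProduct.includeLeft_apply]
    · simp only [AlgHom.comp_apply, comulHom_apply]
      rw [Theta.comul_incl, comul_x, thetaToTensor_incl, toTensor_x, tensor_comul_one_tmul,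
        H8.comul_x, map_comulGen, map_comulGen, map_comulGen, thetaToTensor_incl,
        thetaToTensor_incl, toTensor_g₁, toTensor_x]
      rfl
  exact DFunLike.congr_fun this a

theorem thetaToTensor_counit (a : (data q hq).Theta (character k)) :
    ((H4.data k).tensor (H8.data q hq)).counit (thetaToTensor q hq a)
      = ((data q hq).thetaData (character k) (g₂ k)).counit a := by
  have e : ∀ a b, ((H4.data k).tensor (H8.data q hq)).counit (a ⊗ₜ[k] b)
      = (H4.data k).counit a * (H8.data q hq).counit b := fun _ _ => rfl
  have e4 := (inferInstance : (H4.data k).IsMult).counit_one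
  have e8 := (inferInstance : (H8.data q hq).IsMult).counit_one
  have : ((H4.data k).tensor (H8.data q hq)).counitHom.comp (thetaToTensor q hq)
      = ((data q hq).thetaData (character k) (g₂ k)).counitHom := by
    refine theta_algHom_ext q hq ?_ ?_ ?_ ?_
    · rw [AlgHom.comp_apply, counitHom_apply, counitHom_apply, Theta.counit_theta, thetaToTensor_θ,
        e, H4.counit_x, zero_mul]
    · rw [AlgHom.comp_apply, counitHom_apply, counitHom_apply, Theta.counit_incl,
        thetaToTensor_incl, toTensor_g₁, e, counit_g₁, e4, H8.counit_g, mul_one]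
    · rw [AlgHom.comp_apply, counitHom_apply, counitHom_apply, Theta.counit_incl,
        thetaToTensor_incl, toTensor_g₂, e, counit_g₂, e8, H4.counit_g, mul_one]
    · rw [AlgHom.comp_apply, counitHom_apply, counitHom_apply, Theta.counit_incl,
        thetaToTensor_incl, toTensor_x, e, counit_x, H8.counit_x, mul_zero]
  exact DFunLike.congr_fun this a

/-- Both composites are anti-multiplicative and unital, so agreement on θ, g₁, g₂ and x is enough.
-/
theorem thetaToTensor_antipode (a : (data q hq).Theta (character k)) :
    ((H4.data k).tensor (H8.data q hq)).antipode (thetaToTensor q hq a)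
      = thetaToTensor q hq (((data q hq).thetaData (character k) (g₂ k)).antipode a) := by
  have e : ∀ a b, ((H4.data k).tensor (H8.data q hq)).antipode (a ⊗ₜ[k] b)
      = (H4.data k).antipode a ⊗ₜ[k] (H8.data q hq).antipode b := fun _ _ => rfl
  have e4 := H4.antipode_one k
  have e8 := H8.antipode_one q hq
  have hmul := tensor_antipode_mul (H4.data k) (H8.data q hq) (H4.antipode_mul k)
    (H8.antipode_mul q hq)
  refine antiHom_ext
    (f := ((H4.data k).tensor (H8.data q hq)).antipode ∘ₗ (thetaToTensor q hq).toLinearMap)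
    (f' := (thetaToTensor q hq).toLinearMap
      ∘ₗ ((data q hq).thetaData (character k) (g₂ k)).antipode)
    ?_ ?_ ?_ ?_ (Theta.adjoin_eq_top _ _ adjoin_eq_top) ?_ a
  · change ((H4.data k).tensor (H8.data q hq)).antipode (thetaToTensor q hq 1) = 1
    rw [map_one, Algebra.TensorProduct.one_def, e, e4, e8]
  · change thetaToTensor q hq (((data q hq).thetaData (character k) (g₂ k)).antipode 1) = 1
    rw [theta_antipode_one, map_one]
  · intro a b
    change ((H4.data k).tensor (H8.data q hq)).antipode (thetaToTensor q hq (a * b)) = _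
    rw [map_mul, hmul]
    rfl
  · intro a b
    change thetaToTensor q hq (((data q hq).thetaData (character k) (g₂ k)).antipode (a * b)) = _
    rw [theta_antipode_mul, map_mul]
    rfl
  · intro a ha
    change ((H4.data k).tensor (H8.data q hq)).antipode (thetaToTensor q hq a)
      = thetaToTensor q hq (((data q hq).thetaData (character k) (g₂ k)).antipode a)
    rcases ha with rfl | ⟨_, rfl | rfl | rfl, rfl⟩
    · rw [theta_antipode_theta, map_neg, map_mul, thetaToTensor_θ, thetaToTensor_incl,
        toTensor_g₂, e, e8, H4.antipode_x, Algebra.TensorProduct.tmul_mul_tmul, mul_one,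
        TensorProduct.neg_tmul]
    · rw [Theta.antipode_incl, thetaToTensor_incl, thetaToTensor_incl, antipode_g₁, toTensor_g₁,
        e, e4, H8.antipode_g]
    · rw [Theta.antipode_incl, thetaToTensor_incl, thetaToTensor_incl, antipode_g₂, toTensor_g₂,
        e, e8, H4.antipode_g]
    · rw [Theta.antipode_incl, thetaToTensor_incl, thetaToTensor_incl, antipode_x, toTensor_x,
        e, e4, H8.antipode_x, map_antipodeGen, toTensor_g₁, toTensor_x]
      exact map_antipodeGen (Algebra.TensorProduct.includeRight : H8 k →ₐ[k] H4 k ⊗[k] H8 k) _ _ _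

/-- `H_q(16)(θ) ≃ H₄ ⊗ H_q(8)`, as quasi-Hopf algebras. -/
def thetaQuasiHopfEquiv : QuasiHopfEquiv ((data q hq).thetaData (character k) (g₂ k))
    ((H4.data k).tensor (H8.data q hq)) where
  toAlgEquiv := thetaAlgEquiv q hq
  map_comul := thetaToTensor_comul q hq
  map_counit := thetaToTensor_counit q hq
  map_reassoc := by
    have h := (Theta.isSignTwisted (σ := character k) (g₂ k) (isSignTwisted q hq)).Phi_eq
    rw [h]
    refine Eq.trans ?_ (map_phiGen (thetaToTensor q hq) _).symm
    rw [thetaToTensor_incl, toTensor_g₁]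
    exact (tensor_Phi (H4.data k) (H8.data q hq) rfl).trans
      (map_phiGen (Algebra.TensorProduct.includeRight : H8 k →ₐ[k] H4 k ⊗[k] H8 k) (H8.g k))
  map_antipode := thetaToTensor_antipode q hq
  map_alpha := (thetaToTensor_incl q hq (g₁ k)).trans toTensor_g₁
  map_beta := map_one (thetaToTensor q hq)

end H16

end

section

/-! ### Braided Hopf algebras -/

namespace QuasiHopfData

variable {k : Type u} {H : Type v} [Field k] [Ring H] [Algebra k H]
variable {D : QuasiHopfData k H} {g : H}
variable {M N P : Type*} [AddCommGroup M] [Module k M] [AddCommGroup N] [Module k N]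
  [AddCommGroup P] [Module k P]

theorem braid_tmul {δ : M →ₗ[k] H ⊗[k] M} (ρ : H →ₗ[k] N →ₗ[k] N) {m m' : M} {h : H}
    (hm : δ m = h ⊗ₜ[k] m') (n : N) : braid δ ρ (m ⊗ₜ[k] n) = ρ h n ⊗ₜ[k] m' := by
  simp [braid, hm]

theorem regAct_apply (a b : H) : regAct k H a b = a * b := rfl

theorem regAct_one : regAct k H 1 = LinearMap.id := by
  ext a
  exact one_mul a

theorem tensorAct_one [hD : D.IsMult] {ρM : H →ₗ[k] M →ₗ[k] M} {ρN : H →ₗ[k] N →ₗ[k] N}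
    (hM : ρM 1 = LinearMap.id) (hN : ρN 1 = LinearMap.id) :
    D.tensorAct ρM ρN 1 = LinearMap.id := by
  rw [tensorAct, LinearMap.comp_apply, hD.comul_one, Algebra.TensorProduct.one_def,
    TensorProduct.map₂_apply_tmul, hM, hN, TensorProduct.map_id]

theorem tensorAct_of_comul_eq {ρM : H →ₗ[k] M →ₗ[k] M} {ρN : H →ₗ[k] N →ₗ[k] N} {h : H}
    (hh : D.comul h = h ⊗ₜ[k] h) (m : M) (n : N) :
    D.tensorAct ρM ρN h (m ⊗ₜ[k] n) = ρM h m ⊗ₜ[k] ρN h n := by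
  rw [tensorAct, LinearMap.comp_apply, hh, TensorProduct.map₂_apply_tmul, TensorProduct.map_tmul]

/-- Serves to read the right side of the coaction axiom as a product in the algebra H ⊗ H. -/
theorem tensorAct_reg_reg (h : H) (z : H ⊗[k] H) :
    D.tensorAct (regAct k H) (regAct k H) h z = D.comul h * z := by
  rw [tensorAct, LinearMap.comp_apply]
  generalize D.comul h = y
  induction y using TensorProduct.induction_on with
  | zero => simp
  | add y y' hy hy' => rw [map_add, LinearMap.add_apply, hy, hy', add_mul]
  | tmul a b =>
    rw [TensorProduct.map₂_apply_tmul]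
    induction z using TensorProduct.induction_on with
    | zero => simp
    | add z z' hz hz' => rw [map_add, hz, hz', mul_add]
    | tmul c d =>
      rw [TensorProduct.map_tmul, Algebra.TensorProduct.tmul_mul_tmul]
      rfl

namespace IsSignTwisted

theorem tensorAct_pMinus [hD : D.IsMult] (hg : D.IsSignTwisted g) (h2 : (2 : k) ≠ 0)
    {ρM : H →ₗ[k] M →ₗ[k] M} {ρN : H →ₗ[k] N →ₗ[k] N} (hM : ρM 1 = LinearMap.id)
    (hN : ρN 1 = LinearMap.id) (m : M) (n : N) :
    D.tensorAct ρM ρN (pMinus k g) (m ⊗ₜ[k] n) = ρM (pMinus k g) m ⊗ₜ[k] n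
      + m ⊗ₜ[k] ρN (pMinus k g) n
      - (2 : k) • ρM (pMinus k g) m ⊗ₜ[k] ρN (pMinus k g) n := by
  rw [tensorAct, LinearMap.comp_apply, hg.comul_pMinus h2]
  simp only [map_add, map_sub, map_smul, TensorProduct.map₂_apply_tmul, LinearMap.add_apply,
    LinearMap.sub_apply, LinearMap.smul_apply, TensorProduct.map_tmul, hM, hN, LinearMap.id_apply]

/-- The constraint differs from the plain rebracketing only where p₋ acts on all three factors, so
it is trivial once p₋ kills one of them. -/
theorem assocMap_tmul (hg : D.IsSignTwisted g) {ρM : H →ₗ[k] M →ₗ[k] M}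
    {ρN : H →ₗ[k] N →ₗ[k] N} {ρP : H →ₗ[k] P →ₗ[k] P} (hM : ρM 1 = LinearMap.id)
    (hN : ρN 1 = LinearMap.id) (hP : ρP 1 = LinearMap.id) (m : M) (n : N) (p : P) :
    D.assocMap ρM ρN ρP ((m ⊗ₜ[k] n) ⊗ₜ[k] p) = m ⊗ₜ[k] (n ⊗ₜ[k] p)
      - (2 : k) • ρM (pMinus k g) m ⊗ₜ[k] (ρN (pMinus k g) n ⊗ₜ[k] ρP (pMinus k g) p) := by
  rw [assocMap, hg.Phi_eq, phiGen]
  simp only [Algebra.TensorProduct.one_def, LinearMap.comp_apply, LinearEquiv.coe_coe,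
    TensorProduct.assoc_tmul, map_sub, map_smul, TensorProduct.map₂_apply_tmul,
    LinearMap.sub_apply, LinearMap.smul_apply, TensorProduct.map_tmul, hM, hN, hP,
    LinearMap.id_apply]

theorem assocInvMap_tmul (hg : D.IsSignTwisted g) (h2 : (2 : k) ≠ 0) {ρM : H →ₗ[k] M →ₗ[k] M}
    {ρN : H →ₗ[k] N →ₗ[k] N} {ρP : H →ₗ[k] P →ₗ[k] P} (hM : ρM 1 = LinearMap.id)
    (hN : ρN 1 = LinearMap.id) (hP : ρP 1 = LinearMap.id) (m : M) (n : N) (p : P) :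
    D.assocInvMap ρM ρN ρP (m ⊗ₜ[k] (n ⊗ₜ[k] p)) = (m ⊗ₜ[k] n) ⊗ₜ[k] p
      - (2 : k) • (ρM (pMinus k g) m ⊗ₜ[k] ρN (pMinus k g) n) ⊗ₜ[k] ρP (pMinus k g) p := by
  rw [assocInvMap, hg.PhiInv_eq h2, phiGen]
  simp only [Algebra.TensorProduct.one_def, LinearMap.comp_apply, LinearEquiv.coe_coe,
    map_sub, map_smul, TensorProduct.map₂_apply_tmul,
    LinearMap.sub_apply, LinearMap.smul_apply, TensorProduct.map_tmul, hM, hN, hP,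
    LinearMap.id_apply, TensorProduct.assoc_symm_tmul]

end IsSignTwisted

/-! #### The trivial action -/

section Trivial

/-- The action through the counit. -/
def trivAct (D : QuasiHopfData k H) (M : Type*) [AddCommGroup M] [Module k M] :
    H →ₗ[k] M →ₗ[k] M := D.counit.smulRight LinearMap.id

theorem trivAct_apply (h : H) (m : M) : D.trivAct M h m = D.counit h • m := rfl

theorem trivAct_one [hD : D.IsMult] : D.trivAct M 1 = LinearMap.id := by
  ext m
  rw [trivAct_apply, hD.counit_one, one_smul, LinearMap.id_apply]

variable [hD : D.IsMult] (hg : D.IsSignTwisted g) (h2 : (2 : k) ≠ 0)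

include hg in
theorem trivAct_pMinus (m : M) : D.trivAct M (pMinus k g) m = 0 := by
  rw [trivAct_apply, hg.counit_pMinus, zero_smul]

omit hD in
theorem tensorAct_reg_triv (h : H)
    (hh : TensorProduct.rid k H (D.counit.lTensor H (D.comul h)) = h) (m : M) :
    D.tensorAct (regAct k H) (D.trivAct M) h (1 ⊗ₜ[k] m) = h ⊗ₜ[k] m := by
  conv_rhs => rw [← hh]
  rw [tensorAct, LinearMap.comp_apply]
  generalize D.comul h = y
  induction y using TensorProduct.induction_on with
  | zero => simp
  | add y y' hy hy' => simp only [map_add, LinearMap.add_apply, hy, hy', TensorProduct.add_tmul]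
  | tmul a b =>
    simp only [TensorProduct.map₂_apply_tmul, TensorProduct.map_tmul, regAct_apply, mul_one,
      trivAct_apply, LinearMap.lTensor_tmul, TensorProduct.rid_tmul, TensorProduct.tmul_smul,
      TensorProduct.smul_tmul']

omit hD in
theorem tensorAct_triv_left (ρ : H →ₗ[k] N →ₗ[k] N) (h : H)
    (hh : TensorProduct.lid k H (D.counit.rTensor H (D.comul h)) = h) (m : M) (n : N) :
    D.tensorAct (D.trivAct M) ρ h (m ⊗ₜ[k] n) = m ⊗ₜ[k] ρ h n := by
  conv_rhs => rw [← hh]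
  rw [tensorAct, LinearMap.comp_apply]
  generalize D.comul h = y
  induction y using TensorProduct.induction_on with
  | zero => simp
  | add y y' hy hy' => simp only [map_add, LinearMap.add_apply, hy, hy', TensorProduct.tmul_add]
  | tmul a b =>
    simp only [TensorProduct.map₂_apply_tmul, TensorProduct.map_tmul, map_smul,
      trivAct_apply, LinearMap.rTensor_tmul, TensorProduct.lid_tmul, TensorProduct.tmul_smul,
      TensorProduct.smul_tmul', LinearMap.smul_apply]

omit hD in
theorem tensorAct_triv_triv (h : H)
    (hh : TensorProduct.lid k H (D.counit.rTensor H (D.comul h)) = h) (z : M ⊗[k] N) :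
    D.tensorAct (D.trivAct M) (D.trivAct N) h z = D.counit h • z := by
  induction z using TensorProduct.induction_on with
  | zero => simp
  | add z z' hz hz' => rw [map_add, hz, hz', smul_add]
  | tmul m n =>
    rw [D.tensorAct_triv_left _ h hh, trivAct_apply, TensorProduct.tmul_smul]

end Trivial

end QuasiHopfData

/-! ### Braided structures with the trivial action -/

namespace BraidedHopfData

open QuasiHopfData

variable {k : Type u} {H : Type v} [Field k] [Ring H] [Algebra k H] {B : Type w}
variable {D : QuasiHopfData k H} [hD : D.IsMult] {g : H}

section TrivialAction

variable [AddCommGroup B] [Module k B] {X : BraidedHopfData k H B}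
  (hg : D.IsSignTwisted g) (h2 : (2 : k) ≠ 0) (hX : X.act = D.trivAct B)

include hg hX in
theorem assocMap_triv (a b c : B) :
    D.assocMap X.act X.act X.act ((a ⊗ₜ[k] b) ⊗ₜ[k] c) = a ⊗ₜ[k] (b ⊗ₜ[k] c) := by
  rw [hX, hg.assocMap_tmul trivAct_one trivAct_one trivAct_one, trivAct_pMinus hg,
    TensorProduct.zero_tmul, smul_zero, sub_zero]

include hg h2 hX in
/-- For the trivial action, the multiplication of `B ⊗ B` is the usual one on tensors whose inner
factors are interchanged by the braiding. -/
theorem tensorMul_triv {a b c d : B}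
    (hbc : braid X.coact X.act (b ⊗ₜ[k] c) = c ⊗ₜ[k] b) :
    tensorMul D X ((a ⊗ₜ[k] b) ⊗ₜ[k] (c ⊗ₜ[k] d))
      = X.mul (a ⊗ₜ[k] c) ⊗ₜ[k] X.mul (b ⊗ₜ[k] d) := by
  have h1 : X.act 1 = LinearMap.id := hX ▸ trivAct_one
  have h0 : ∀ z, X.act (pMinus k g) z = 0 := fun z => hX ▸ trivAct_pMinus hg z
  have h1' := tensorAct_one (D := D) h1 h1
  simp only [tensorMul, LinearMap.comp_apply, hg.assocMap_tmul h1 h1 h1', h0,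
    TensorProduct.zero_tmul, smul_zero, sub_zero, LinearMap.lTensor_tmul,
    hg.assocInvMap_tmul h2 h1 h1 h1, LinearMap.rTensor_tmul, hbc, hg.assocMap_tmul h1 h1 h1,
    hg.assocInvMap_tmul h2 h1 h1 h1', TensorProduct.map_tmul]

include hg h2 hX in
/-- The coaction on `B ⊗ B`, for the trivial action. -/
theorem tensorYD_coact_triv {a b : B} {s t : H} (ha : X.coact a = s ⊗ₜ[k] a)
    (hb : X.coact b = t ⊗ₜ[k] b) :
    (D.tensorYD X.toYDData X.toYDData).coact (a ⊗ₜ[k] b)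
      = (s * t) ⊗ₜ[k] (a ⊗ₜ[k] b) := by
  have h1 : X.act 1 = LinearMap.id := hX ▸ trivAct_one
  have h0 : ∀ z, X.act (pMinus k g) z = 0 := fun z => hX ▸ trivAct_pMinus hg z
  simp only [tensorYD, LinearMap.comp_apply, LinearMap.flip_apply, TensorProduct.mk_apply,
    hg.assocMap_tmul h1 h1 regAct_one, hg.assocMap_tmul regAct_one h1 h1,
    hg.assocInvMap_tmul h2 h1 regAct_one h1, h0, TensorProduct.zero_tmul, TensorProduct.tmul_zero,
    smul_zero, sub_zero, LinearMap.lTensor_tmul, LinearMap.rTensor_tmul,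
    braid_tmul _ ha, braid_tmul _ hb, regAct_apply, mul_one]

-- Together with `coact_coassoc_triv_right`, this turns the coaction axiom at b into Δ(s) = s ⊗ s,
-- since p₋ acts on b by ε(p₋) = 0.
include hg hX in
theorem coact_coassoc_triv_left {b : B} {s : H} (hb : X.coact b = s ⊗ₜ[k] b) :
    (braid X.coact (regAct k H)).lTensor H
        (D.assocMap (regAct k H) X.act (regAct k H)
          ((braid X.coact (regAct k H)).rTensor H ((b ⊗ₜ[k] (1 : H)) ⊗ₜ[k] (1 : H))))
      = s ⊗ₜ[k] (s ⊗ₜ[k] b) := by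
  have h1 : X.act 1 = LinearMap.id := hX ▸ trivAct_one
  have h0 : ∀ z, X.act (pMinus k g) z = 0 := fun z => hX ▸ trivAct_pMinus hg z
  simp only [LinearMap.rTensor_tmul, braid_tmul _ hb, regAct_apply, mul_one,
    hg.assocMap_tmul regAct_one h1 regAct_one, h0, TensorProduct.zero_tmul,
    TensorProduct.tmul_zero, smul_zero, sub_zero, LinearMap.lTensor_tmul]

include hg hX in
theorem coact_coassoc_triv_right {b : B} {s : H} (hb : X.coact b = s ⊗ₜ[k] b) :
    D.assocMap (regAct k H) (regAct k H) X.act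
          (braid X.coact (D.tensorAct (regAct k H) (regAct k H))
            (D.assocMap X.act (regAct k H) (regAct k H) ((b ⊗ₜ[k] (1 : H)) ⊗ₜ[k] (1 : H))))
      = TensorProduct.assoc k H H B (D.comul s ⊗ₜ[k] b) := by
  have h1 : X.act 1 = LinearMap.id := hX ▸ trivAct_one
  have h0 : ∀ z, X.act (pMinus k g) z = 0 := fun z => hX ▸ trivAct_pMinus hg z
  rw [hg.assocMap_tmul h1 regAct_one regAct_one, h0, TensorProduct.zero_tmul, smul_zero, sub_zero,
    braid_tmul _ hb, tensorAct_reg_reg, ← Algebra.TensorProduct.one_def, mul_one]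
  generalize D.comul s = z
  induction z using TensorProduct.induction_on with
  | zero => simp
  | add z z' hz hz' => rw [TensorProduct.add_tmul, map_add, map_add, hz, hz']
  | tmul c d =>
    rw [hg.assocMap_tmul regAct_one regAct_one h1, h0, TensorProduct.tmul_zero,
      TensorProduct.tmul_zero, smul_zero, sub_zero, TensorProduct.assoc_tmul]

end TrivialAction

/-- An ordinary Hopf algebra, with the trivial action and coaction, is a Hopf algebra in the
category of Yetter-Drinfeld modules. -/
theorem trivial_isBraidedHopf [Ring B] [HopfAlgebra k B] (hQ : D.IsQuasiHopf)
    (hg : D.IsSignTwisted g) (h2 : (2 : k) ≠ 0) : (trivial D B).IsBraidedHopf D := by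
  have hX : (trivial D B).act = D.trivAct B := rfl
  have hact : ∀ h b, (trivial D B).act h b = D.counit h • b := fun _ _ => rfl
  have hδ : ∀ b, (trivial D B).coact b = 1 ⊗ₜ[k] b := fun _ => rfl
  have h1 : (trivial D B).act 1 = LinearMap.id := trivAct_one
  have hYD : ∀ z, (D.tensorYD (trivial D B).toYDData (trivial D B).toYDData).coact z
      = 1 ⊗ₜ[k] z := by
    intro z
    induction z using TensorProduct.induction_on with
    | zero => simp
    | add z z' hz hz' => rw [map_add, hz, hz', TensorProduct.tmul_add]
    | tmul a b => rw [tensorYD_coact_triv hg h2 hX (hδ a) (hδ b), one_mul]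
  -- The trivial coaction makes the braiding the flip, so B ⊗ B carries its usual multiplication.
  have hbraid : ∀ b c, braid (trivial D B).coact (trivial D B).act (b ⊗ₜ[k] c) = c ⊗ₜ[k] b := by
    intro b c
    rw [braid_tmul _ (hδ b), h1, LinearMap.id_apply]
  have hmul : ∀ a b, (trivial D B).mul (a ⊗ₜ[k] b) = a * b := fun _ _ => rfl
  have htmul : ∀ z z' : B ⊗[k] B, tensorMul D (trivial D B) (z ⊗ₜ[k] z') = z * z' := by
    intro z z'
    induction z using TensorProduct.induction_on with
    | zero => simp
    | add z z' hz hz' => rw [TensorProduct.add_tmul, map_add, hz, hz', add_mul]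
    | tmul a b =>
      induction z' using TensorProduct.induction_on with
      | zero => simp
      | add z z' hz hz' => rw [TensorProduct.tmul_add, map_add, hz, hz', mul_add]
      | tmul c d =>
        rw [tensorMul_triv hg h2 hX (hbraid b c), hmul, hmul, Algebra.TensorProduct.tmul_mul_tmul]
  have htact : ∀ h (z : B ⊗[k] B), D.tensorAct (trivial D B).act (trivial D B).act h z
      = D.counit h • z := fun h z => tensorAct_triv_triv h (hQ.rTensor_counit h) z
  have hassoc : D.assocMap (trivial D B).act (trivial D B).act (trivial D B).act
      = (TensorProduct.assoc k B B B).toLinearMap := by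
    refine TensorProduct.ext_threefold fun a b c => ?_
    rw [assocMap_triv hg hX]
    rfl
  exact
    { act_one := h1
      act_mul := fun a b => by
        ext c
        rw [LinearMap.comp_apply, hact, hact, hact, hD.counit_mul, smul_smul]
      coact_counit := fun b => by
        rw [hδ, LinearMap.rTensor_tmul, TensorProduct.lid_tmul, hD.counit_one, one_smul]
      coact_coassoc := fun b => by
        rw [coact_coassoc_triv_left hg hX (hδ b), coact_coassoc_triv_right hg hX (hδ b),
          hD.comul_one, Algebra.TensorProduct.one_def, TensorProduct.assoc_tmul]
      act_coact := fun h b => by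
        rw [hδ, hX, tensorAct_reg_triv h (hQ.lTensor_counit h),
          tensorAct_triv_left _ h (hQ.rTensor_counit h), braid_tmul _ (hδ b), regAct_apply,
          regAct_apply, one_mul, mul_one]
      one_mul := fun b => one_mul b
      mul_one := fun b => mul_one b
      mul_act := fun h z => by rw [hact, htact, map_smul]
      one_act := fun h => hact h 1
      mul_assoc := by
        rw [hassoc]
        refine TensorProduct.ext_threefold fun a b c => ?_
        exact mul_assoc a b c
      mul_coact := fun z => by rw [hYD, hδ, LinearMap.lTensor_tmul]
      one_coact := hδ 1
      comul_act := fun h b => by rw [hact, htact, map_smul]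
      counit_act := fun h b => by rw [hact, map_smul, smul_eq_mul]
      counit_comul := fun b => by
        change TensorProduct.lid k B (Coalgebra.counit.rTensor B (Coalgebra.comul b)) = b
        rw [Coalgebra.rTensor_counit_comul, TensorProduct.lid_tmul, one_smul]
      comul_counit := fun b => by
        change TensorProduct.rid k B (Coalgebra.counit.lTensor B (Coalgebra.comul b)) = b
        rw [Coalgebra.lTensor_counit_comul, TensorProduct.rid_tmul, one_smul]
      comul_coassoc := fun b => by
        rw [hassoc]
        exact Coalgebra.coassoc_apply b
      comul_coact := fun b => by rw [hYD, hδ, LinearMap.lTensor_tmul]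
      counit_coact := fun b => by
        rw [hδ, LinearMap.lTensor_tmul, TensorProduct.rid_tmul]
      comul_one := Bialgebra.comul_one
      counit_one := Bialgebra.counit_one
      counit_mul := Bialgebra.counit_mul
      comul_mul := fun a b => by
        rw [htmul]
        exact Bialgebra.comul_mul a b
      antipode_act := fun h b => by rw [hact, hact, map_smul]
      antipode_coact := fun b => by rw [hδ, hδ, LinearMap.lTensor_tmul]
      antipode_left := fun b =>
        (HopfAlgebra.mul_antipode_rTensor_comul_apply b).trans (Algebra.algebraMap_eq_smul_one _)
      antipode_right := fun b =>
        (HopfAlgebra.mul_antipode_lTensor_comul_apply b).trans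
          (Algebra.algebraMap_eq_smul_one _) }

end BraidedHopfData

end

section

/-! ### Braided Hopf algebras of rank two -/

namespace BraidedHopfData

open QuasiHopfData

variable {k : Type u} {H : Type v} [Field k] [Ring H] [Algebra k H] {B : Type w}
  [AddCommGroup B] [Module k B]

/-- The vectors `1` and `b` form a basis of `B`, with dual basis `ε`, `β`, and the structure maps
of `X` are given on `b` by a character `χ` of `H`, an element `s` of `H` and scalars `l`, `m`. -/
structure IsRankTwo (D : QuasiHopfData k H) (X : BraidedHopfData k H B) (b : B) (β : B →ₗ[k] k)
    (χ : H →ₐ[k] k) (s : H) (l m : k) : Prop where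
  counit_gen : X.counit b = 0
  coord_gen : β b = 1
  coord_one : β X.one = 0
  eq_add : ∀ z, z = X.counit z • X.one + β z • b
  act_gen : ∀ h, X.act h b = χ h • b
  coact_gen : X.coact b = s ⊗ₜ[k] b
  counit_coeff : D.counit s = 1
  mul_gen : X.mul (b ⊗ₜ[k] b) = l • b
  comul_gen : X.comul b = b ⊗ₜ[k] X.one + X.one ⊗ₜ[k] b + m • b ⊗ₜ[k] b

variable {D : QuasiHopfData k H} {X : BraidedHopfData k H B}

/-- As ε(1) = 1, the kernel of ε is a line complementary to that of 1, spanned by b. The functional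
β is one with value 1 at b, corrected by a multiple of ε so as to vanish at 1. -/
theorem exists_basis (hX : X.IsBraidedHopf D) (hB : Module.finrank k B = 2) :
    ∃ (b : B) (β : B →ₗ[k] k), X.counit b = 0 ∧ β b = 1 ∧ β X.one = 0 ∧
      ∀ z, z = X.counit z • X.one + β z • b := by
  have : Module.Finite k B := Module.finite_of_finrank_pos (by omega)
  have hsurj : LinearMap.range X.counit = ⊤ := by
    refine LinearMap.range_eq_top.mpr fun c => ⟨c • X.one, ?_⟩
    rw [map_smul, hX.counit_one, smul_eq_mul, _root_.mul_one]
  have hker : Module.finrank k (LinearMap.ker X.counit) = 1 := by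
    have := LinearMap.finrank_range_add_finrank_ker X.counit
    rw [hsurj, finrank_top, Module.finrank_self] at this
    omega
  obtain ⟨⟨b, hb⟩, hb0, hspan⟩ := finrank_eq_one_iff'.mp hker
  have hb0' : b ≠ 0 := fun h => hb0 (Subtype.ext h)
  obtain ⟨f, hf⟩ : ∃ f : B →ₗ[k] k, f b = 1 := by
    obtain ⟨f, hf⟩ : ∃ f : Module.Dual k B, f b ≠ 0 := by
      by_contra! hf
      exact hb0' ((Module.forall_dual_apply_eq_zero_iff k b).mp hf)
    refine ⟨(f b)⁻¹ • f, ?_⟩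
    rw [LinearMap.smul_apply, smul_eq_mul, inv_mul_cancel₀ hf]
  have hb' : X.counit b = 0 := hb
  have h1 := hX.counit_one
  refine ⟨b, f - f X.one • X.counit, hb', ?_, ?_, fun z => ?_⟩
  · simp [hf, hb']
  · simp [h1]
  · obtain ⟨c, hc⟩ := hspan ⟨z - X.counit z • X.one, by simp [h1]⟩
    have hc' : c • b = z - X.counit z • X.one := congrArg Subtype.val hc
    have hz : z = X.counit z • X.one + c • b := by rw [hc']; abel
    have hfz : f z = X.counit z * f X.one + c := by
      conv_lhs => rw [hz]
      simp [hf]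
    have hcz : (f - f X.one • X.counit) z = c := by
      rw [LinearMap.sub_apply, LinearMap.smul_apply, hfz, smul_eq_mul]
      ring
    rw [hcz]
    exact hz

/-- The action, coaction and multiplication are compatible with ε and therefore respect its kernel,
the line of b; this yields χ, s and l. In Δ(b) the counit axioms fix every coefficient except that
of b ⊗ b. -/
theorem exists_isRankTwo (hX : X.IsBraidedHopf D) (hB : Module.finrank k B = 2) :
    ∃ (b : B) (β : B →ₗ[k] k) (χ : H →ₐ[k] k) (s : H) (l m : k), IsRankTwo D X b β χ s l m := by
  obtain ⟨b, β, hb, hβ, hβ1, hz⟩ := exists_basis hX hB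
  have hker : ∀ z, X.counit z = 0 → z = β z • b := fun z h => by
    conv_lhs => rw [hz z, h, zero_smul, zero_add]
  have hact : ∀ h, X.act h b = β (X.act h b) • b := fun h =>
    hker _ (by rw [hX.counit_act, hb, mul_zero])
  let χ : H →ₐ[k] k := AlgHom.ofLinearMap (β ∘ₗ X.act.flip b)
    (by
      change β (X.act 1 b) = 1
      rw [hX.act_one, LinearMap.id_apply, hβ])
    (fun a c => by
      change β (X.act (a * c) b) = β (X.act a b) * β (X.act c b)
      rw [hX.act_mul, LinearMap.comp_apply]
      conv_lhs => rw [hact c, map_smul, hact a]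
      rw [map_smul, map_smul, hβ, smul_eq_mul, smul_eq_mul, _root_.mul_one, mul_comm])
  have hHB : ∀ t : H ⊗[k] B, t = TensorProduct.rid k H (X.counit.lTensor H t) ⊗ₜ[k] X.one
      + TensorProduct.rid k H (β.lTensor H t) ⊗ₜ[k] b := by
    intro t
    induction t using TensorProduct.induction_on with
    | zero => simp
    | add t t' ht ht' =>
      simp only [map_add, TensorProduct.add_tmul]
      nth_rw 1 [ht, ht']
      abel
    | tmul h z =>
      nth_rw 1 [hz z]
      simp only [LinearMap.lTensor_tmul, TensorProduct.rid_tmul, TensorProduct.tmul_add,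
        TensorProduct.tmul_smul, TensorProduct.smul_tmul']
  have hBB : ∀ t : B ⊗[k] B, t = X.one ⊗ₜ[k] TensorProduct.lid k B (X.counit.rTensor B t)
      + b ⊗ₜ[k] TensorProduct.lid k B (β.rTensor B t) := by
    intro t
    induction t using TensorProduct.induction_on with
    | zero => simp
    | add t t' ht ht' =>
      simp only [map_add, TensorProduct.tmul_add]
      nth_rw 1 [ht, ht']
      abel
    | tmul z y =>
      nth_rw 1 [hz z]
      simp only [LinearMap.rTensor_tmul, TensorProduct.lid_tmul, TensorProduct.add_tmul,
        TensorProduct.tmul_smul, TensorProduct.smul_tmul']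
  have hcoact : X.coact b = TensorProduct.rid k H (β.lTensor H (X.coact b)) ⊗ₜ[k] b := by
    conv_lhs => rw [hHB (X.coact b), hX.counit_coact, hb, zero_smul, TensorProduct.zero_tmul,
      zero_add]
  have hcomul := hBB (X.comul b)
  rw [hX.counit_comul] at hcomul
  set w := TensorProduct.lid k B (β.rTensor B (X.comul b))
  -- So w = 1 + m b, where Δ(b) = 1 ⊗ b + b ⊗ w.
  have hw : X.counit w = 1 := by
    have := congrArg β (hX.comul_counit b)
    rw [hcomul, map_add, map_add, LinearMap.lTensor_tmul, LinearMap.lTensor_tmul,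
      TensorProduct.rid_tmul, TensorProduct.rid_tmul, hb, zero_smul, zero_add, map_smul, hβ,
      smul_eq_mul, _root_.mul_one] at this
    exact this
  refine ⟨b, β, χ, _, β (X.mul (b ⊗ₜ[k] b)), β w, hb, hβ, hβ1, hz, hact, hcoact, ?_, ?_, ?_⟩
  · have := congrArg β (hX.coact_counit b)
    rw [hcoact, LinearMap.rTensor_tmul, TensorProduct.lid_tmul, map_smul, hβ, smul_eq_mul,
      _root_.mul_one] at this
    exact this
  · exact hker _ (by rw [hX.counit_mul, hb, mul_zero])
  · rw [hcomul]
    nth_rw 1 [hz w]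
    rw [hw, one_smul, TensorProduct.tmul_add, TensorProduct.tmul_smul]
    abel

/-! ### The two possible characters of a braided Hopf algebra of rank two -/

namespace IsRankTwo

variable [hD : D.IsMult] {g : H} {b : B} {β : B →ₗ[k] k} {χ : H →ₐ[k] k} {s : H} {l m : k}

/-- The character of a braided Hopf algebra of rank two does not map `g` to `-1`. -/
theorem apply_ne_neg_one (hg : D.IsSignTwisted g) (h2 : (2 : k) ≠ 0) (hX : X.IsBraidedHopf D)
    (h : IsRankTwo D X b β χ s l m) (hχ : χ g = -1)
    (hχχ : ∀ a, tensorSq χ (D.comul a) = D.counit a) : False := by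
  have h1 := hX.act_one
  have h1' := tensorAct_one (D := D) h1 h1
  have hχM : χ (pMinus k g) = 1 := by rw [map_pMinus, hχ, pMinus_neg_one h2]
  have hMb : X.act (pMinus k g) b = b := by rw [h.act_gen, hχM, one_smul]
  have hMe : X.act (pMinus k g) X.one = 0 := by rw [hX.one_act, hg.counit_pMinus, zero_smul]
  have hgb : X.act g b = -b := by rw [h.act_gen, hχ, neg_smul, one_smul]
  have hge : X.act g X.one = X.one := by rw [hX.one_act, hg.counit_eq, one_smul]
  -- The element g acts on b by −1, hence on b b by 1, while b b = l b.
  have hl : l = 0 := by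
    have := congrArg β (hX.mul_act g (b ⊗ₜ[k] b))
    rw [tensorAct_of_comul_eq hg.comul_eq, hgb, TensorProduct.neg_tmul, TensorProduct.tmul_neg,
      neg_neg, h.mul_gen, map_smul, hgb, smul_neg, map_neg, map_smul, h.coord_gen,
      smul_eq_mul, _root_.mul_one] at this
    exact (mul_eq_zero.mp (show 2 * l = 0 by linear_combination -this)).resolve_left h2
  -- The same parity argument, for the coefficient of b ⊗ b in Δ(b).
  have hm : m = 0 := by
    have := congrArg (fun z => TensorProduct.lid k k (TensorProduct.map β β z))
      (hX.comul_act g b)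
    simp only [hgb, map_neg, h.comul_gen, map_add, map_smul, tensorAct_of_comul_eq hg.comul_eq,
      hge, TensorProduct.map_tmul, TensorProduct.lid_tmul, h.coord_gen, h.coord_one, smul_eq_mul,
      mul_zero, _root_.mul_one, zero_add, neg_zero, mul_neg, neg_neg] at this
    exact (mul_eq_zero.mp (show 2 * m = 0 by linear_combination -this)).resolve_left h2
  have hbraid_one : ∀ z, braid X.coact X.act (X.one ⊗ₜ[k] z) = z ⊗ₜ[k] X.one := fun z => by
    rw [braid_tmul _ hX.one_coact, h1, LinearMap.id_apply]
  have hbe : braid X.coact X.act (b ⊗ₜ[k] X.one) = X.one ⊗ₜ[k] b := by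
    rw [braid_tmul _ h.coact_gen, hX.one_act, h.counit_coeff, one_smul]
  have hbb : braid X.coact X.act (b ⊗ₜ[k] b) = χ s • b ⊗ₜ[k] b := by
    rw [braid_tmul _ h.coact_gen, h.act_gen, TensorProduct.smul_tmul']
  -- Compare the coefficients of b ⊗ b in 0 = Δ(b b) = (b ⊗ 1 + 1 ⊗ b)²: the square gives 1 + χ(s),
  -- where χ(s) comes from the braiding of b with b. The constraints are trivial here, each meeting
  -- a slot made of copies of 1 only, on which p₋ acts by zero.
  have hs : χ s = -1 := by
    have := hX.comul_mul b b
    rw [h.mul_gen, hl, zero_smul, map_zero, h.comul_gen, hm, zero_smul, add_zero] at this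
    simp only [TensorProduct.add_tmul, TensorProduct.tmul_add, map_add, tensorMul,
      LinearMap.comp_apply, hg.assocMap_tmul h1 h1 h1', hMe, hMb, TensorProduct.zero_tmul,
      TensorProduct.tmul_zero, smul_zero, sub_zero, LinearMap.lTensor_tmul,
      hg.assocInvMap_tmul h2 h1 h1 h1, LinearMap.rTensor_tmul, hbraid_one, hbe, hbb,
      hg.assocMap_tmul h1 h1 h1, hg.assocInvMap_tmul h2 h1 h1 h1', TensorProduct.map_tmul,
      hg.tensorAct_pMinus h2 h1 h1, map_smul, TensorProduct.tmul_smul,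
      ← TensorProduct.smul_tmul', add_zero, zero_add,
      h.mul_gen, hl, zero_smul, hX.one_mul, hX.mul_one] at this
    have := congrArg (fun z => TensorProduct.lid k k (TensorProduct.map β β z)) this
    simp only [map_add, map_smul, map_zero, TensorProduct.map_tmul, TensorProduct.lid_tmul,
      h.coord_gen, smul_eq_mul, _root_.mul_one] at this
    linear_combination -this
  let L : H ⊗[k] (H ⊗[k] B) →ₗ[k] k := (TensorProduct.lid k k).toLinearMap ∘ₗ
    TensorProduct.map χ.toLinearMap
      ((TensorProduct.lid k k).toLinearMap ∘ₗ TensorProduct.map χ.toLinearMap β)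
  have hL : ∀ a c z, L (a ⊗ₜ[k] (c ⊗ₜ[k] z)) = χ a * (χ c * β z) := fun _ _ _ => rfl
  have hR : ∀ z : H ⊗[k] H, L (D.assocMap (regAct k H) (regAct k H) X.act (z ⊗ₜ[k] b))
      = -tensorSq χ z := by
    intro z
    induction z using TensorProduct.induction_on with
    | zero => simp
    | add z z' hz hz' => rw [TensorProduct.add_tmul, map_add, map_add, hz, hz', map_add, neg_add]
    | tmul a c =>
      rw [hg.assocMap_tmul regAct_one regAct_one h1, map_sub, map_smul, hL, hL, hMb, regAct_apply,
        regAct_apply, map_mul, map_mul, hχM, h.coord_gen, tensorSq_tmul, smul_eq_mul]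
      ring
  -- Under L = χ ⊗ χ ⊗ β each constraint is a sign −1. The left side passes one constraint and gives
  -- −χ(s)² = −1; the right side passes two and gives (χ ⊗ χ)(Δ(s)) = ε(s) = 1.
  have key := congrArg L (hX.coact_coassoc b)
  rw [LinearMap.rTensor_tmul, braid_tmul _ h.coact_gen, hg.assocMap_tmul regAct_one h1 regAct_one,
    hg.assocMap_tmul h1 regAct_one regAct_one] at key
  simp only [hMb, map_sub, map_smul, LinearMap.lTensor_tmul, braid_tmul _ h.coact_gen,
    regAct_apply, _root_.mul_one, hL, tensorAct_reg_reg, hR, map_mul, hχM, hs, hχχ,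
    h.counit_coeff, tensorSq_tmul, map_one, h.coord_gen, smul_eq_mul] at key
  exact h2 (by linear_combination -key)

section Trivial

variable (hQ : D.IsQuasiHopf) (hg : D.IsSignTwisted g) (h2 : (2 : k) ≠ 0)
  (hX : X.IsBraidedHopf D) (h : IsRankTwo D X b β D.counitHom s l m)

include hX h in
theorem act_eq_trivAct : X.act = D.trivAct B := by
  ext a z
  rw [trivAct_apply, h.eq_add z, map_add, map_smul, map_smul, hX.one_act, h.act_gen, smul_add,
    smul_comm, counitHom_apply, smul_comm (β z)]

-- The braiding is the flip on 1 and b. The coefficient of b ⊗ b is lm in Δ(b b) and 2 + 4lm + (lm)²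
-- in Δ(b)Δ(b).
include hg h2 hX h in
theorem mul_self_add : (l * m) ^ 2 + 3 * (l * m) + 2 = 0 := by
  have ht := h.act_eq_trivAct hX
  have h1 := hX.act_one
  have hee : braid X.coact X.act (X.one ⊗ₜ[k] X.one) = X.one ⊗ₜ[k] X.one := by
    rw [braid_tmul _ hX.one_coact, h1, LinearMap.id_apply]
  have heb : braid X.coact X.act (X.one ⊗ₜ[k] b) = b ⊗ₜ[k] X.one := by
    rw [braid_tmul _ hX.one_coact, h1, LinearMap.id_apply]
  have hbe : braid X.coact X.act (b ⊗ₜ[k] X.one) = X.one ⊗ₜ[k] b := by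
    rw [braid_tmul _ h.coact_gen, hX.one_act, h.counit_coeff, one_smul]
  have hbb : braid X.coact X.act (b ⊗ₜ[k] b) = b ⊗ₜ[k] b := by
    rw [braid_tmul _ h.coact_gen, ht, trivAct_apply, h.counit_coeff, one_smul]
  have := congrArg (fun z => TensorProduct.lid k k (TensorProduct.map β β z)) (hX.comul_mul b b)
  simp only [h.mul_gen, map_smul, h.comul_gen, TensorProduct.add_tmul, TensorProduct.tmul_add,
    map_add, TensorProduct.tmul_smul, ← TensorProduct.smul_tmul',
    tensorMul_triv hg h2 ht hee, tensorMul_triv hg h2 ht heb, tensorMul_triv hg h2 ht hbe,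
    tensorMul_triv hg h2 ht hbb, hX.one_mul, hX.mul_one, TensorProduct.map_tmul,
    TensorProduct.lid_tmul, h.coord_gen, h.coord_one, smul_eq_mul, _root_.mul_one, mul_zero,
    zero_add, add_zero] at this
  linear_combination -this

-- The coaction axiom makes s group-like, and compatibility of the coaction with b b = l b makes it
-- idempotent because l ≠ 0. The antipode axiom S(s) α s = α then makes it cancellable.
include hQ hg h2 hX h in
theorem coeff_eq_one (hl : l ≠ 0) : s = 1 := by
  have ht := h.act_eq_trivAct hX
  have hcancel : ∀ {a c : H}, a ⊗ₜ[k] b = c ⊗ₜ[k] b → a = c := fun {a c} hac => by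
    have := congrArg (fun z => TensorProduct.rid k H (β.lTensor H z)) hac
    simpa only [LinearMap.lTensor_tmul, TensorProduct.rid_tmul, h.coord_gen, one_smul] using this
  have hΔ : D.comul s = s ⊗ₜ[k] s := by
    have e := hX.coact_coassoc b
    rw [coact_coassoc_triv_left hg ht h.coact_gen, coact_coassoc_triv_right hg ht h.coact_gen]
      at e
    have e' := congrArg (TensorProduct.assoc k H H B).symm e
    rw [LinearEquiv.symm_apply_apply, TensorProduct.assoc_symm_tmul] at e'
    have := congrArg (fun z => TensorProduct.rid k (H ⊗[k] H) (β.lTensor (H ⊗[k] H) z)) e'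
    simpa only [LinearMap.lTensor_tmul, TensorProduct.rid_tmul, h.coord_gen, one_smul]
      using this.symm
  have hss : s * s = s := by
    have e := hX.mul_coact (b ⊗ₜ[k] b)
    rw [tensorYD_coact_triv hg h2 ht h.coact_gen h.coact_gen, h.mul_gen, map_smul, h.coact_gen,
      LinearMap.lTensor_tmul, h.mul_gen, TensorProduct.tmul_smul] at e
    exact (hcancel (smul_right_injective _ hl e)).symm
  have hα : D.antipode s * (g * s) = g := by
    have e := hQ.antipode_alpha s
    rw [hΔ, h.counit_coeff, one_smul, hg.alpha_eq] at e
    exact e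
  -- Multiply S(s) g s = g by s on the right and use s s = s.
  have hgs : g * s = g := by
    calc g * s = D.antipode s * (g * s) * s := by rw [hα]
      _ = D.antipode s * (g * (s * s)) := by simp only [_root_.mul_assoc]
      _ = g := by rw [hss, hα]
  calc s = g * g * s := by rw [hg.sq, _root_.one_mul]
    _ = 1 := by rw [_root_.mul_assoc, hgs, hg.sq]

-- With S(b) = p 1 + r b the left antipode axiom at b reads p = 0 and r + 1 + r l m = 0. Of the two
-- roots left by `mul_self_add`, lm = −1 gives 1 = 0, and lm = −2 gives r = 1.
include hg h2 hX h in
theorem mul_eq_neg_two_and_antipode_gen : l * m = -2 ∧ X.antipode b = b := by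
  have hcoord : ∀ {p r : k}, p • X.one + r • b = 0 → p = 0 ∧ r = 0 := fun {p r} e => by
    constructor
    · have := congrArg X.counit e
      simpa [hX.counit_one, h.counit_gen] using this
    · have := congrArg β e
      simpa [h.coord_one, h.coord_gen] using this
  have hSe : X.antipode X.one = X.one := by
    have := hX.antipode_left X.one
    rwa [hX.comul_one, LinearMap.rTensor_tmul, hX.mul_one, hX.counit_one, one_smul] at this
  have e := hX.antipode_left b
  have hSb := h.eq_add (X.antipode b)
  set p := X.counit (X.antipode b)
  set r := β (X.antipode b)
  rw [h.comul_gen, h.counit_gen, zero_smul] at e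
  simp only [map_add, map_smul, LinearMap.rTensor_tmul, hSe, hX.mul_one, hX.one_mul, hSb,
    TensorProduct.add_tmul, ← TensorProduct.smul_tmul', h.mul_gen] at e
  obtain ⟨hp, hr⟩ := hcoord (p := p) (r := r + 1 + m * (p + r * l)) (by rw [← e]; module)
  have ht : l * m = -2 := by
    have := h.mul_self_add hg h2 hX
    have hf : (l * m + 1) * (l * m + 2) = 0 := by linear_combination this
    rcases mul_eq_zero.mp hf with h' | h'
    · rw [hp] at hr
      exact absurd (show (1 : k) = 0 by linear_combination hr - r * h') one_ne_zero
    · linear_combination h'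
  refine ⟨ht, ?_⟩
  have : r = 1 := by
    rw [hp] at hr
    linear_combination -hr + r * ht
  rw [hSb, hp, this, zero_smul, zero_add, one_smul]

-- The element 1 + m b is group-like with square 1 + m(2 + lm) b = 1. Sending it to the generator of
-- C₂ amounts to b ↦ m⁻¹(`gen` − 1).
include hQ hg h2 hX h in
theorem nonempty_equiv (hB : Module.finrank k B = 2) :
    Nonempty (BraidedHopfEquiv X (trivial D (GroupAlgC2 k))) := by
  obtain ⟨hlm, hSb⟩ := h.mul_eq_neg_two_and_antipode_gen hg h2 hX
  have hl : l ≠ 0 := by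
    rintro rfl
    exact h2 (by linear_combination hlm)
  have hm : m ≠ 0 := by
    rintro rfl
    exact h2 (by linear_combination hlm)
  have hs := h.coeff_eq_one hQ hg h2 hX hl
  have ht := h.act_eq_trivAct hX
  have hSe : X.antipode X.one = X.one := by
    have := hX.antipode_left X.one
    rwa [hX.comul_one, LinearMap.rTensor_tmul, hX.mul_one, hX.counit_one, one_smul] at this
  have : Module.Finite k B := Module.finite_of_finrank_pos (by omega)
  have : Module.Finite k (GroupAlgC2 k) :=
    Module.finite_of_finrank_pos (by rw [GroupAlgC2.finrank_eq]; omega)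
  set c : GroupAlgC2 k := GroupAlgC2.gen k - 1 with hc
  have hcc : c * c = (-2 : k) • c := by
    rw [hc, sub_mul, mul_sub, GroupAlgC2.gen_mul_gen, _root_.one_mul, _root_.mul_one]
    module
  have hΔ1 : (Coalgebra.comul (1 : GroupAlgC2 k) : GroupAlgC2 k ⊗[k] GroupAlgC2 k)
      = 1 ⊗ₜ[k] 1 := Bialgebra.comul_one
  have hΔc : (Coalgebra.comul c : GroupAlgC2 k ⊗[k] GroupAlgC2 k)
      = c ⊗ₜ[k] 1 + 1 ⊗ₜ[k] c + c ⊗ₜ[k] c := by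
    rw [hc, map_sub, GroupAlgC2.comul_gen, hΔ1]
    simp only [TensorProduct.sub_tmul, TensorProduct.tmul_sub]
    abel
  have hεc : (Coalgebra.counit c : k) = 0 := by
    rw [hc, map_sub, GroupAlgC2.counit_gen, Bialgebra.counit_one, sub_self]
  have hSc : HopfAlgebra.antipode k c = c := by
    rw [hc, map_sub, GroupAlgC2.antipode_gen, HopfAlgebra.antipode_one]
  let φ : B →ₗ[k] GroupAlgC2 k := X.counit.smulRight 1 + β.smulRight (m⁻¹ • c)
  have hφ : ∀ z, φ z = X.counit z • 1 + β z • (m⁻¹ • c) := fun _ => rfl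
  have hφe : φ X.one = 1 := by
    rw [hφ, hX.counit_one, h.coord_one, one_smul, zero_smul, add_zero]
  have hφb : φ b = m⁻¹ • c := by
    rw [hφ, h.counit_gen, h.coord_gen, one_smul, zero_smul, zero_add]
  -- The characters of k[C₂] with values 1 and −1 on the generator take φ(z) to ε(z) and to ε(z) − 2
  -- m⁻¹ β(z), which determine z.
  have hinj : Function.Injective φ := by
    refine (injective_iff_map_eq_zero φ).mpr fun z hz => ?_
    have e1 := congrArg (GroupAlgC2.lift (1 : k) (_root_.one_mul 1)) hz
    have e2 := congrArg (GroupAlgC2.lift (-1 : k) (by rw [neg_mul_neg, _root_.one_mul])) hz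
    simp only [hφ, hc, map_add, map_smul, map_sub, map_one, map_zero, GroupAlgC2.lift_gen,
      smul_eq_mul, _root_.mul_one, sub_self, mul_zero, add_zero] at e1 e2
    rw [e1, zero_add] at e2
    have e3 : β z = 0 := by
      have : β z * (m⁻¹ * 2) = 0 := by linear_combination -e2
      exact (mul_eq_zero.mp this).resolve_right (mul_ne_zero (inv_ne_zero hm) h2)
    rw [h.eq_add z, e1, e3, zero_smul, zero_smul, add_zero]
  let e : B ≃ₗ[k] GroupAlgC2 k :=
    LinearEquiv.ofInjectiveOfFinrankEq φ hinj (by rw [hB, GroupAlgC2.finrank_eq])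
  have hee : e X.one = 1 := hφe
  have heb : e b = m⁻¹ • c := hφb
  have hact : ∀ a z, (trivial D (GroupAlgC2 k)).act a z = D.counit a • z := fun _ _ => rfl
  have hmul : ∀ a z, (trivial D (GroupAlgC2 k)).mul (a ⊗ₜ[k] z) = a * z := fun _ _ => rfl
  refine ⟨⟨e, fun a z => ?_, fun z => ?_, fun y z => ?_, hee, fun z => ?_, fun z => ?_,
    fun z => ?_⟩⟩
  · rw [ht, trivAct_apply, map_smul, hact]
  · change (1 : H) ⊗ₜ[k] e z = _
    rw [h.eq_add z]
    simp only [map_add, map_smul, hX.one_coact, h.coact_gen, hs, LinearMap.lTensor_tmul,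
      LinearEquiv.coe_coe, TensorProduct.tmul_add, TensorProduct.tmul_smul]
  · rw [hmul, h.eq_add y, h.eq_add z]
    simp only [map_add, map_smul, TensorProduct.add_tmul, TensorProduct.tmul_add,
      TensorProduct.tmul_smul, ← TensorProduct.smul_tmul', hX.one_mul, hX.mul_one, h.mul_gen, hee,
      heb, add_mul, mul_add, smul_mul_assoc, mul_smul_comm, hcc, _root_.one_mul, _root_.mul_one]
    -- This matches b b = l b with (m⁻¹ c)² = −2 m⁻¹ (m⁻¹ c).
    have : l = -2 * m⁻¹ := by
      rw [← hlm, mul_assoc, mul_inv_cancel₀ hm, _root_.mul_one]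
    rw [this]
    module
  · change Coalgebra.comul (e z) = _
    rw [h.eq_add z]
    simp only [map_add, map_smul, hX.comul_one, h.comul_gen, TensorProduct.map_tmul, hee, heb,
      LinearEquiv.coe_coe, hΔ1, hΔc, TensorProduct.tmul_smul, ← TensorProduct.smul_tmul',
      smul_add, smul_smul]
    match_scalars <;> field_simp
  · change Coalgebra.counit (e z) = _
    nth_rw 1 [h.eq_add z]
    rw [map_add, map_smul, map_smul, hee, heb, map_add, map_smul, map_smul, map_smul, hεc,
      Bialgebra.counit_one, smul_zero, smul_zero, add_zero, smul_eq_mul, _root_.mul_one]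
  · change _ = HopfAlgebra.antipode k (e z)
    rw [h.eq_add z]
    simp only [map_add, map_smul, hSe, hSb, hee, heb, HopfAlgebra.antipode_one, hSc]

end Trivial

end IsRankTwo

/-- If every character of `H` is the counit or maps `g` to `-1` and squares to the counit, then
every braided Hopf algebra of rank two over `H` is the group algebra of the group of order two,
with the trivial action and coaction. -/
theorem nonempty_equiv_of_finrank_eq_two [D.IsMult] {g : H} (hQ : D.IsQuasiHopf)
    (hg : D.IsSignTwisted g) (h2 : (2 : k) ≠ 0)
    (hchar : ∀ χ : H →ₐ[k] k,
      χ = D.counitHom ∨ χ g = -1 ∧ ∀ a, tensorSq χ (D.comul a) = D.counit a)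
    (hB : Module.finrank k B = 2) (hX : X.IsBraidedHopf D) :
    Nonempty (BraidedHopfEquiv X (trivial D (GroupAlgC2 k))) := by
  obtain ⟨b, β, χ, s, l, m, h⟩ := exists_isRankTwo hX hB
  obtain rfl | ⟨hχ, hχχ⟩ := hchar χ
  · exact h.nonempty_equiv hQ hg h2 hX hB
  · exact (h.apply_ne_neg_one hg h2 hX hχ hχχ).elim

end BraidedHopfData

/-! ### Characters of H_q(8) and H(32) -/

open QuasiHopfData

/-- Each of the three terms of Δ(x) contains a factor x. -/
theorem tensorSq_comulGen {k : Type u} {H : Type v} [Field k] [Ring H] [Algebra k H]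
    (χ : H →ₐ[k] k) (q : k) (g : H) {x : H} (hx : χ x = 0) :
    tensorSq χ (comulGen q g x) = 0 := by
  simp only [comulGen, map_add, tensorSq_tmul, map_mul, hx, mul_zero, zero_mul, add_zero]

theorem apply_eq_zero_of_pow_four {k : Type u} {H : Type v} [Field k] [Ring H] [Algebra k H]
    (χ : H →ₐ[k] k) {x : H} (hx : x ^ 4 = 0) : χ x = 0 := by
  have : χ x ^ 4 = 0 := by rw [← map_pow, hx, map_zero]
  exact (pow_eq_zero_iff (by norm_num)).mp this

variable {k : Type u} [Field k]

/-- A character kills the nilpotent x and is ±1 on g. The value 1 gives the counit; for the value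
−1, the convolution square is computed on the generators. -/
theorem H8.character_cases (q : k) (hq : IsPrimitiveRoot q 4) (χ : H8 k →ₐ[k] k) :
    χ = (H8.data q hq).counitHom ∨
      χ (H8.g k) = -1 ∧ ∀ a, tensorSq χ ((H8.data q hq).comul a) = (H8.data q hq).counit a := by
  have hx := apply_eq_zero_of_pow_four χ (H8.x_pow k)
  have hg : χ (H8.g k) * χ (H8.g k) = 1 := by rw [← map_mul, H8.g_sq, map_one]
  refine (mul_self_eq_one_iff.mp hg).imp (fun h => ?_) (fun h => ⟨h, fun a => ?_⟩)
  · refine AlgHom.ext_of_adjoin_eq_top H8.adjoin_eq_top ?_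
    rintro _ (rfl | rfl)
    · rw [h, counitHom_apply, H8.counit_g]
    · rw [hx, counitHom_apply, H8.counit_x]
  · have : (tensorSq χ).comp (H8.data q hq).comulHom = (H8.data q hq).counitHom := by
      refine AlgHom.ext_of_adjoin_eq_top H8.adjoin_eq_top ?_
      rintro _ (rfl | rfl)
      · rw [AlgHom.comp_apply, comulHom_apply, H8.comul_g, tensorSq_tmul, hg, counitHom_apply,
          H8.counit_g]
      · rw [AlgHom.comp_apply, comulHom_apply, H8.comul_x, tensorSq_comulGen χ q _ hx,
          counitHom_apply, H8.counit_x]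
    exact DFunLike.congr_fun this a

theorem H32.character_cases {q : k} (hq : IsPrimitiveRoot q 4) (χ : H32 q →ₐ[k] k) :
    χ = (H32.data hq).counitHom ∨
      χ (H32.g q) = -1 ∧ ∀ a, tensorSq χ ((H32.data hq).comul a) = (H32.data hq).counit a := by
  have hx := apply_eq_zero_of_pow_four χ (H32.x_pow q)
  have hy := apply_eq_zero_of_pow_four χ (H32.y_pow q)
  have hg : χ (H32.g q) * χ (H32.g q) = 1 := by rw [← map_mul, H32.g_sq, map_one]
  refine (mul_self_eq_one_iff.mp hg).imp (fun h => ?_) (fun h => ⟨h, fun a => ?_⟩)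
  · refine AlgHom.ext_of_adjoin_eq_top H32.adjoin_eq_top ?_
    rintro _ (rfl | rfl | rfl)
    · rw [h, counitHom_apply, H32.counit_g]
    · rw [hx, counitHom_apply, H32.counit_x]
    · rw [hy, counitHom_apply, H32.counit_y]
  · have : (tensorSq χ).comp (H32.data hq).comulHom = (H32.data hq).counitHom := by
      refine AlgHom.ext_of_adjoin_eq_top H32.adjoin_eq_top ?_
      rintro _ (rfl | rfl | rfl)
      · rw [AlgHom.comp_apply, comulHom_apply, H32.comul_g, tensorSq_tmul, hg, counitHom_apply,
          H32.counit_g]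
      · rw [AlgHom.comp_apply, comulHom_apply, H32.comul_x, tensorSq_comulGen χ q _ hx,
          counitHom_apply, H32.counit_x]
      · rw [AlgHom.comp_apply, comulHom_apply, H32.comul_y, tensorSq_comulGen χ (-q) _ hy,
          counitHom_apply, H32.counit_y]
    exact DFunLike.congr_fun this a

end

end

end QH

theorem mainTheorem12 {k : Type u} [Field k] (q : k) (hq : IsPrimitiveRoot q 4) :
    -- the algebras in question are quasi-Hopf algebras
    ((QH.H8.data q hq).IsQuasiHopf ∧ (QH.H32.data hq).IsQuasiHopf ∧
      (QH.H16.data q hq).IsQuasiHopf) ∧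
    -- the only admissible pair for `H_q(16)`, and the resulting quasi-Hopf algebra
    (∃ σ₀ : QH.H16 k →ₐ[k] k,
      (σ₀ (QH.H16.g₁ k) = 1 ∧ σ₀ (QH.H16.g₂ k) = -1 ∧ σ₀ (QH.H16.x k) = 0) ∧
      (∀ (σ : QH.H16 k →ₐ[k] k) (v : QH.H16 k),
        (QH.H16.data q hq).IsAdmissible σ v ↔ σ = σ₀ ∧ v = QH.H16.g₂ k) ∧
      ((QH.H16.data q hq).thetaData σ₀ (QH.H16.g₂ k)).IsQuasiHopf ∧
      Module.finrank k ((QH.H16.data q hq).Theta σ₀) = 32 ∧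
      Nonempty (QH.QuasiHopfEquiv ((QH.H16.data q hq).thetaData σ₀ (QH.H16.g₂ k))
        ((QH.H4.data k).tensor (QH.H8.data q hq)))) ∧
    -- two-dimensional braided Hopf algebras over `H_q(8)`
    ((QH.BraidedHopfData.trivial (QH.H8.data q hq) (QH.GroupAlgC2 k)).IsBraidedHopf
        (QH.H8.data q hq) ∧
      ∀ (B : Type w) [AddCommGroup B] [Module k B] (X : QH.BraidedHopfData k (QH.H8 k) B),
        Module.finrank k B = 2 → X.IsBraidedHopf (QH.H8.data q hq) →
          Nonempty (QH.BraidedHopfEquiv X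
            (QH.BraidedHopfData.trivial (QH.H8.data q hq) (QH.GroupAlgC2 k)))) ∧
    -- two-dimensional braided Hopf algebras over `H(32)`
    ((QH.BraidedHopfData.trivial (QH.H32.data hq) (QH.GroupAlgC2 k)).IsBraidedHopf
        (QH.H32.data hq) ∧
      ∀ (B : Type w) [AddCommGroup B] [Module k B] (X : QH.BraidedHopfData k (QH.H32 q) B),
        Module.finrank k B = 2 → X.IsBraidedHopf (QH.H32.data hq) →
          Nonempty (QH.BraidedHopfEquiv X
            (QH.BraidedHopfData.trivial (QH.H32.data hq) (QH.GroupAlgC2 k)))) := by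
  have h2 := QH.two_ne_zero_of_primitive hq
  have h8 := QH.H8.isQuasiHopf q hq
  have h32 := QH.H32.isQuasiHopf hq
  have s8 := QH.H8.isSignTwisted q hq
  have s32 := QH.H32.isSignTwisted hq
  exact ⟨⟨h8, h32, QH.H16.isQuasiHopf q hq⟩,
    ⟨QH.H16.character k, ⟨QH.H16.character_g₁, QH.H16.character_g₂, QH.H16.character_x⟩,
      QH.H16.isAdmissible_iff q hq, QH.H16.theta_isQuasiHopf q hq, QH.H16.theta_finrank q hq,
      ⟨QH.H16.thetaQuasiHopfEquiv q hq⟩⟩,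
    ⟨QH.BraidedHopfData.trivial_isBraidedHopf h8 s8 h2, fun B _ _ X hB hX =>
      QH.BraidedHopfData.nonempty_equiv_of_finrank_eq_two h8 s8 h2
        (QH.H8.character_cases q hq) hB hX⟩,
    ⟨QH.BraidedHopfData.trivial_isBraidedHopf h32 s32 h2, fun B _ _ X hB hX =>
      QH.BraidedHopfData.nonempty_equiv_of_finrank_eq_two h32 s32 h2
        (QH.H32.character_cases hq) hB hX⟩⟩
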